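/- Fix a non-principal ultrafilter $\omega$ on $\mathbb{N}$. A tracial von Neumann algebra is a von Neumann algebra $N\subset B(\mathcal K)$ together with a faithful normal tracial state $\tau_N$; put $\|x\|_2=\tau_N(x^*x)^{1/2}$. A II$_1$ factor is an infinite dimensional tracial von Neumann algebra with trivial center. It is separable if it is separable in $\|\cdot\|_2$. An $M$-$M$-bimodule is a Hilbert space $\mathcal H$ with a normal unital $*$-homomorphism and a normal unital $*$-anti-homomorphism from $M$ to $B(\mathcal H)$ whose images commute, written $\xi\mapsto x\xi$ and $\xi\mapsto\xi x$. A vector $\xi\in\mathcal H$ is tracial if $\langle \xi,x\xi\rangle=\tau(x)=\langle\xi,\xi x\rangle$ for all $x\in M$, and it is central if $x\xi=\xi x$ for all $x\in M$. The tracial von Neumann algebra $(M,\tau)$ has property (T) if for every $\varepsilon'>0$ there are a finite set $F\subset M$ and $\varepsilon>0$ such that, for every $M$-$M$-bimodule $\mathcal H$ and every tracial unit vector $\xi\in\mathcal H$ with $\max_{x\in F}\|x\xi-\xi x\|\le\varepsilon$, there is a central vector $\eta\in\mathcal H$ with $\|\eta-\xi\|\le\varepsilon'$. The ultrapower $N^\omega$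 of $(N,\tau_N)$ is the algebra of operator-norm bounded sequences $(x_n)$ in $N$ modulo the ideal of those with $\lim_{n\to\omega}\tau_N(x_n^*x_n)=0$. An inclusion $M\subset\tilde M$ identifies $M$ with a von Neumann subalgebra of $\tilde M$ having the same unit (that is, it is an injective normal unital $*$-homomorphism), and elements of $M$ are viewed in $\tilde M^\omega$ as constant sequences. For $A\subset\tilde M$, $A^\omega\subset\tilde M^\omega$ is the set of classes of bounded sequences from $A$. The inclusion has weak spectral gap if $M'\cap\tilde M^\omega=(M'\cap\tilde M)^\omega$. Theorem. Let $M$ be a separable II$_1$ factor. Then $M$ has property (T) if and only if every inclusion $M\subset\tilde M$ of $M$ into a tracial von Neumann algebra $\tilde M$ has weak spectral gap, i.e. $M'\cap\tilde M^\omega=(M'\cap\tilde M)^\omega$. -/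

import Mathlib

open Filter Topology
open scoped ComplexOrder

universe u

namespace TracialVN

/-! ### Concrete von Neumann algebras, normality, tracial states -/

section Basic

variable {H : Type u} [NormedAddCommGroup H] [InnerProductSpace ℂ H] [CompleteSpace H]

instance instSMulMemClass : SMulMemClass (VonNeumannAlgebra H) ℂ (H →L[ℂ] H) where
  smul_mem {s} c {_} ha := s.toStarSubalgebra.smul_mem ha c

/-- The weak operator topology on a von Neumann algebra `M ⊆ B(H)`. -/
noncomputable abbrev wotTopology (M : VonNeumannAlgebra H) : TopologicalSpace M :=
  TopologicalSpace.induced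
    (fun x : M => (ContinuousLinearMapWOT.ofCLM (x : H →L[ℂ] H) : H →WOT[ℂ] H)) inferInstance

/-- A scalar-valued (linear) function on a von Neumann algebra is normal if its restriction to the
closed operator-norm unit ball is continuous for the weak operator topology. On bounded sets the
weak and the ultraweak operator topologies agree, so for linear functionals this is the same as
ultraweak continuity. -/
def IsNormalFun (M : VonNeumannAlgebra H) (f : M → ℂ) : Prop :=
  @ContinuousOn M ℂ (wotTopology M) _ f {x : M | ‖(x : H →L[ℂ] H)‖ ≤ 1}

/-- A faithful normal tracial state on a von Neumann algebra. A pair consisting of a von Neumann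
algebra and such a state is a tracial von Neumann algebra. -/
structure FaithfulNormalTrace (M : VonNeumannAlgebra H) where
  /-- the underlying linear functional -/
  toLin : M →ₗ[ℂ] ℂ
  map_one : toLin 1 = 1
  nonneg : ∀ x : M, (x : H →L[ℂ] H).IsPositive → 0 ≤ toLin x
  tracial : ∀ x y : M, toLin (x * y) = toLin (y * x)
  faithful : ∀ x : M, toLin (star x * x) = 0 → x = 0
  normal : IsNormalFun M toLin

/-- `M` is a II₁ factor: an infinite dimensional tracial von Neumann algebra with trivial center.
(The trace is the datum `τ`, which is unique.) -/
def IsII1Factor (M : VonNeumannAlgebra H) (_τ : FaithfulNormalTrace M) : Prop :=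
  ¬ FiniteDimensional ℂ M ∧ ∀ z ∈ Set.center M, ∃ c : ℂ, z = c • (1 : M)

/-- The 2-norm `‖x‖₂ = τ(x* x)^{1/2}`. -/
noncomputable def norm2 {M : VonNeumannAlgebra H} (τ : FaithfulNormalTrace M) (x : M) : ℝ :=
  Real.sqrt (τ.toLin (star x * x)).re

/-- `(M, τ)` is separable: `M` is separable for the 2-norm, i.e. the Hilbert space `L²(M, τ)` is
separable. -/
def IsSeparableVN {M : VonNeumannAlgebra H} (τ : FaithfulNormalTrace M) : Prop :=
  ∃ D : Set M, D.Countable ∧ ∀ (x : M) (ε : ℝ), 0 < ε → ∃ d ∈ D, norm2 τ (x - d) < ε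

end Basic

/-! ### Bimodules and property (T) -/

section PropertyT

variable {H : Type u} [NormedAddCommGroup H] [InnerProductSpace ℂ H] [CompleteSpace H]

/-- An `M`-`M`-bimodule structure on the Hilbert space `K`: a normal unital *-homomorphism `left`
and a normal unital *-anti-homomorphism `right` (a *-homomorphism on the opposite algebra) from `M`
to `B(K)` whose images commute. The vector `x ξ` is `left x ξ` and `ξ x` is `right (op x) ξ`. -/
structure Bimodule (M : VonNeumannAlgebra H) (K : Type u) [NormedAddCommGroup K]
    [InnerProductSpace ℂ K] [CompleteSpace K] where
  /-- the left action -/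
  left : M →⋆ₐ[ℂ] (K →L[ℂ] K)
  /-- the right action -/
  right : (M)ᵐᵒᵖ →⋆ₐ[ℂ] (K →L[ℂ] K)
  left_normal : ∀ ξ η : K, IsNormalFun M (fun x => inner ℂ ξ (left x η))
  right_normal : ∀ ξ η : K, IsNormalFun M (fun x => inner ℂ ξ (right (MulOpposite.op x) η))
  comm : ∀ x y : M, Commute (left x) (right (MulOpposite.op y))

namespace Bimodule

variable {M : VonNeumannAlgebra H} {K : Type u} [NormedAddCommGroup K]
  [InnerProductSpace ℂ K] [CompleteSpace K]

/-- `ξ` is tracial: `⟨ξ, x ξ⟩ = τ(x)` and `⟨ξ, ξ y⟩ = τ(y)`. By linearity it does not matter whether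
this is asked of positive elements or of all elements. -/
def IsTracial (B : Bimodule M K) (τ : FaithfulNormalTrace M) (ξ : K) : Prop :=
  (∀ x : M, inner ℂ ξ (B.left x ξ) = τ.toLin x) ∧
    ∀ y : M, inner ℂ ξ (B.right (MulOpposite.op y) ξ) = τ.toLin y

/-- `ξ` is `(F, ε)`-almost central: `‖x ξ - ξ x‖ ≤ ε` for all `x ∈ F`. -/
def IsAlmostCentral (B : Bimodule M K) (F : Finset M) (ε : ℝ) (ξ : K) : Prop :=
  ∀ x ∈ F, ‖B.left x ξ - B.right (MulOpposite.op x) ξ‖ ≤ ε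

/-- `η` is central: `x η = η x` for all `x ∈ M`. -/
def IsCentral (B : Bimodule M K) (η : K) : Prop :=
  ∀ x : M, B.left x η = B.right (MulOpposite.op x) η

end Bimodule

/-- Property (T) of the tracial von Neumann algebra `(M, τ)`: for every `ε' > 0` there are a finite
set `F ⊆ M` and `ε > 0` such that, in every `M`-`M`-bimodule, every tracial `(F, ε)`-almost central
unit vector is within `ε'` of a central vector. -/
def HasPropertyT {M : VonNeumannAlgebra H} (τ : FaithfulNormalTrace M) : Prop :=
  ∀ ε' : ℝ, 0 < ε' → ∃ (F : Finset M) (ε : ℝ), 0 < ε ∧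
    ∀ (K : Type u) [NormedAddCommGroup K] [InnerProductSpace ℂ K] [CompleteSpace K]
      (B : Bimodule M K) (ξ : K),
      ‖ξ‖ = 1 → B.IsTracial τ ξ → B.IsAlmostCentral F ε ξ →
        ∃ η : K, B.IsCentral η ∧ ‖η - ξ‖ ≤ ε'

end PropertyT

/-! ### The ultrapower -/

section Ultrapower

variable {K : Type u} [NormedAddCommGroup K] [InnerProductSpace ℂ K] [CompleteSpace K]

/-- The algebra of operator-norm bounded sequences in `N`. -/
def boundedSeq (N : VonNeumannAlgebra K) : Subalgebra ℂ (ℕ → N) where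
  carrier := {x | ∃ C : ℝ, ∀ n, ‖(x n : K →L[ℂ] K)‖ ≤ C}
  mul_mem' := by
    rintro a b ⟨C, hC⟩ ⟨D, hD⟩
    refine ⟨C * D, fun n => ?_⟩
    have h1 := norm_mul_le (a n : K →L[ℂ] K) (b n : K →L[ℂ] K)
    refine le_trans h1 (mul_le_mul (hC n) (hD n) (norm_nonneg _) ((norm_nonneg _).trans (hC n)))
  add_mem' := by
    rintro a b ⟨C, hC⟩ ⟨D, hD⟩
    refine ⟨C + D, fun n => ?_⟩
    exact (norm_add_le (a n : K →L[ℂ] K) (b n : K →L[ℂ] K)).trans (add_le_add (hC n) (hD n))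
  algebraMap_mem' c := ⟨‖algebraMap ℂ (K →L[ℂ] K) c‖, fun _ => le_rfl⟩

variable {N : VonNeumannAlgebra K}

theorem trace_star_mul_self_nonneg (σ : FaithfulNormalTrace N) (x : N) :
    0 ≤ σ.toLin (star x * x) := by
  refine σ.nonneg _ ?_
  have h : ((star x * x : N) : K →L[ℂ] K) =
      ContinuousLinearMap.adjoint (x : K →L[ℂ] K) ∘L (x : K →L[ℂ] K) := rfl
  rw [h]
  exact ContinuousLinearMap.isPositive_adjoint_comp_self _

theorem trace_add_le (σ : FaithfulNormalTrace N) (x y : N) :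
    σ.toLin (star (x + y) * (x + y)) ≤
      2 * (σ.toLin (star x * x) + σ.toLin (star y * y)) := by
  have h := trace_star_mul_self_nonneg σ (x - y)
  have e : star (x + y) * (x + y) + star (x - y) * (x - y) =
      (2 : ℂ) • (star x * x + star y * y) := by
    simp only [star_add, star_sub, two_smul]
    noncomm_ring
  have e' := congrArg σ.toLin e
  simp only [map_add, map_smul, smul_eq_mul] at e'
  rw [← e']
  exact le_add_of_nonneg_right h

theorem isPositive_aux (a b : K →L[ℂ] K) :
    (((‖a‖ ^ 2 : ℝ) : ℂ) • (star b * b) - star (a * b) * (a * b)).IsPositive := by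
  rw [ContinuousLinearMap.isPositive_def']
  refine ⟨?_, fun v => ?_⟩
  · have h1 : IsSelfAdjoint (((‖a‖ ^ 2 : ℝ) : ℂ)) := by
      rw [isSelfAdjoint_iff]; exact Complex.conj_ofReal _
    exact (h1.smul (IsSelfAdjoint.star_mul_self b)).sub (IsSelfAdjoint.star_mul_self _)
  · have e (c : K →L[ℂ] K) : inner ℂ ((star c * c) v) v = ((‖c v‖ ^ 2 : ℝ) : ℂ) := by
      rw [ContinuousLinearMap.star_eq_adjoint, mul_apply_eq_comp,
        ContinuousLinearMap.adjoint_inner_left, inner_self_eq_norm_sq_to_K]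
      norm_cast
    rw [ContinuousLinearMap.reApplyInnerSelf_apply]
    simp only [sub_apply, smul_apply, inner_sub_left,
      inner_smul_left, e, Complex.conj_ofReal]
    rw [← Complex.ofReal_mul, ← Complex.ofReal_sub]
    simp only [RCLike.re_to_complex, Complex.ofReal_re]
    have h3 : ‖a (b v)‖ ^ 2 ≤ (‖a‖ * ‖b v‖) ^ 2 :=
      pow_le_pow_left₀ (norm_nonneg _) (a.le_opNorm _) 2
    rw [mul_apply_eq_comp]
    nlinarith [h3]

theorem trace_mul_le (σ : FaithfulNormalTrace N) (x y : N) :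
    σ.toLin (star (x * y) * (x * y)) ≤
      ((‖(x : K →L[ℂ] K)‖ ^ 2 : ℝ) : ℂ) * σ.toLin (star y * y) := by
  have key := σ.nonneg (((‖(x : K →L[ℂ] K)‖ ^ 2 : ℝ) : ℂ) • (star y * y)
      - star (x * y) * (x * y)) (isPositive_aux (x : K →L[ℂ] K) (y : K →L[ℂ] K))
  rw [map_sub, map_smul, smul_eq_mul] at key
  exact sub_nonneg.mp key

theorem trace_mul_star (σ : FaithfulNormalTrace N) (x : N) :
    σ.toLin (star (star x) * star x) = σ.toLin (star x * x) := by
  rw [star_star, σ.tracial]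

theorem tendsto_zero_of_le {l : Filter ℕ} {f g : ℕ → ℂ} (h0 : ∀ n, 0 ≤ f n)
    (h1 : ∀ n, f n ≤ g n) (hg : Tendsto g l (𝓝 0)) : Tendsto f l (𝓝 0) := by
  refine squeeze_zero_norm (fun n => ?_) (tendsto_zero_iff_norm_tendsto_zero.mp hg)
  exact CStarAlgebra.norm_le_norm_of_nonneg_of_le (h0 n) (h1 n)

/-- The ideal `I_ω` of bounded sequences `x` with `lim_ω τ(xₙ* xₙ) = 0`. -/
noncomputable def nullIdeal (σ : FaithfulNormalTrace N) (ω : Ultrafilter ℕ) :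
    TwoSidedIdeal (boundedSeq N) :=
  TwoSidedIdeal.mk'
    {x | Tendsto (fun n => σ.toLin (star (x.1 n) * x.1 n)) ω (𝓝 0)}
    (by simp)
    (by
      intro x y hx hy
      have h := (hx.add hy).const_mul (2 : ℂ)
      rw [add_zero, mul_zero] at h
      exact tendsto_zero_of_le (fun n => trace_star_mul_self_nonneg σ _)
        (fun n => trace_add_le σ _ _) h)
    (by
      intro x hx
      simpa using hx)
    (by
      rintro ⟨x, C, hC⟩ y hy
      have h := hy.const_mul ((C ^ 2 : ℝ) : ℂ)
      rw [mul_zero] at h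
      refine tendsto_zero_of_le (fun n => trace_star_mul_self_nonneg σ _)
        (fun n => (trace_mul_le σ _ _).trans ?_) h
      refine mul_le_mul_of_nonneg_right ?_ (trace_star_mul_self_nonneg σ _)
      exact_mod_cast pow_le_pow_left₀ (norm_nonneg _) (hC n) 2)
    (by
      rintro x ⟨y, C, hC⟩ hx
      have h := hx.const_mul ((C ^ 2 : ℝ) : ℂ)
      rw [mul_zero] at h
      refine tendsto_zero_of_le (fun n => trace_star_mul_self_nonneg σ _) (fun n => ?_) h
      have h1 := trace_mul_le σ (star (y n)) (star (x.1 n))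
      rw [← star_mul, trace_mul_star, trace_mul_star] at h1
      refine h1.trans (mul_le_mul_of_nonneg_right ?_ (trace_star_mul_self_nonneg σ _))
      have h2 : ‖((star (y n) : N) : K →L[ℂ] K)‖ = ‖(y n : K →L[ℂ] K)‖ :=
        norm_star (y n : K →L[ℂ] K)
      rw [h2]
      exact_mod_cast pow_le_pow_left₀ (norm_nonneg _) (hC n) 2)

/-- The ultrapower `N^ω`: bounded sequences modulo `I_ω`. -/
noncomputable abbrev Ultrapower (σ : FaithfulNormalTrace N) (ω : Ultrafilter ℕ) : Type u :=
  (nullIdeal σ ω).ringCon.Quotient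

/-- The class in `N^ω` of a bounded sequence. -/
noncomputable def Ultrapower.mk (σ : FaithfulNormalTrace N) (ω : Ultrafilter ℕ) :
    boundedSeq N →+* Ultrapower σ ω :=
  (nullIdeal σ ω).ringCon.mk'

/-- The constant sequence with value `x`. -/
def constSeq (x : N) : boundedSeq N :=
  ⟨fun _ => x, ‖(x : K →L[ℂ] K)‖, fun _ => le_rfl⟩

/-- For a subset `A ⊆ N`, the set `A^ω ⊆ N^ω` of classes of bounded sequences from `A`. -/
def ultraSet (σ : FaithfulNormalTrace N) (ω : Ultrafilter ℕ) (A : Set N) :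
    Set (Ultrapower σ ω) :=
  Ultrapower.mk σ ω '' {x | ∀ n, x.1 n ∈ A}

end Ultrapower

/-! ### Inclusions and weak spectral gap -/

section Gap

variable {H : Type u} [NormedAddCommGroup H] [InnerProductSpace ℂ H] [CompleteSpace H]
  {K : Type u} [NormedAddCommGroup K] [InnerProductSpace ℂ K] [CompleteSpace K]

/-- An inclusion of von Neumann algebras: an injective normal unital *-homomorphism `M → N`, so that
`M` is identified with a von Neumann subalgebra of `N` containing the unit of `N`. -/
structure Inclusion (M : VonNeumannAlgebra H) (N : VonNeumannAlgebra K) where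
  /-- the underlying unital *-homomorphism -/
  toHom : M →⋆ₐ[ℂ] N
  injective : Function.Injective toHom
  normal : ∀ ξ η : K, IsNormalFun M (fun x => inner ℂ ξ ((toHom x : K →L[ℂ] K) η))

/-- The inclusion `M ⊆ N` has weak spectral gap (with respect to `ω`):
`M' ∩ N^ω = (M' ∩ N)^ω`, where `M` sits in `N^ω` as constant sequences. -/
def HasWeakSpectralGap {M : VonNeumannAlgebra H} {N : VonNeumannAlgebra K}
    (ι : Inclusion M N) (σ : FaithfulNormalTrace N) (ω : Ultrafilter ℕ) : Prop :=
  Set.centralizer (Set.range fun x : M => Ultrapower.mk σ ω (constSeq (ι.toHom x))) =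
    ultraSet σ ω (Set.centralizer (Set.range ι.toHom))

end Gap

end TracialVN

namespace TracialVN

/-! ### Positive functionals on C*-algebras -/

section CStar

variable {A : Type*} [CStarAlgebra A]

/-! Both directions translate between almost central vectors in bimodules and almost commuting
elements of algebras containing M.

Weak spectral gap implies (T). If (T) fails, there are bimodules with tracial unit vectors ξₙ that
become asymptotically central but stay at distance more than ε' from every central vector. By a
Radon-Nikodym theorem for the trace, the coefficient (x, y) ↦ ⟨ξₙ, xξₙy⟩ is τ(Φₙ(x)y) for a unital
completely positive Φₙ; averaging with its τ-adjoint gives a τ-symmetric φₙ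
(`Bimodule.exists_covariance`). Operator-valued semicircular elements Sₙ with covariances φₙ act on
one Fock space over M. They commute with their right-handed analogues, so the vacuum Ω is a cyclic
trace vector for the commutant of the right operators, and this commutant is a tracial von Neumann
algebra containing M and all Sₙ (`FockSpace.commute_semi_rsemi`, `inner_mul_comm`,
`eq_zero_of_apply_eq_zero`). The bounded sequence (Sₙ) asymptotically commutes with M because SₙΩ
carries the symmetrised coefficient of ξₙ (`Bimodule.norm_commutator_semi_le`). Weak spectral gap
supplies yₙ commuting with M and 2-norm close to Sₙ along ω. A bimodule map of norm at most √2 takes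
SₙΩ to ξₙ (`Bimodule.exists_intertwiner`); it takes yₙΩ to a central vector, which for some n is too
close to ξₙ.

(T) implies weak spectral gap. L²(N) is an M-M-bimodule, and since M is a factor the trace of N
restricts to τ (`trace_unique`), so unitaries of N are tracial vectors. A self-adjoint a that almost
commutes with M is replaced by its Cayley transform, a unitary that almost commutes with M; (T) puts
a central vector nearby, so conjugation by unitaries of M barely moves the Cayley transform, and
hence barely moves a (`Inclusion.exists_norm_conj_sub_le`). The element of minimal 2-norm in a
suitable invariant convex set of bounded elements then commutes with M and is close to a
(`Inclusion.exists_mem_centralizer_of_conj`). General elements split into real and imaginary parts,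
and bounded sequences are treated term by term. -/

theorem exists_star_mul_self_norm_sub (a : A) :
    ∃ b : A, ((‖a‖ ^ 2 : ℝ) : ℂ) • (1 : A) - star a * a = star b * b := by
  let _ := CStarAlgebra.spectralOrder A
  have _ := CStarAlgebra.spectralOrderedRing A
  have h : 0 ≤ ((‖a‖ ^ 2 : ℝ) : ℂ) • (1 : A) - star a * a := by
    rw [sub_nonneg]
    have h := (IsSelfAdjoint.star_mul_self a).le_algebraMap_norm_self
    rw [CStarRing.norm_star_mul_self, ← sq] at h
    refine h.trans (le_of_eq ?_)
    rw [Algebra.algebraMap_eq_smul_one, Complex.coe_smul]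
  exact CStarAlgebra.nonneg_iff_eq_star_mul_self.mp h

theorem span_star_mul_self : Submodule.span ℂ (Set.range fun y : A => star y * y) = ⊤ := by
  let _ := CStarAlgebra.spectralOrder A
  have _ := CStarAlgebra.spectralOrderedRing A
  rw [← CStarAlgebra.span_nonneg]
  congr 1
  ext a
  rw [Set.mem_ofPred, CStarAlgebra.nonneg_iff_eq_star_mul_self]
  simp only [Set.mem_range, eq_comm]

/-- Positive elements are written as squares throughout, so that no order on `A` has to be fixed
outside the proofs. -/
theorem exists_posPart_negPart {a : A} (ha : IsSelfAdjoint a) :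
    ∃ p q : A, a = star p * p - star q * q ∧ star p * p * (star q * q) = 0 ∧
      ‖star p * p‖ ≤ ‖a‖ := by
  let _ := CStarAlgebra.spectralOrder A
  have _ := CStarAlgebra.spectralOrderedRing A
  obtain ⟨p, hp⟩ := CStarAlgebra.nonneg_iff_eq_star_mul_self.mp (CFC.posPart_nonneg a)
  obtain ⟨q, hq⟩ := CStarAlgebra.nonneg_iff_eq_star_mul_self.mp (CFC.negPart_nonneg a)
  refine ⟨p, q, ?_, ?_, ?_⟩
  · rw [← hp, ← hq, CFC.posPart_sub_negPart a ha]
  · rw [← hp, ← hq, CFC.posPart_mul_negPart]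
  · rw [← hp]; exact CStarAlgebra.norm_posPart_le a

variable {T : A →ₗ[ℂ] ℂ}

/-- Polarisation: values at squares are real, so the cross terms at the pairs (1, x) and (1, ix) are
real, which fixes the imaginary and real parts of T(x*) respectively. -/
theorem map_star_of_nonneg (hT : ∀ x, 0 ≤ T (star x * x)) (x : A) :
    T (star x) = star (T x) := by
  have key : ∀ y z : A, T (star y * z) + T (star z * y) =
      star (T (star y * z) + T (star z * y)) := by
    intro y z
    have h := (hT (y + z)).isSelfAdjoint.star_eq
    have h1 := (hT y).isSelfAdjoint.star_eq
    have h2 := (hT z).isSelfAdjoint.star_eq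
    simp only [star_add, add_mul, mul_add, map_add] at h ⊢
    linear_combination -h + h1 + h2
  have h1 := key 1 x
  have h2 := key 1 (Complex.I • x)
  simp only [star_one, one_mul, mul_one, star_smul, map_smul, smul_eq_mul, star_add, star_mul',
    Complex.star_def, Complex.conj_I] at h1 h2
  apply Complex.ext
  · have := congrArg Complex.im h2
    simp at this ⊢
    linarith
  · have := congrArg Complex.im h1
    simp at this ⊢
    linarith

/-- Testing with b = q*q, the negative part of k, leaves only minus a square, so faithfulness forces
the negative part to vanish. -/
theorem exists_eq_star_mul_self_of_isSelfAdjoint (hT : ∀ x, 0 ≤ T (star x * x))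
    (hf : ∀ x, T (star x * x) = 0 → x = 0) {k : A} (hk : IsSelfAdjoint k)
    (h : ∀ b, 0 ≤ T (star b * k * b)) : ∃ c, k = star c * c := by
  obtain ⟨p, q, e, hpq, -⟩ := exists_posPart_negPart hk
  have h1 := h (star q * q)
  have hpq' : star q * q * (star p * p) = 0 := by
    have := congrArg star hpq
    simpa [mul_assoc] using this
  have e1 : star (star q * q) * k * (star q * q) = - (star (q * (star q * q)) * (q * (star q * q))) := by
    rw [e, star_mul, star_star, mul_sub, hpq', zero_sub]
    simp only [star_mul, star_star, mul_assoc, neg_mul]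
  rw [e1, map_neg] at h1
  have h2 : q * (star q * q) = 0 := hf _ (le_antisymm (neg_nonneg.mp h1) (hT _))
  have h3 : star q * q = 0 := by
    rw [← CStarRing.star_mul_self_eq_zero_iff]
    simp only [star_mul, star_star, mul_assoc, h2, mul_zero]
  exact ⟨p, by rw [e, h3, sub_zero]⟩

theorem exists_eq_star_mul_self (hT : ∀ x, 0 ≤ T (star x * x))
    (hf : ∀ x, T (star x * x) = 0 → x = 0) {m : A}
    (h : ∀ b, 0 ≤ T (star b * m * b)) : ∃ c, m = star c * c := by
  -- The form of i(m* - m) vanishes identically, so the self-adjoint case makes it a square of trace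
  -- zero.
  have hs : star m = m := by
    have h0 : ∀ b, T (star b * (Complex.I • (star m - m)) * b) = 0 := by
      intro b
      have h1 := map_star_of_nonneg hT (star b * m * b)
      rw [(h b).isSelfAdjoint.star_eq] at h1
      simp only [star_mul, star_star, ← mul_assoc] at h1
      simp [mul_sub, sub_mul, h1]
    have hsa : IsSelfAdjoint (Complex.I • (star m - m)) := by
      rw [IsSelfAdjoint, star_smul, star_sub, star_star, Complex.star_def, Complex.conj_I,
        neg_smul, ← smul_neg, neg_sub]
    obtain ⟨c, hc⟩ := exists_eq_star_mul_self_of_isSelfAdjoint hT hf hsa (fun b => (h0 b).ge)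
    have h2 := h0 1
    rw [star_one, one_mul, mul_one, hc] at h2
    rw [hf c h2, mul_zero] at hc
    have := (smul_eq_zero.mp hc).resolve_left Complex.I_ne_zero
    exact sub_eq_zero.mp this
  exact exists_eq_star_mul_self_of_isSelfAdjoint hT hf hs h

end CStar

/-- A faithful tracial state on a C*-algebra. -/
structure FaithfulTrace (A : Type*) [CStarAlgebra A] where
  /-- the underlying linear functional -/
  toLin : A →ₗ[ℂ] ℂ
  map_one : toLin 1 = 1
  nonneg : ∀ x, 0 ≤ toLin (star x * x)
  tracial : ∀ x y, toLin (x * y) = toLin (y * x)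
  faithful : ∀ x, toLin (star x * x) = 0 → x = 0

namespace FaithfulTrace

variable {A : Type*} [CStarAlgebra A] (τ : FaithfulTrace A)

theorem map_star (x : A) : τ.toLin (star x) = star (τ.toLin x) :=
  map_star_of_nonneg τ.nonneg x

theorem eq_of_forall_mul {x y : A} (h : ∀ z, τ.toLin (z * x) = τ.toLin (z * y)) : x = y := by
  refine sub_eq_zero.mp (τ.faithful _ ?_)
  rw [mul_sub, map_sub, h, sub_self]

theorem eq_of_forall_mul_right {x y : A} (h : ∀ z, τ.toLin (x * z) = τ.toLin (y * z)) : x = y :=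
  τ.eq_of_forall_mul fun z => by rw [τ.tracial z x, τ.tracial z y, h]

/-- A matrix with entries in `A` is positive, tested by the trace. -/
def PosMatrix {n : Type*} [Fintype n] (a : n → n → A) : Prop :=
  ∀ y : n → A, 0 ≤ ∑ i, ∑ j, τ.toLin (star (y i) * a i j * y j)

variable {τ} {n : Type*} [Fintype n]

/-- Matrices over `A` form a C*-algebra on which the sum of the diagonal traces is a faithful
positive functional, so positivity tested by the trace is positivity as an operator matrix. -/
theorem PosMatrix.exists_gram [DecidableEq n] {a : n → n → A} (h : τ.PosMatrix a) :
    ∃ b : n → n → A, ∀ i j, a i j = ∑ k, star (b k i) * b k j := by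
  let _ := CStarAlgebra.spectralOrder A
  have _ := CStarAlgebra.spectralOrderedRing A
  let T : CStarMatrix n n A →ₗ[ℂ] ℂ :=
    { toFun := fun x => ∑ i, τ.toLin (x i i)
      map_add' := fun x y => by simp [Finset.sum_add_distrib]
      map_smul' := fun c x => by simp [Finset.mul_sum] }
  have hsq : ∀ x : CStarMatrix n n A, T (star x * x) =
      ∑ i, ∑ k, τ.toLin (star (x k i) * x k i) := by
    intro x
    simp [T, CStarMatrix.mul_apply, CStarMatrix.star_apply]
  obtain ⟨c, hc⟩ := exists_eq_star_mul_self (T := T) (m := CStarMatrix.ofMatrix a) (fun x => by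
      rw [hsq]
      exact Finset.sum_nonneg fun i _ => Finset.sum_nonneg fun k _ => τ.nonneg _)
    (fun x hx => by
      rw [hsq, Finset.sum_eq_zero_iff_of_nonneg
        (fun i _ => Finset.sum_nonneg fun k _ => τ.nonneg _)] at hx
      ext k i
      have h1 := hx i (Finset.mem_univ i)
      rw [Finset.sum_eq_zero_iff_of_nonneg (fun k _ => τ.nonneg _)] at h1
      exact τ.faithful _ (h1 k (Finset.mem_univ k)))
    (fun b => by
      have : T (star b * CStarMatrix.ofMatrix a * b) =
          ∑ c, ∑ i, ∑ j, τ.toLin (star (b i c) * a i j * b j c) := by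
        simp only [T, CStarMatrix.mul_apply, CStarMatrix.star_apply, Finset.sum_mul, map_sum,
          LinearMap.coe_mk, AddHom.coe_mk]
        exact Finset.sum_congr rfl fun c _ => Finset.sum_comm
      rw [this]
      exact Finset.sum_nonneg fun c _ => h fun i => b i c)
  refine ⟨fun k i => c k i, fun i j => ?_⟩
  change CStarMatrix.ofMatrix a i j = _
  simp [hc, CStarMatrix.mul_apply, CStarMatrix.star_apply]

theorem PosMatrix.conj {a : n → n → A} (h : τ.PosMatrix a) (x : n → A) :
    τ.PosMatrix fun i j => star (x i) * a i j * x j := by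
  intro y
  have := h fun i => x i * y i
  simpa [mul_assoc] using this

end FaithfulTrace
/-! ### Words and their kernel -/

/-- Words `x₀ n₁ x₁ ⋯ nₖ xₖ` alternating between letters in `A` and indices in `ι`. -/
inductive Word (A : Type u) (ι : Type) : Type u
  | nil : A → Word A ι
  | cons : A → ι → Word A ι → Word A ι

namespace Word

variable {A : Type u} [CStarAlgebra A] {ι : Type}

/-- Multiply the first letter of a word. -/
noncomputable def lmul (a : A) : Word A ι → Word A ι
  | .nil x => .nil (a * x)
  | .cons x n w => .cons (a * x) n w

/-- Multiply the last letter of a word. -/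
noncomputable def rmul (a : A) : Word A ι → Word A ι
  | .nil x => .nil (x * a)
  | .cons x n w => .cons x n (rmul a w)

/-- Right creation. -/
noncomputable def rcre (n : ι) : Word A ι → Word A ι
  | .nil x => .cons x n (.nil 1)
  | .cons x m w => .cons x m (rcre n w)

/-- The head letter. -/
noncomputable def head : Word A ι → A
  | .nil x => x
  | .cons x _ _ => x

/-- The word without its first letter and index. -/
noncomputable def tail : Word A ι → Word A ι
  | .nil _ => .nil 0
  | .cons _ _ w => w

/-- The number of indices. -/
noncomputable def length : Word A ι → ℕ
  | .nil _ => 0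
  | .cons _ _ w => length w + 1

/-- The first index. -/
noncomputable def index : Word A ι → Option ι
  | .nil _ => none
  | .cons _ n _ => some n

@[simp] theorem rmul_lmul (a b : A) (v : Word A ι) : (v.lmul a).rmul b = (v.rmul b).lmul a := by
  cases v <;> simp [Word.lmul, Word.rmul, mul_assoc]

@[simp] theorem lmul_lmul (a b : A) (v : Word A ι) : (v.lmul a).lmul b = v.lmul (b * a) := by
  cases v <;> simp [Word.lmul, mul_assoc]

@[simp] theorem lmul_one (v : Word A ι) : v.lmul 1 = v := by
  cases v <;> simp [Word.lmul]

@[simp] theorem rmul_rmul (a b : A) (v : Word A ι) : (v.rmul a).rmul b = v.rmul (a * b) := by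
  induction v with
  | nil x => simp [Word.rmul, mul_assoc]
  | cons x n v ih => simp [Word.rmul, ih]

@[simp] theorem rmul_one (v : Word A ι) : v.rmul 1 = v := by
  induction v with
  | nil x => simp [Word.rmul]
  | cons x n v ih => simp [Word.rmul, ih]

@[simp] theorem rcre_lmul (a : A) (n : ι) (v : Word A ι) :
    (v.lmul a).rcre n = (v.rcre n).lmul a := by
  cases v <;> simp [Word.lmul, Word.rcre]

end Word

/-- A unital completely positive map that is symmetric with respect to the trace. Complete
positivity is tested by the trace. -/
structure Covariance {A : Type u} [CStarAlgebra A] (τ : FaithfulTrace A) where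
  /-- the underlying linear map -/
  toLin : A →ₗ[ℂ] A
  map_one : toLin 1 = 1
  symm : ∀ x y, τ.toLin (toLin x * y) = τ.toLin (x * toLin y)
  pos : ∀ {n : Type u} [Fintype n] [DecidableEq n] (a : n → n → A), τ.PosMatrix a →
    τ.PosMatrix fun i j => toLin (a i j)

section Kernel

variable {A : Type u} [CStarAlgebra A] {τ : FaithfulTrace A}

/-- Each functional x ↦ τ(φ(x) z*z) is positive, hence Hermitian, and the squares z*z span `A`. -/
theorem Covariance.map_star (φ : Covariance τ) (x : A) : φ.toLin (star x) = star (φ.toLin x) := by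
  refine τ.eq_of_forall_mul_right fun z => ?_
  have hpos : ∀ x z : A, 0 ≤ τ.toLin (φ.toLin (star x * x) * (star z * z)) := by
    intro x z
    have h := φ.pos (n := PUnit) (fun _ _ => star x * x) (fun y => by
      have := τ.nonneg (x * y PUnit.unit)
      simpa [mul_assoc] using this) (fun _ => star z)
    simp only [Finset.univ_unique, Finset.sum_singleton, star_star] at h
    rw [mul_assoc, τ.tracial, mul_assoc] at h
    exact h
  have h1 : ∀ x z : A, τ.toLin (φ.toLin (star x) * (star z * z)) =
      star (τ.toLin (φ.toLin x * (star z * z))) := by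
    intro x z
    exact map_star_of_nonneg
      (T := τ.toLin ∘ₗ (LinearMap.mulRight ℂ (star z * z)) ∘ₗ φ.toLin) (fun x => hpos x z) x
  have h2 : ∀ z : A, τ.toLin (φ.toLin (star x) * z) = star (τ.toLin (φ.toLin x * star z)) := by
    intro z
    have hz : z ∈ Submodule.span ℂ (Set.range fun y : A => star y * y) := by
      rw [span_star_mul_self]; trivial
    induction hz using Submodule.span_induction with
    | mem z hz =>
      obtain ⟨y, rfl⟩ := hz
      beta_reduce
      rw [h1, star_mul, star_star]
    | zero => simp
    | add a b _ _ ha hb => simp [mul_add, ha, hb]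
    | smul c a _ ha => simp [ha]
  rw [h2, ← τ.map_star, star_mul, star_star, τ.tracial]

variable {ι : Type} [DecidableEq ι] (φ : ι → Covariance τ)

/-- The kernel `(v, w) ↦ ⟨v, c w⟩` on words. -/
noncomputable def ker : A → Word A ι → Word A ι → ℂ
  | c, .nil x, .nil y => τ.toLin (star x * c * y)
  | c, .cons x n v, .cons y m w => if n = m then ker ((φ n).toLin (star x * c * y)) v w else 0
  | _, .nil _, .cons _ _ _ => 0
  | _, .cons _ _ _, .nil _ => 0

@[simp] theorem ker_nil_nil (c x y : A) :
    ker φ c (.nil x) (.nil y) = τ.toLin (star x * c * y) := by rw [ker]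

@[simp] theorem ker_cons_cons (c x y : A) (n m : ι) (v w : Word A ι) :
    ker φ c (.cons x n v) (.cons y m w) =
      if n = m then ker φ ((φ n).toLin (star x * c * y)) v w else 0 := by rw [ker]

@[simp] theorem ker_nil_cons (c x y : A) (m : ι) (w : Word A ι) :
    ker φ c (.nil x) (.cons y m w) = 0 := by rw [ker]

@[simp] theorem ker_cons_nil (c x y : A) (m : ι) (w : Word A ι) :
    ker φ c (.cons y m w) (.nil x) = 0 := by rw [ker]

/-- Symmetry of the covariances moves each φₙ off the side of c. This gives linearity in c, and
later the normality of the left action. -/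
theorem exists_ker_eq_trace (v w : Word A ι) : ∃ d, ∀ c, ker φ c v w = τ.toLin (c * d) := by
  induction v generalizing w with
  | nil x =>
    cases w with
    | nil y => exact ⟨y * star x, fun c => by
        rw [ker_nil_nil, mul_assoc, τ.tracial, mul_assoc]⟩
    | cons y m w => exact ⟨0, by simp⟩
  | cons x n v ih =>
    cases w with
    | nil y => exact ⟨0, by simp⟩
    | cons y m w =>
      obtain ⟨d, hd⟩ := ih w
      by_cases h : n = m
      · refine ⟨y * (φ n).toLin d * star x, fun c => ?_⟩
        rw [ker_cons_cons, if_pos h, hd, (φ n).symm, mul_assoc, mul_assoc, τ.tracial]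
        simp only [mul_assoc]
      · exact ⟨0, by simp [h]⟩

theorem ker_add (c d : A) (v w : Word A ι) : ker φ (c + d) v w = ker φ c v w + ker φ d v w := by
  obtain ⟨b, hb⟩ := exists_ker_eq_trace φ v w
  simp [hb, add_mul]

theorem ker_smul (r : ℂ) (c : A) (v w : Word A ι) : ker φ (r • c) v w = r * ker φ c v w := by
  obtain ⟨b, hb⟩ := exists_ker_eq_trace φ v w
  simp [hb]

@[simp] theorem ker_zero (v w : Word A ι) : ker φ 0 v w = 0 := by
  obtain ⟨b, hb⟩ := exists_ker_eq_trace φ v w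
  simp [hb]

theorem star_ker (c : A) (v w : Word A ι) : star (ker φ c v w) = ker φ (star c) w v := by
  induction v generalizing w c with
  | nil x => cases w <;> simp [← τ.map_star, mul_assoc, -Complex.star_def]
  | cons x n v ih =>
    cases w with
    | nil y => simp
    | cons y m w =>
      by_cases h : n = m
      · subst h
        rw [ker_cons_cons, if_pos rfl, ih, ← Covariance.map_star, ker_cons_cons, if_pos rfl]
        simp [mul_assoc]
      · simp [h, Ne.symm h]

namespace Word

/-- Left annihilation. -/
noncomputable def lann (n : ι) : Word A ι → Word A ι
  | .nil _ => .nil 0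
  | .cons x m w => if n = m then lmul ((φ n).toLin x) w else .nil 0

/-- Right annihilation. -/
noncomputable def rann (n : ι) : Word A ι → Word A ι
  | .nil _ => .nil 0
  | .cons x m (.nil y) => if n = m then .nil (x * (φ n).toLin y) else .nil 0
  | .cons x m (.cons y p w) => .cons x m (rann n (.cons y p w))

end Word

theorem ker_lmul_right (a c : A) (v w : Word A ι) : ker φ c v (w.lmul a) = ker φ (c * a) v w := by
  cases v <;> cases w <;> simp [Word.lmul, mul_assoc]

theorem ker_lmul_left (a c : A) (v w : Word A ι) :
    ker φ c (v.lmul a) w = ker φ (star a * c) v w := by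
  cases v <;> cases w <;> simp [Word.lmul, mul_assoc]

theorem ker_rmul_left (a c : A) (v w : Word A ι) :
    ker φ c (v.rmul a) w = ker φ c v (w.rmul (star a)) := by
  induction v generalizing w c with
  | nil x =>
    cases w
    · simp only [Word.rmul, ker_nil_nil, star_mul]
      rw [mul_assoc, mul_assoc, τ.tracial]
      simp only [mul_assoc]
    · simp [Word.rmul]
  | cons x n v ih =>
    cases w
    · simp [Word.rmul]
    · simp [Word.rmul, ih]

theorem ker_lcre_left (n : ι) (v w : Word A ι) :
    ker φ 1 (.cons 1 n v) w = ker φ 1 v (w.lann φ n) := by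
  cases w with
  | nil x => cases v <;> simp [Word.lann]
  | cons x m w =>
    by_cases h : n = m
    · subst h
      simp [Word.lann, ker_lmul_right]
    · cases v <;> simp [Word.lann, h]

/-- Both words are peeled from the left until the last index; there the identity is τ(φ(b)z) =
τ(bφ(z)), the symmetry of φ. -/
theorem ker_rcre_left (n : ι) (c : A) (v w : Word A ι) :
    ker φ c (v.rcre n) w = ker φ c v (w.rann φ n) := by
  induction w generalizing v c with
  | nil y => cases v <;> simp [Word.rcre, Word.rann]
  | cons y m w ih =>
    cases v with
    | nil x =>
      cases w with
      | nil z =>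
        by_cases h : n = m
        · subst h
          simp [Word.rcre, Word.rann, (φ n).symm, mul_assoc]
        · simp [Word.rcre, Word.rann, h]
      | cons z p w => simp [Word.rcre, Word.rann]
    | cons x q v =>
      cases w with
      | nil z =>
        have h1 : ∀ c, ker φ c (v.rcre n) (.nil z) = 0 := by
          intro c; cases v <;> simp [Word.rcre]
        by_cases h : n = m
        · subst h
          simp [Word.rcre, Word.rann, h1]
        · simp [Word.rcre, Word.rann, h1, h]
      | cons z p w => simp [Word.rcre, Word.rann, ih]

@[simp] theorem rann_rcre (n : ι) (v : Word A ι) : (v.rcre n).rann φ n = v := by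
  induction v with
  | nil x => simp [Word.rcre, Word.rann, (φ n).map_one]
  | cons x m v ih =>
    cases v with
    | nil y => simp [Word.rcre, Word.rann, (φ n).map_one]
    | cons y p v =>
      simp only [Word.rcre, Word.rann] at ih ⊢
      rw [ih]

@[simp] theorem rann_lmul (a : A) (n : ι) (v : Word A ι) :
    (v.lmul a).rann φ n = (v.rann φ n).lmul a := by
  cases v with
  | nil x => simp [Word.lmul, Word.rann]
  | cons x m v =>
    cases v with
    | nil y => by_cases h : n = m <;> simp [Word.lmul, Word.rann, h, mul_assoc]
    | cons y p v => simp [Word.lmul, Word.rann]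

/-- Sort the words by their first index: those without index contribute the positive matrix a
conjugated by their letters, and those starting with p reduce to their tails with coefficient matrix
φₚ of a conjugate of a, again positive by complete positivity. The matrix coefficient is what makes
the induction close. -/
theorem ker_nonneg_of_length_le (N : ℕ) {n : Type u} [Fintype n] [DecidableEq n] (a : n → n → A)
    (ha : τ.PosMatrix a) (w : n → Word A ι) (hw : ∀ i, (w i).length ≤ N) :
    0 ≤ ∑ i, ∑ j, ker φ (a i j) (w i) (w j) := by
  induction N generalizing a w with
  | zero =>
    have h : ∀ i, w i = .nil (w i).head := by
      intro i
      have := hw i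
      cases h : w i with
      | nil x => rfl
      | cons x m v => rw [h] at this; simp [Word.length] at this
    have := ha fun i => (w i).head
    convert this using 5 with i _ j
    rw [h i, h j, ker_nil_nil]
    rfl
  | succ N ih =>
    -- Heads are replaced by 0 outside their own class, so every sum can run over all words and the
    -- mixed terms vanish by themselves.
    let x : n → A := fun i => if (w i).index = none then (w i).head else 0
    let y : ι → n → A := fun p i => if (w i).index = some p then (w i).head else 0
    let s : Finset ι := Finset.univ.biUnion fun i => (w i).index.toFinset
    have key : ∀ i j, ker φ (a i j) (w i) (w j) =
        τ.toLin (star (x i) * a i j * x j) +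
          ∑ p ∈ s, ker φ ((φ p).toLin (star (y p i) * a i j * y p j)) (w i).tail (w j).tail := by
      intro i j
      cases hi : w i with
      | nil b =>
        have h1 : ∀ p, y p i = 0 := fun p => by simp [y, hi, Word.index]
        have h2 : x i = b := by simp [x, hi, Word.index, Word.head]
        cases hj : w j with
        | nil c =>
          have h3 : x j = c := by simp [x, hj, Word.index, Word.head]
          simp [h1, h2, h3]
        | cons c m v =>
          have h3 : x j = 0 := by simp [x, hj, Word.index]
          simp [h1, h3]
      | cons b m v =>
        have h2 : x i = 0 := by simp [x, hi, Word.index]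
        have hm : m ∈ s := Finset.mem_biUnion.mpr ⟨i, Finset.mem_univ _, by simp [hi, Word.index]⟩
        have hb : y m i = b := by simp [y, hi, Word.index, Word.head]
        have hb' : ∀ p, p ≠ m → y p i = 0 := fun p hp => by simp [y, hi, Word.index, Ne.symm hp]
        rw [Finset.sum_eq_single_of_mem m hm (fun p _ hp => by simp [hb' p hp])]
        cases hj : w j with
        | nil c =>
          have h3 : y m j = 0 := by simp [y, hj, Word.index]
          simp [h3, h2]
        | cons c p u =>
          by_cases h : m = p
          · subst h
            have h3 : y m j = c := by simp [y, hj, Word.index, Word.head]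
            simp [h2, hb, h3, Word.tail]
          · have h3 : y m j = 0 := by simp [y, hj, Word.index, Ne.symm h]
            simp [h2, h3, h]
    have e : ∑ i, ∑ j, ker φ (a i j) (w i) (w j) =
        ∑ i, ∑ j, τ.toLin (star (x i) * a i j * x j) +
          ∑ p ∈ s, ∑ i, ∑ j,
            ker φ ((φ p).toLin (star (y p i) * a i j * y p j)) (w i).tail (w j).tail := by
      simp only [key, Finset.sum_add_distrib]
      congr 1
      rw [Finset.sum_comm (s := s)]
      exact Finset.sum_congr rfl fun i _ => Finset.sum_comm
    rw [e]
    refine add_nonneg (ha x) (Finset.sum_nonneg fun p _ => ?_)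
    refine ih _ ((φ p).pos _ (ha.conj (y p))) _ fun i => ?_
    have := hw i
    cases h : w i with
    | nil b => simp [Word.tail, Word.length]
    | cons b m v => rw [h] at this; simpa [Word.tail, Word.length] using this

theorem ker_nonneg (c : Word A ι →₀ ℂ) :
    0 ≤ c.sum fun v a => c.sum fun w b => star a * b * ker φ 1 v w := by
  classical
  let n := c.support
  let y : n → A := fun i => c i.1 • (1 : A)
  obtain ⟨N, hN⟩ : ∃ N, ∀ i : n, i.1.length ≤ N :=
    ⟨c.support.sup Word.length, fun i => Finset.le_sup (f := Word.length) i.2⟩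
  -- The scalar coefficients enter as a rank-one positive matrix.
  have h := ker_nonneg_of_length_le φ N (fun i j => star (y i) * 1 * y j)
    (FaithfulTrace.PosMatrix.conj (a := fun _ _ => 1) (fun z => by
      have : ∑ i, ∑ j, τ.toLin (star (z i) * 1 * z j) =
          τ.toLin (star (∑ i, z i) * ∑ i, z i) := by
        simp [Finset.sum_mul, Finset.mul_sum]
        exact Finset.sum_comm
      rw [this]
      exact τ.nonneg _) y) (fun i => i.1) hN
  have e : (c.sum fun v a => c.sum fun w b => star a * b * ker φ 1 v w) =
      ∑ i : n, ∑ j : n, ker φ (star (y i) * 1 * y j) i.1 j.1 := by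
    rw [Finsupp.sum, ← Finset.sum_coe_sort]
    refine Finset.sum_congr rfl fun i _ => ?_
    rw [Finsupp.sum, ← Finset.sum_coe_sort]
    refine Finset.sum_congr rfl fun j _ => ?_
    simp [y, ker_smul, mul_assoc]
    ring
  rw [e]
  exact h

end Kernel
/-! ### Hilbert spaces spanned by a positive kernel -/

section KernelSpace

variable {W : Type*} {E F : Type*} [NormedAddCommGroup E] [InnerProductSpace ℂ E]
  [NormedAddCommGroup F] [InnerProductSpace ℂ F]

theorem inner_self_eq_ofReal (x : E) : inner ℂ x x = ((‖x‖ ^ 2 : ℝ) : ℂ) := by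
  rw [inner_self_eq_norm_sq_to_K]
  norm_cast

theorem inner_linearCombination (g : W → E) (c d : W →₀ ℂ) :
    inner ℂ (Finsupp.linearCombination ℂ g c) (Finsupp.linearCombination ℂ g d) =
      c.sum fun v a => d.sum fun w b => star a * b * inner ℂ (g v) (g w) := by
  rw [Finsupp.linearCombination_apply, Finsupp.linearCombination_apply, Finsupp.sum_inner]
  refine Finsupp.sum_congr fun v _ => ?_
  rw [inner_smul_left, Finsupp.inner_sum, Finsupp.mul_sum]
  refine Finsupp.sum_congr fun w _ => ?_
  rw [inner_smul_right, Complex.star_def]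
  ring

theorem sum_inner_kernel_nonneg (g : W → E) (c : W →₀ ℂ) :
    0 ≤ c.sum fun v a => c.sum fun w b => star a * b * inner ℂ (g v) (g w) := by
  rw [← inner_linearCombination, inner_self_eq_ofReal]
  exact Complex.zero_le_real.mpr (sq_nonneg _)

/-- Domination of Gram matrices bounds the map vec w ↦ g w. Combined with `IsTotal.exists_clm` it
produces the multiplication and creation operators and the maps from the Fock space to bimodules. -/
theorem norm_linearCombination_le {vec : W → F} {g : W → E} {C : ℝ} (hC : 0 ≤ C)
    (R : W → W → ℂ)
    (hR : ∀ c : W →₀ ℂ, 0 ≤ c.sum fun v a => c.sum fun w b => star a * b * R v w)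
    (h : ∀ v w, ((C ^ 2 : ℝ) : ℂ) * inner ℂ (vec v) (vec w) = inner ℂ (g v) (g w) + R v w)
    (c : W →₀ ℂ) :
    ‖Finsupp.linearCombination ℂ g c‖ ≤ C * ‖Finsupp.linearCombination ℂ vec c‖ := by
  have e : ((C ^ 2 : ℝ) : ℂ) * inner ℂ (Finsupp.linearCombination ℂ vec c)
      (Finsupp.linearCombination ℂ vec c) = inner ℂ (Finsupp.linearCombination ℂ g c)
      (Finsupp.linearCombination ℂ g c) +
      c.sum fun v a => c.sum fun w b => star a * b * R v w := by
    simp only [inner_linearCombination]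
    simp only [Finsupp.sum, Finset.mul_sum, ← Finset.sum_add_distrib]
    refine Finset.sum_congr rfl fun v _ => Finset.sum_congr rfl fun w _ => ?_
    linear_combination star (c v) * c w * h v w
  have h1 : inner ℂ (Finsupp.linearCombination ℂ g c) (Finsupp.linearCombination ℂ g c) ≤
      ((C ^ 2 : ℝ) : ℂ) * inner ℂ (Finsupp.linearCombination ℂ vec c)
      (Finsupp.linearCombination ℂ vec c) := by
    rw [e]; exact le_add_of_nonneg_right (hR c)
  rw [inner_self_eq_ofReal, inner_self_eq_ofReal, ← Complex.ofReal_mul] at h1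
  have h2 : ‖Finsupp.linearCombination ℂ g c‖ ^ 2 ≤
      C ^ 2 * ‖Finsupp.linearCombination ℂ vec c‖ ^ 2 := Complex.real_le_real.mp h1
  rw [← mul_pow] at h2
  exact (pow_le_pow_iff_left₀ (norm_nonneg _) (by positivity) two_ne_zero).mp h2

/-- A family of vectors with dense linear span. -/
def IsTotal (vec : W → F) : Prop := DenseRange (Finsupp.linearCombination ℂ vec)

namespace IsTotal

variable {vec : W → F}

theorem ext_clm (hv : IsTotal vec) {S T : F →L[ℂ] E} (h : ∀ w, S (vec w) = T (vec w)) : S = T := by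
  have h1 := hv.equalizer S.continuous T.continuous (by
    funext c
    simp [Finsupp.linearCombination_apply, Finsupp.sum, map_sum, h])
  exact DFunLike.coe_injective h1

theorem ext_inner_right (hv : IsTotal vec)
    {x y : F} (h : ∀ w, inner ℂ (vec w) x = inner ℂ (vec w) y) : x = y := by
  refine hv.eq_of_inner_right ℂ fun v => ?_
  simp only [Finsupp.linearCombination_apply, Finsupp.sum_inner, inner_smul_left, h]

theorem exists_clm (hv : IsTotal vec) [CompleteSpace E] {g : W → E} {C : ℝ} (hC : 0 ≤ C)
    (hg : ∀ c, ‖Finsupp.linearCombination ℂ g c‖ ≤ C * ‖Finsupp.linearCombination ℂ vec c‖) :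
    ∃ T : F →L[ℂ] E, (∀ w, T (vec w) = g w) ∧ ‖T‖ ≤ C := by
  refine ⟨(Finsupp.linearCombination ℂ g).extendOfNorm (Finsupp.linearCombination ℂ vec),
    fun w => ?_, ContinuousLinearMap.opNorm_le_bound _ hC
      (LinearMap.norm_extendOfNorm_apply_le hv C hg)⟩
  have := LinearMap.extendOfNorm_eq hv ⟨C, hg⟩ (Finsupp.single w 1)
  simpa using this

end IsTotal

end KernelSpace

/-- The kernel is a semi-inner product on finitely supported functions; completing the seminormed
space also identifies null vectors. -/
theorem exists_hilbert_of_kernel {W : Type u} (k : W → W → ℂ)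
    (hs : ∀ v w, star (k v w) = k w v)
    (hk : ∀ c : W →₀ ℂ, 0 ≤ c.sum fun v a => c.sum fun w b => star a * b * k v w) :
    ∃ (F : Type u) (_ : NormedAddCommGroup F) (_ : InnerProductSpace ℂ F) (_ : CompleteSpace F)
      (vec : W → F), (∀ v w, inner ℂ (vec v) (vec w) = k v w) ∧ IsTotal vec := by
  let core : PreInnerProductSpace.Core ℂ (W →₀ ℂ) :=
    { inner := fun c d => c.sum fun v a => d.sum fun w b => star a * b * k v w
      conj_inner_symm := fun c d => by
        simp only [Finsupp.sum, map_sum, map_mul]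
        rw [Finset.sum_comm]
        refine Finset.sum_congr rfl fun v _ => Finset.sum_congr rfl fun w _ => ?_
        rw [← Complex.star_def, hs, star_star]
        ring
      re_inner_nonneg := fun c => (Complex.nonneg_iff.mp (hk c)).1
      add_left := fun c d e => by
        rw [Finsupp.sum_add_index'] <;> simp [← Finsupp.sum_add, add_mul]
      smul_left := fun c d r => by
        rw [Finsupp.sum_smul_index] <;> simp [Finsupp.mul_sum, ← mul_assoc] }
  let _ : SeminormedAddCommGroup (W →₀ ℂ) :=
    InnerProductSpace.Core.toSeminormedAddCommGroup (c := core)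
  let _ : InnerProductSpace ℂ (W →₀ ℂ) := InnerProductSpace.ofCore core
  refine ⟨UniformSpace.Completion (W →₀ ℂ), inferInstance, inferInstance, inferInstance,
    fun w => ((Finsupp.single w 1 : W →₀ ℂ) : UniformSpace.Completion (W →₀ ℂ)),
    fun v w => ?_, ?_⟩
  · rw [UniformSpace.Completion.inner_coe]
    change (Finsupp.single v 1).sum _ = _
    simp
  · have : ⇑(Finsupp.linearCombination ℂ
        (fun w => ((Finsupp.single w 1 : W →₀ ℂ) : UniformSpace.Completion (W →₀ ℂ)))) =
        fun c : W →₀ ℂ => (c : UniformSpace.Completion (W →₀ ℂ)) := by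
      funext c
      have h := map_finsuppSum (UniformSpace.Completion.toComplL (𝕜 := ℂ) (E := W →₀ ℂ)) c
        (fun w a => Finsupp.single w a)
      rw [Finsupp.sum_single] at h
      rw [Finsupp.linearCombination_apply]
      refine Eq.trans (Finsupp.sum_congr fun w _ => ?_) h.symm
      rw [← UniformSpace.Completion.coe_toComplL (𝕜 := ℂ), ← map_smul, Finsupp.smul_single_one]
    rw [IsTotal, this]
    exact UniformSpace.Completion.denseRange_coe

/-! ### Fock spaces and their operators -/

section Fock

variable {A : Type u} [CStarAlgebra A] {τ : FaithfulTrace A} {ι : Type} [DecidableEq ι]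

/-- The full Fock space over `A` with covariances `φ`: the Hilbert space spanned by the words, with
inner product given by the kernel. -/
structure FockSpace (φ : ι → Covariance τ) (F : Type*) [NormedAddCommGroup F]
    [InnerProductSpace ℂ F] where
  /-- the vector of a word -/
  vec : Word A ι → F
  inner_vec : ∀ v w, inner ℂ (vec v) (vec w) = ker φ 1 v w
  total : IsTotal vec

theorem exists_fockSpace (φ : ι → Covariance τ) :
    ∃ (F : Type u) (_ : NormedAddCommGroup F) (_ : InnerProductSpace ℂ F) (_ : CompleteSpace F),
      Nonempty (FockSpace φ F) := by
  obtain ⟨F, i1, i2, i3, vec, h1, h2⟩ := exists_hilbert_of_kernel (ker φ 1)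
    (fun v w => by rw [star_ker, star_one]) (ker_nonneg φ)
  exact ⟨F, i1, i2, i3, ⟨⟨vec, h1, h2⟩⟩⟩

/-- The last letter is met only in the innermost trace. This yields linearity and normality of the
right action. -/
theorem exists_ker_rmul_eq_trace (φ : ι → Covariance τ) (c : A) (v w : Word A ι) :
    ∃ d, ∀ a, ker φ c v (w.rmul a) = τ.toLin (d * a) := by
  induction v generalizing w c with
  | nil x =>
    cases w with
    | nil y => exact ⟨star x * c * y, fun a => by simp [Word.rmul, mul_assoc]⟩
    | cons y m w => exact ⟨0, by simp [Word.rmul]⟩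
  | cons x n v ih =>
    cases w with
    | nil y => exact ⟨0, by simp [Word.rmul]⟩
    | cons y m w =>
      by_cases h : n = m
      · subst h
        obtain ⟨d, hd⟩ := ih ((φ n).toLin (star x * c * y)) w
        exact ⟨d, fun a => by simp [Word.rmul, hd]⟩
      · exact ⟨0, by simp [Word.rmul, h]⟩

namespace FockSpace

variable {φ : ι → Covariance τ} {F : Type*} [NormedAddCommGroup F] [InnerProductSpace ℂ F]
  (X : FockSpace φ F)

theorem eq_vec {x : F} {w : Word A ι} (h : ∀ v, inner ℂ (X.vec v) x = ker φ 1 v w) :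
    x = X.vec w :=
  X.total.ext_inner_right fun v => by rw [h, X.inner_vec]

@[simp] theorem vec_nil_zero : X.vec (.nil 0) = 0 :=
  (X.eq_vec fun v => by cases v <;> simp).symm

@[simp] theorem vec_cons_nil_zero (x : A) (n : ι) : X.vec (.cons x n (.nil 0)) = 0 :=
  (X.eq_vec fun v => by
    rcases v with y | ⟨y, m, y | _⟩ <;> simp).symm

theorem vec_lmul_add (a b : A) (w : Word A ι) :
    X.vec (w.lmul (a + b)) = X.vec (w.lmul a) + X.vec (w.lmul b) :=
  (X.eq_vec fun v => by
    rw [inner_add_right]; simp only [X.inner_vec, ker_lmul_right, mul_add, ker_add]).symm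

theorem vec_lmul_smul (r : ℂ) (a : A) (w : Word A ι) :
    X.vec (w.lmul (r • a)) = r • X.vec (w.lmul a) :=
  (X.eq_vec fun v => by
    rw [inner_smul_right]
    simp only [X.inner_vec, ker_lmul_right, mul_smul_comm, ker_smul]).symm

theorem vec_rmul_add (a b : A) (w : Word A ι) :
    X.vec (w.rmul (a + b)) = X.vec (w.rmul a) + X.vec (w.rmul b) :=
  (X.eq_vec fun v => by
    obtain ⟨d, hd⟩ := exists_ker_rmul_eq_trace φ 1 v w
    rw [inner_add_right]; simp only [X.inner_vec, hd, mul_add, map_add]).symm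

theorem vec_rmul_smul (r : ℂ) (a : A) (w : Word A ι) :
    X.vec (w.rmul (r • a)) = r • X.vec (w.rmul a) :=
  (X.eq_vec fun v => by
    obtain ⟨d, hd⟩ := exists_ker_rmul_eq_trace φ 1 v w
    rw [inner_smul_right]
    simp only [X.inner_vec, hd, mul_smul_comm, map_smul, smul_eq_mul]).symm

variable [CompleteSpace F]

/-- With ‖a‖² - a*a = b*b, the defect of the bound is the Gram matrix of the vectors of the words
multiplied by b. -/
theorem exists_left (a : A) :
    ∃ T : F →L[ℂ] F, (∀ w, T (X.vec w) = X.vec (w.lmul a)) ∧ ‖T‖ ≤ ‖a‖ := by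
  obtain ⟨b, hb⟩ := exists_star_mul_self_norm_sub a
  have hR := sum_inner_kernel_nonneg fun v : Word A ι => X.vec (v.lmul b)
  refine X.total.exists_clm (norm_nonneg _) (norm_linearCombination_le (norm_nonneg _) _ hR
    fun v w => ?_)
  simp only [X.inner_vec, ker_lmul_right, ker_lmul_left, one_mul]
  have h : star a * a + star b * b = ((‖a‖ ^ 2 : ℝ) : ℂ) • (1 : A) := by
    rw [← hb, add_sub_cancel]
  exact ((ker_smul φ _ 1 v w).symm.trans (congrArg (fun c => ker φ c v w) h.symm)).trans
    (ker_add φ _ _ v w)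

theorem exists_right (a : A) :
    ∃ T : F →L[ℂ] F, (∀ w, T (X.vec w) = X.vec (w.rmul a)) ∧ ‖T‖ ≤ ‖a‖ := by
  obtain ⟨b, hb⟩ := exists_star_mul_self_norm_sub (star a)
  have hR := sum_inner_kernel_nonneg fun v : Word A ι => X.vec (v.rmul (star b))
  refine X.total.exists_clm (norm_nonneg _) (norm_linearCombination_le (norm_nonneg _) _ hR
    fun v w => ?_)
  have h : a * star a + star b * b = ((‖a‖ ^ 2 : ℝ) : ℂ) • (1 : A) := by
    rw [star_star, norm_star] at hb
    rw [← hb, add_sub_cancel]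
  simp only [X.inner_vec, ker_rmul_left, Word.rmul_rmul, star_star]
  obtain ⟨d, hd⟩ := exists_ker_rmul_eq_trace φ 1 v w
  have h1 := congrArg (fun c => τ.toLin (d * c)) h
  have h2 := hd 1
  rw [Word.rmul_one] at h2
  simp only [mul_add, map_add, mul_smul_comm, map_smul, smul_eq_mul] at h1
  rw [hd, hd, h1, h2]

/-- Creation preserves the kernel because φₙ is unital, so the defect is zero. -/
theorem exists_lcre (n : ι) :
    ∃ T : F →L[ℂ] F, (∀ w, T (X.vec w) = X.vec (.cons 1 n w)) ∧ ‖T‖ ≤ 1 := by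
  refine X.total.exists_clm zero_le_one (norm_linearCombination_le zero_le_one (fun _ _ => 0)
    (fun c => by simp) fun v w => ?_)
  simp [X.inner_vec, (φ n).map_one]

theorem exists_rcre (n : ι) :
    ∃ T : F →L[ℂ] F, (∀ w, T (X.vec w) = X.vec (w.rcre n)) ∧ ‖T‖ ≤ 1 := by
  refine X.total.exists_clm zero_le_one (norm_linearCombination_le zero_le_one (fun _ _ => 0)
    (fun c => by simp) fun v w => ?_)
  simp [X.inner_vec, ker_rcre_left]

/-- Left multiplication. -/
noncomputable def leftCLM (a : A) : F →L[ℂ] F := (X.exists_left a).choose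

/-- Right multiplication. -/
noncomputable def rightCLM (a : A) : F →L[ℂ] F := (X.exists_right a).choose

/-- Left creation. -/
noncomputable def lcre (n : ι) : F →L[ℂ] F := (X.exists_lcre n).choose

/-- Right creation. -/
noncomputable def rcre (n : ι) : F →L[ℂ] F := (X.exists_rcre n).choose

@[simp] theorem leftCLM_vec (a : A) (w : Word A ι) :
    X.leftCLM a (X.vec w) = X.vec (w.lmul a) := (X.exists_left a).choose_spec.1 w

@[simp] theorem rightCLM_vec (a : A) (w : Word A ι) :
    X.rightCLM a (X.vec w) = X.vec (w.rmul a) := (X.exists_right a).choose_spec.1 w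

@[simp] theorem lcre_vec (n : ι) (w : Word A ι) :
    X.lcre n (X.vec w) = X.vec (.cons 1 n w) := (X.exists_lcre n).choose_spec.1 w

@[simp] theorem rcre_vec (n : ι) (w : Word A ι) :
    X.rcre n (X.vec w) = X.vec (w.rcre n) := (X.exists_rcre n).choose_spec.1 w

@[simp] theorem star_lcre_vec (n : ι) (w : Word A ι) :
    star (X.lcre n) (X.vec w) = X.vec (w.lann φ n) :=
  X.eq_vec fun v => by
    rw [ContinuousLinearMap.star_eq_adjoint, ContinuousLinearMap.adjoint_inner_right, lcre_vec,
      X.inner_vec, ker_lcre_left]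

@[simp] theorem star_rcre_vec (n : ι) (w : Word A ι) :
    star (X.rcre n) (X.vec w) = X.vec (w.rann φ n) :=
  X.eq_vec fun v => by
    rw [ContinuousLinearMap.star_eq_adjoint, ContinuousLinearMap.adjoint_inner_right, rcre_vec,
      X.inner_vec, ker_rcre_left]

/-- The left action of `A` on the Fock space. -/
noncomputable def left : A →⋆ₐ[ℂ] (F →L[ℂ] F) where
  toFun := X.leftCLM
  map_one' := X.total.ext_clm fun w => by simp
  map_mul' a b := X.total.ext_clm fun w => by simp
  map_zero' := X.total.ext_clm fun w => by
    have := X.vec_lmul_smul 0 0 w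
    simpa using this
  map_add' a b := X.total.ext_clm fun w => by simp [X.vec_lmul_add]
  commutes' r := X.total.ext_clm fun w => by
    rw [leftCLM_vec, Algebra.algebraMap_eq_smul_one, vec_lmul_smul, Word.lmul_one,
      Algebra.algebraMap_eq_smul_one]
    rfl
  map_star' a := X.total.ext_clm fun w => by
    refine (leftCLM_vec X _ w).trans (X.eq_vec fun v => ?_).symm
    rw [ContinuousLinearMap.star_eq_adjoint, ContinuousLinearMap.adjoint_inner_right, leftCLM_vec,
      X.inner_vec, ker_lmul_left, ker_lmul_right, mul_one, one_mul]

/-- The right action of `A` on the Fock space. -/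
noncomputable def right : Aᵐᵒᵖ →⋆ₐ[ℂ] (F →L[ℂ] F) where
  toFun a := X.rightCLM a.unop
  map_one' := X.total.ext_clm fun w => by simp
  map_mul' a b := X.total.ext_clm fun w => by simp [Word.rmul_rmul]
  map_zero' := X.total.ext_clm fun w => by
    have := X.vec_rmul_smul 0 0 w
    simpa using this
  map_add' a b := X.total.ext_clm fun w => by simp [X.vec_rmul_add]
  commutes' r := X.total.ext_clm fun w => by
    rw [rightCLM_vec, Algebra.algebraMap_eq_smul_one, MulOpposite.unop_smul, MulOpposite.unop_one,
      vec_rmul_smul, Word.rmul_one, Algebra.algebraMap_eq_smul_one]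
    rfl
  map_star' a := X.total.ext_clm fun w => by
    refine (rightCLM_vec X _ w).trans (X.eq_vec fun v => ?_).symm
    rw [ContinuousLinearMap.star_eq_adjoint, ContinuousLinearMap.adjoint_inner_right, rightCLM_vec,
      X.inner_vec, ker_rmul_left, MulOpposite.unop_star]

@[simp] theorem left_vec (a : A) (w : Word A ι) :
    X.left a (X.vec w) = X.vec (w.lmul a) := X.leftCLM_vec a w

@[simp] theorem right_vec (a : Aᵐᵒᵖ) (w : Word A ι) :
    X.right a (X.vec w) = X.vec (w.rmul a.unop) := X.rightCLM_vec a.unop w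

theorem norm_left_le (a : A) : ‖X.left a‖ ≤ ‖a‖ := (X.exists_left a).choose_spec.2

theorem norm_right_le (a : Aᵐᵒᵖ) : ‖X.right a‖ ≤ ‖a‖ := (X.exists_right a.unop).choose_spec.2

/-- The left semicircular operator. -/
noncomputable def semi (n : ι) : F →L[ℂ] F := X.lcre n + star (X.lcre n)

/-- The right semicircular operator. -/
noncomputable def rsemi (n : ι) : F →L[ℂ] F := X.rcre n + star (X.rcre n)

@[simp] theorem star_semi (n : ι) : star (X.semi n) = X.semi n := by
  rw [semi, star_add, star_star, add_comm]

@[simp] theorem star_rsemi (n : ι) : star (X.rsemi n) = X.rsemi n := by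
  rw [rsemi, star_add, star_star, add_comm]

theorem norm_semi_le (n : ι) : ‖X.semi n‖ ≤ 2 := by
  have h : ‖X.lcre n‖ ≤ 1 := (X.exists_lcre n).choose_spec.2
  have h1 := norm_add_le (X.lcre n) (star (X.lcre n))
  rw [norm_star] at h1
  exact h1.trans (by linarith)

theorem semi_vec (n : ι) (w : Word A ι) :
    X.semi n (X.vec w) = X.vec (.cons 1 n w) + X.vec (w.lann φ n) := by
  simp [semi]

theorem rsemi_vec (n : ι) (w : Word A ι) :
    X.rsemi n (X.vec w) = X.vec (w.rcre n) + X.vec (w.rann φ n) := by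
  simp [rsemi]

theorem commute_left_right (a : A) (b : Aᵐᵒᵖ) : Commute (X.left a) (X.right b) :=
  X.total.ext_clm fun w => by simp

theorem commute_left_rsemi (a : A) (n : ι) : Commute (X.left a) (X.rsemi n) :=
  X.total.ext_clm fun w => by simp [rsemi_vec]

theorem commute_semi_right (n : ι) (b : Aᵐᵒᵖ) : Commute (X.semi n) (X.right b) :=
  X.total.ext_clm fun w => by
    cases w with
    | nil x => simp [semi_vec, Word.lann, Word.rmul]
    | cons x m v => by_cases h : n = m <;> simp [semi_vec, Word.lann, Word.rmul, h]

/-- Left and right operators act on opposite ends of a word and can interfere only on short words.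
On a word x without index and with n = m, annihilating on the left after creating on the right, or
the reverse, both give φₙ(x). -/
theorem commute_semi_rsemi (n m : ι) : Commute (X.semi n) (X.rsemi m) :=
  X.total.ext_clm fun w => by
    cases w with
    | nil x =>
      by_cases h : n = m
      · subst h
        simp [semi_vec, rsemi_vec, Word.lann, Word.rann, Word.rcre, Word.lmul]
      · simp [semi_vec, rsemi_vec, Word.lann, Word.rann, Word.rcre, h, Ne.symm h]
    | cons x p v =>
      cases v with
      | nil y =>
        by_cases h : n = p
        · by_cases h' : m = p
          · simp [semi_vec, rsemi_vec, Word.lann, Word.rann, Word.rcre, Word.lmul, h, h']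
            abel
          · simp [semi_vec, rsemi_vec, Word.lann, Word.rann, Word.rcre, Word.lmul, h, h']
        · by_cases h' : m = p <;>
            simp [semi_vec, rsemi_vec, Word.lann, Word.rann, Word.rcre, h, h']
      | cons y q v =>
        by_cases h : n = p
        · subst h
          simp [semi_vec, rsemi_vec, Word.lann, Word.rann, Word.rcre]
          abel
        · simp [semi_vec, rsemi_vec, Word.lann, Word.rann, Word.rcre, h]

end FockSpace
end Fock
/-! ### Von Neumann algebras: C*-structure, weak compactness, normality -/

section VN

variable {H : Type u} [NormedAddCommGroup H] [InnerProductSpace ℂ H] [CompleteSpace H]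

theorem isClosed_coe (M : VonNeumannAlgebra H) : IsClosed (M : Set (H →L[ℂ] H)) := by
  rw [← M.centralizer_centralizer]
  exact Set.isClosed_centralizer _

instance instCompleteSpaceCoe (M : VonNeumannAlgebra H) : CompleteSpace M :=
  (isClosed_coe M).completeSpace_coe

instance instCStarRingCoe (M : VonNeumannAlgebra H) : CStarRing M where
  norm_mul_self_le x := CStarRing.norm_mul_self_le (x : H →L[ℂ] H)

noncomputable instance instCStarAlgebraCoe (M : VonNeumannAlgebra H) : CStarAlgebra M where

variable {M : VonNeumannAlgebra H}

/-- The underlying faithful tracial state. -/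
def FaithfulNormalTrace.toTrace (τ : FaithfulNormalTrace M) : FaithfulTrace M where
  toLin := τ.toLin
  map_one := τ.map_one
  nonneg := trace_star_mul_self_nonneg τ
  tracial := τ.tracial
  faithful := τ.faithful

/-- Convergence of a family in `M` in the weak operator topology. -/
def WOTTendsto {α : Type*} (g : α → M) (l : Filter α) (x : M) : Prop :=
  ∀ ξ η : H, Tendsto (fun a => inner ℂ ξ ((g a : H →L[ℂ] H) η)) l
    (𝓝 (inner ℂ ξ ((x : H →L[ℂ] H) η)))

theorem tendsto_nhds_induced_iff {α Y Z : Type*} [t : TopologicalSpace Z] (f : Y → Z) (g : α → Y)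
    (l : Filter α) (y : Y) :
    Tendsto g l (@nhds Y (t.induced f) y) ↔ Tendsto (f ∘ g) l (𝓝 (f y)) := by
  rw [nhds_induced, tendsto_comap_iff]

theorem wotTendsto_iff {α : Type*} {g : α → M} {l : Filter α} {x : M} :
    WOTTendsto g l x ↔ Tendsto g l (@nhds M (wotTopology M) x) := by
  let f : M → (H →WOT[ℂ] H) := fun x => ContinuousLinearMapWOT.ofCLM (x : H →L[ℂ] H)
  have h1 := ContinuousLinearMapWOT.tendsto_iff_forall_inner_apply_tendsto (f := f ∘ g) (l := l)
    (A := f x)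
  have h2 := @tendsto_nhds_induced_iff α M (H →WOT[ℂ] H) _ f g l x
  exact (forall_comm.trans h1.symm).trans h2.symm

/-- The filter form keeps the weak operator topology from competing with the norm topology as an
instance on `M`. -/
theorem isNormalFun_iff {f : M → ℂ} : IsNormalFun M f ↔
    ∀ (l : Filter M) (x : M), ‖x‖ ≤ 1 → (∀ᶠ y in l, ‖y‖ ≤ 1) → WOTTendsto id l x →
      Tendsto f l (𝓝 (f x)) := by
  constructor
  · intro h l x hx hl hw
    have h1 := h x hx
    refine Tendsto.mono_left h1 ?_
    exact le_inf (wotTendsto_iff.mp hw) (le_principal_iff.mpr hl)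
  · intro h x hx
    refine h _ x hx ?_ ?_
    · exact mem_inf_of_right (mem_principal_self _)
    · exact wotTendsto_iff.mpr (tendsto_id'.mpr inf_le_left)

theorem IsNormalFun.tendsto {f : M → ℂ} (hf : IsNormalFun M f) {α : Type*} {g : α → M}
    {l : Filter α} {x : M} (hx : ‖x‖ ≤ 1) (hl : ∀ᶠ a in l, ‖g a‖ ≤ 1) (hw : WOTTendsto g l x) :
    Tendsto (fun a => f (g a)) l (𝓝 (f x)) := by
  have h := isNormalFun_iff.mp hf (l.map g) x hx (eventually_map.mpr hl) fun ξ η => ?_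
  · exact tendsto_map'_iff.mp h
  · exact tendsto_map'_iff.mpr (hw ξ η)

theorem WOTTendsto.mul_left {α : Type*} {g : α → M} {l : Filter α} {x : M}
    (h : WOTTendsto g l x) (a : M) : WOTTendsto (fun i => a * g i) l (a * x) := by
  intro ξ η
  have h1 := h (star (a : H →L[ℂ] H) ξ) η
  simp only [ContinuousLinearMap.star_eq_adjoint, ContinuousLinearMap.adjoint_inner_left] at h1
  exact h1

theorem WOTTendsto.mul_right {α : Type*} {g : α → M} {l : Filter α} {x : M}
    (h : WOTTendsto g l x) (a : M) : WOTTendsto (fun i => g i * a) l (x * a) :=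
  fun ξ η => h ξ ((a : H →L[ℂ] H) η)

theorem WOTTendsto.smul {α : Type*} {g : α → M} {l : Filter α} {x : M}
    (h : WOTTendsto g l x) (c : ℂ) : WOTTendsto (fun i => c • g i) l (c • x) := by
  intro ξ η
  have h1 := (h ξ η).const_mul c
  simp only [← inner_smul_right] at h1
  exact h1

theorem IsNormalFun.tendsto_of_le {f : M →ₗ[ℂ] ℂ} (hf : IsNormalFun M f) {α : Type*} {g : α → M}
    {l : Filter α} {x : M} {C : ℝ} (hx : ‖x‖ ≤ C) (hl : ∀ᶠ a in l, ‖g a‖ ≤ C)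
    (hw : WOTTendsto g l x) : Tendsto (fun a => f (g a)) l (𝓝 (f x)) := by
  have hC : 0 ≤ C := (norm_nonneg x).trans hx
  -- Rescaling by C + 1 instead of C also covers C = 0.
  have hD : 0 < C + 1 := by linarith
  have hle : ∀ y : M, ‖y‖ ≤ C → ‖((C + 1 : ℝ) : ℂ)⁻¹ • y‖ ≤ 1 := by
    intro y hy
    rw [norm_smul, norm_inv, Complex.norm_real, Real.norm_of_nonneg hD.le,
      inv_mul_le_iff₀ hD]
    linarith
  have h := (hf.tendsto (hle x hx) (hl.mono fun a ha => hle _ ha)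
    (hw.smul ((C + 1 : ℝ) : ℂ)⁻¹)).const_mul ((C + 1 : ℝ) : ℂ)
  have hne : ((C + 1 : ℝ) : ℂ) ≠ 0 := Complex.ofReal_ne_zero.mpr hD.ne'
  simpa only [map_smul, smul_eq_mul, mul_inv_cancel_left₀ hne] using h

theorem IsNormalFun.mul_mul {f : M →ₗ[ℂ] ℂ} (hf : IsNormalFun M f) (a b : M) :
    IsNormalFun M fun x => f (a * x * b) := by
  rw [isNormalFun_iff]
  intro l x hx hl hw
  have hle : ∀ y : M, ‖y‖ ≤ 1 → ‖a * y * b‖ ≤ ‖a‖ * ‖b‖ := by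
    intro y hy
    calc ‖a * y * b‖ ≤ ‖a‖ * ‖y‖ * ‖b‖ :=
          (norm_mul_le _ _).trans (mul_le_mul_of_nonneg_right (norm_mul_le _ _) (norm_nonneg _))
      _ ≤ ‖a‖ * 1 * ‖b‖ := by gcongr
      _ = _ := by ring
  exact hf.tendsto_of_le (hle x hx) (hl.mono fun y hy => hle y hy)
    ((hw.mul_left a).mul_right b)

theorem IsNormalFun.mul_right {f : M →ₗ[ℂ] ℂ} (hf : IsNormalFun M f) (b : M) :
    IsNormalFun M fun x => f (x * b) := by
  simpa using hf.mul_mul 1 b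

theorem IsNormalFun.mul_left {f : M →ₗ[ℂ] ℂ} (hf : IsNormalFun M f) (a : M) :
    IsNormalFun M fun x => f (a * x) := by
  simpa using hf.mul_mul a 1

theorem IsNormalFun.add {f g : M → ℂ} (hf : IsNormalFun M f) (hg : IsNormalFun M g) :
    IsNormalFun M fun x => f x + g x := by
  rw [isNormalFun_iff] at *
  exact fun l x hx hl hw => (hf l x hx hl hw).add (hg l x hx hl hw)

theorem IsNormalFun.const_mul {f : M → ℂ} (hf : IsNormalFun M f) (c : ℂ) :
    IsNormalFun M fun x => c * f x := by
  rw [isNormalFun_iff] at *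
  exact fun l x hx hl hw => (hf l x hx hl hw).const_mul c

theorem isNormalFun_const (c : ℂ) : IsNormalFun M fun _ => c := by
  rw [isNormalFun_iff]
  exact fun l x hx hl hw => tendsto_const_nhds

theorem isNormalFun_of_approx {f : M → ℂ}
    (h : ∀ ε > 0, ∃ g : M → ℂ, IsNormalFun M g ∧ ∀ x : M, ‖x‖ ≤ 1 → ‖f x - g x‖ ≤ ε) :
    IsNormalFun M f := by
  rw [isNormalFun_iff]
  intro l x hx hl hw
  rw [Metric.tendsto_nhds]
  intro ε hε
  obtain ⟨g, hg, hfg⟩ := h (ε / 4) (by positivity)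
  have h1 := Metric.tendsto_nhds.mp (isNormalFun_iff.mp hg l x hx hl hw) (ε / 4) (by positivity)
  filter_upwards [h1, hl] with y hy hy1
  rw [dist_eq_norm] at hy ⊢
  have h2 := hfg y hy1
  have h3 := hfg x hx
  calc ‖f y - f x‖ = ‖(f y - g y) + (g y - g x) - (f x - g x)‖ := by congr 1; ring
    _ ≤ ‖f y - g y‖ + ‖g y - g x‖ + ‖f x - g x‖ :=
      (norm_sub_le _ _).trans (add_le_add_left (norm_add_le _ _) _)
    _ < ε := by linarith

theorem isNormalFun_inner (ξ η : H) :
    IsNormalFun M fun x => inner ℂ ξ ((x : H →L[ℂ] H) η) := by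
  rw [isNormalFun_iff]
  exact fun l x hx hl hw => hw ξ η

/-- Since ‖π x‖ ≤ ‖x‖, approximating η and then ξ by finite combinations of total vectors is uniform
over the unit ball, and uniform limits there preserve normality. -/
theorem isNormalFun_inner_of_total {W : Type*} {F : Type*} [NormedAddCommGroup F]
    [InnerProductSpace ℂ F] {vec : W → F} (hv : IsTotal vec) (π : M → F →L[ℂ] F)
    (hπ : ∀ x, ‖π x‖ ≤ ‖x‖)
    (h : ∀ v w, IsNormalFun M fun x => inner ℂ (vec v) (π x (vec w))) (ξ η : F) :
    IsNormalFun M fun x => inner ℂ ξ (π x η) := by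
  have hb : ∀ (ξ η : F) (x : M), ‖x‖ ≤ 1 → ‖inner ℂ ξ (π x η)‖ ≤ ‖ξ‖ * ‖η‖ := by
    intro ξ η x hx
    have h1 : ‖π x η‖ ≤ 1 * ‖η‖ := (π x).le_of_opNorm_le ((hπ x).trans hx) η
    rw [one_mul] at h1
    exact (norm_inner_le_norm _ _).trans (mul_le_mul_of_nonneg_left h1 (norm_nonneg _))
  have happ : ∀ (ξ : F) (δ : ℝ), 0 < δ → ∃ c, ‖ξ - Finsupp.linearCombination ℂ vec c‖ < δ := by
    intro ξ δ hδ
    obtain ⟨c, hc⟩ := hv.exists_dist_lt ξ hδ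
    exact ⟨c, by rwa [dist_eq_norm] at hc⟩
  have hsum : ∀ (s : Finset W) (g : W → M → ℂ), (∀ w ∈ s, IsNormalFun M (g w)) →
      IsNormalFun M fun x => ∑ w ∈ s, g w x := by
    classical
    intro s g hg
    induction s using Finset.induction_on with
    | empty => simpa using isNormalFun_const 0
    | insert a s ha ih =>
      simp only [Finset.sum_insert ha]
      exact (hg a (Finset.mem_insert_self a s)).add
        (ih fun w hw => hg w (Finset.mem_insert_of_mem hw))
  have h1 : ∀ (v : W) (η : F), IsNormalFun M fun x => inner ℂ (vec v) (π x η) := by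
    intro v η
    refine isNormalFun_of_approx fun ε hε => ?_
    obtain ⟨c, hc⟩ := happ η (ε / (‖vec v‖ + 1)) (by positivity)
    refine ⟨fun x => inner ℂ (vec v) (π x (Finsupp.linearCombination ℂ vec c)), ?_, ?_⟩
    · simp only [Finsupp.linearCombination_apply, Finsupp.sum, map_sum, inner_sum, map_smul,
        inner_smul_right]
      exact hsum _ _ fun w _ => (h v w).const_mul _
    · intro x hx
      rw [← inner_sub_right, ← map_sub]
      refine (hb _ _ x hx).trans ?_
      have h2 : ‖vec v‖ * (ε / (‖vec v‖ + 1)) ≤ ε := by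
        rw [mul_div_assoc', div_le_iff₀ (by positivity)]
        nlinarith [norm_nonneg (vec v)]
      exact (mul_le_mul_of_nonneg_left hc.le (norm_nonneg _)).trans h2
  refine isNormalFun_of_approx fun ε hε => ?_
  obtain ⟨c, hc⟩ := happ ξ (ε / (‖η‖ + 1)) (by positivity)
  refine ⟨fun x => inner ℂ (Finsupp.linearCombination ℂ vec c) (π x η), ?_, ?_⟩
  · simp only [Finsupp.linearCombination_apply, Finsupp.sum, sum_inner, inner_smul_left]
    exact hsum _ _ fun w _ => (h1 w η).const_mul _
  · intro x hx
    rw [← inner_sub_left]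
    refine (hb _ _ x hx).trans ?_
    have h2 : (ε / (‖η‖ + 1)) * ‖η‖ ≤ ε := by
      rw [div_mul_eq_mul_div, div_le_iff₀ (by positivity)]
      nlinarith [norm_nonneg η]
    exact (mul_le_mul_of_nonneg_right hc.le (norm_nonneg _)).trans h2

/-- Weak operator compactness of balls: the matrix coefficients converge in compact discs along the
ultrafilter, and the limits form a bounded sesquilinear form. -/
theorem exists_wotTendsto_ultrafilter {α : Type*} (𝓤 : Ultrafilter α) {h : α → M} {C : ℝ}
    (hC : ∀ a, ‖h a‖ ≤ C) : ∃ x : M, ‖x‖ ≤ C ∧ WOTTendsto h 𝓤 x := by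
  have hC0 : 0 ≤ C := by
    obtain ⟨a⟩ := 𝓤.neBot.nonempty
    exact (norm_nonneg _).trans (hC a)
  have hb : ∀ (a : α) (ξ η : H), ‖inner ℂ ((h a : H →L[ℂ] H) ξ) η‖ ≤ C * ‖ξ‖ * ‖η‖ := by
    intro a ξ η
    exact (norm_inner_le_norm _ _).trans (mul_le_mul_of_nonneg_right
      ((h a : H →L[ℂ] H).le_of_opNorm_le (hC a) ξ) (norm_nonneg _))
  have hlim : ∀ ξ η : H, ∃ z ∈ Metric.closedBall (0 : ℂ) (C * ‖ξ‖ * ‖η‖),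
      Tendsto (fun a => inner ℂ ((h a : H →L[ℂ] H) ξ) η) 𝓤 (𝓝 z) := by
    intro ξ η
    exact (isCompact_closedBall (0 : ℂ) (C * ‖ξ‖ * ‖η‖)).ultrafilter_le_nhds
      (𝓤.map fun a => inner ℂ ((h a : H →L[ℂ] H) ξ) η)
      (le_principal_iff.mpr (mem_map.mpr (Eventually.of_forall fun a => by simpa using hb a ξ η)))
  choose B hB hT using hlim
  let L : H →ₗ⋆[ℂ] H →ₗ[ℂ] ℂ := LinearMap.mk₂'ₛₗ (starRingEnd ℂ) (RingHom.id ℂ) B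
    (fun a b c => tendsto_nhds_unique (hT (a + b) c) (by
      simpa only [map_add, inner_add_left] using (hT a c).add (hT b c)))
    (fun r a c => tendsto_nhds_unique (hT (r • a) c) (by
      simpa only [map_smul, inner_smul_left, smul_eq_mul] using (hT a c).const_mul _))
    (fun a b c => tendsto_nhds_unique (hT a (b + c)) (by
      simpa only [inner_add_right] using (hT a b).add (hT a c)))
    (fun r a c => tendsto_nhds_unique (hT a (r • c)) (by
      simpa only [inner_smul_right, smul_eq_mul, RingHom.id_apply] using (hT a c).const_mul _))
  let L' : H →L⋆[ℂ] H →L[ℂ] ℂ := L.mkContinuous₂ C fun ξ η => by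
    have := hB ξ η
    rwa [mem_closedBall_zero_iff] at this
  let x : H →L[ℂ] H := InnerProductSpace.continuousLinearMapOfBilin L'
  have hx : ∀ ξ η, inner ℂ (x ξ) η = B ξ η := fun ξ η =>
    InnerProductSpace.continuousLinearMapOfBilin_apply L' ξ η
  have hxT : ∀ ξ η, Tendsto (fun a => inner ℂ ((h a : H →L[ℂ] H) ξ) η) 𝓤
      (𝓝 (inner ℂ (x ξ) η)) := fun ξ η => by rw [hx]; exact hT ξ η
  -- Commuting with an operator of the commutant survives weak limits, so the bicommutant property
  -- puts the limit in `M`.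
  have hxM : x ∈ M := by
    rw [← M.commutant_commutant, VonNeumannAlgebra.mem_commutant_iff]
    intro y hy
    rw [VonNeumannAlgebra.mem_commutant_iff] at hy
    ext ξ
    refine ext_inner_right ℂ fun η => ?_
    have h1 := hxT (y ξ) η
    have h2 := hxT ξ (star y η)
    rw [ContinuousLinearMap.star_eq_adjoint] at h2
    simp only [ContinuousLinearMap.adjoint_inner_right] at h2
    have e : (fun a => inner ℂ (y ((h a : H →L[ℂ] H) ξ)) η) =
        fun a => inner ℂ ((h a : H →L[ℂ] H) (y ξ)) η := by
      funext a
      have := congrArg (fun T : H →L[ℂ] H => inner ℂ (T ξ) η) (hy _ (h a).2)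
      exact this.symm
    rw [e] at h2
    exact tendsto_nhds_unique h2 h1
  refine ⟨⟨x, hxM⟩, ?_, fun ξ η => ?_⟩
  · refine ContinuousLinearMap.opNorm_le_bound _ hC0 fun ξ => ?_
    change ‖x ξ‖ ≤ C * ‖ξ‖
    have h1 : ‖inner ℂ (x ξ) (x ξ)‖ ≤ C * ‖ξ‖ * ‖x ξ‖ := by
      rw [hx]; simpa using hB ξ (x ξ)
    rw [inner_self_eq_ofReal, Complex.norm_real, Real.norm_of_nonneg (sq_nonneg _), sq] at h1
    rcases (norm_nonneg (x ξ)).eq_or_lt with h0 | h0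
    · rw [← h0]; positivity
    · exact le_of_mul_le_mul_right h1 h0
  · have := (Complex.continuous_conj.tendsto _).comp (hxT η ξ)
    simpa only [Function.comp_def, inner_conj_symm] using this

/-- Turns an L² limit of uniformly bounded elements into an element of `M`: a weak cluster point has
the prescribed traces by normality. -/
theorem exists_trace_eq_of_tendsto {τ : FaithfulTrace M} (hτ : IsNormalFun M τ.toLin) {h : ℕ → M}
    {C : ℝ} (hC : ∀ n, ‖h n‖ ≤ C) {L : M → ℂ}
    (hL : ∀ y, Tendsto (fun n => τ.toLin (y * h n)) atTop (𝓝 (L y))) :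
    ∃ x : M, ‖x‖ ≤ C ∧ ∀ y, τ.toLin (y * x) = L y := by
  obtain ⟨x, hx, hw⟩ := exists_wotTendsto_ultrafilter (hyperfilter ℕ) hC
  refine ⟨x, hx, fun y => ?_⟩
  have hle : ∀ z : M, ‖z‖ ≤ C → ‖y * z‖ ≤ ‖y‖ * C := fun z hz =>
    (norm_mul_le _ _).trans (mul_le_mul_of_nonneg_left hz (norm_nonneg _))
  exact tendsto_nhds_unique (hτ.tendsto_of_le (hle x hx)
    (Eventually.of_forall fun n => hle _ (hC n)) (hw.mul_left y))
    ((hL y).mono_left (Nat.hyperfilter_le_atTop))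

end VN
/-! ### Traces on commutants -/

section Commutant

variable {F : Type u} [NormedAddCommGroup F] [InnerProductSpace ℂ F] [CompleteSpace F]

/-- The commutant of a set of operators and their adjoints. -/
noncomputable def commutantOf (R : Set (F →L[ℂ] F)) : VonNeumannAlgebra F where
  toStarSubalgebra := StarSubalgebra.centralizer ℂ R
  centralizer_centralizer' := by
    change Set.centralizer (Set.centralizer (StarSubalgebra.centralizer ℂ R : Set (F →L[ℂ] F))) =
      (StarSubalgebra.centralizer ℂ R : Set (F →L[ℂ] F))
    rw [StarSubalgebra.coe_centralizer, Set.centralizer_centralizer_centralizer]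

variable {R : Set (F →L[ℂ] F)} {Ω : F}

theorem mem_commutantOf {z : F →L[ℂ] F} :
    z ∈ commutantOf R ↔ ∀ g ∈ R, g * z = z * g ∧ star g * z = z * star g :=
  StarSubalgebra.mem_centralizer_iff ℂ

theorem inner_star_left (x : F →L[ℂ] F) (v w : F) : inner ℂ (star x v) w = inner ℂ v (x w) := by
  rw [ContinuousLinearMap.star_eq_adjoint, ContinuousLinearMap.adjoint_inner_left]

theorem inner_star_right (x : F →L[ℂ] F) (v w : F) : inner ℂ v (star x w) = inner ℂ (x v) w := by
  rw [ContinuousLinearMap.star_eq_adjoint, ContinuousLinearMap.adjoint_inner_right]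

/-- An element `s` of the commutant of `R` for which the vector state of `Ω` satisfies the trace
identity against all elements of the commutant. -/
def IsTraceable (R : Set (F →L[ℂ] F)) (Ω : F) (s : F →L[ℂ] F) : Prop :=
  s ∈ commutantOf R ∧ ∀ x ∈ commutantOf R, inner ℂ Ω (x (s Ω)) = inner ℂ Ω (s (x Ω))

theorem IsTraceable.add {s t : F →L[ℂ] F} (hs : IsTraceable R Ω s) (ht : IsTraceable R Ω t) :
    IsTraceable R Ω (s + t) := by
  refine ⟨add_mem hs.1 ht.1, fun x hx => ?_⟩
  simp only [add_apply, map_add, inner_add_right, hs.2 x hx, ht.2 x hx]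

theorem IsTraceable.smul {s : F →L[ℂ] F} (hs : IsTraceable R Ω s) (c : ℂ) :
    IsTraceable R Ω (c • s) := by
  refine ⟨SMulMemClass.smul_mem c hs.1, fun x hx => ?_⟩
  simp only [smul_apply, map_smul, inner_smul_right, hs.2 x hx]

theorem isTraceable_zero : IsTraceable R Ω 0 :=
  ⟨zero_mem _, fun x _ => by simp⟩

/-- Cyclic rotation in two moves: x·s·t becomes t·x·s, then s·t·x. Hence the trace identity need
only be checked on generators. -/
theorem IsTraceable.mul {s t : F →L[ℂ] F} (hs : IsTraceable R Ω s) (ht : IsTraceable R Ω t) :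
    IsTraceable R Ω (s * t) := by
  refine ⟨mul_mem hs.1 ht.1, fun x hx => ?_⟩
  have h1 := ht.2 (x * s) (mul_mem hx hs.1)
  have h2 := hs.2 (t * x) (mul_mem ht.1 hx)
  exact h1.trans h2

/-- At Ω the operator s can be traded for r, which commutes with every x in the commutant and so
passes to the other side. -/
theorem isTraceable_of_partner {s r : F →L[ℂ] F} (hs : s ∈ commutantOf R) (hr : r ∈ R)
    (h1 : r Ω = s Ω) (h2 : star r Ω = star s Ω) : IsTraceable R Ω s := by
  refine ⟨hs, fun x hx => ?_⟩
  have h3 : x (r Ω) = r (x Ω) := (DFunLike.congr_fun (mem_commutantOf.mp hx r hr).1 Ω).symm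
  rw [← h1, h3, ← inner_star_left, h2, inner_star_left]

/-- The traceable elements, applied to `Ω`, are dense. -/
def IsTraceCyclic (R : Set (F →L[ℂ] F)) (Ω : F) : Prop :=
  ∀ (v : F) (ε : ℝ), 0 < ε → ∃ s, IsTraceable R Ω s ∧ ‖v - s Ω‖ < ε

theorem isTraceCyclic_of_total {W : Type*} {vec : W → F} (hv : IsTotal vec)
    (h : ∀ w, ∃ s, IsTraceable R Ω s ∧ s Ω = vec w) : IsTraceCyclic R Ω := by
  intro v ε hε
  obtain ⟨c, hc⟩ := hv.exists_dist_lt v hε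
  rw [dist_eq_norm] at hc
  suffices hs : ∃ s, IsTraceable R Ω s ∧ s Ω = Finsupp.linearCombination ℂ vec c by
    obtain ⟨s, hs, e⟩ := hs
    exact ⟨s, hs, by rwa [e]⟩
  clear hc
  induction c using Finsupp.induction_linear with
  | zero => exact ⟨0, isTraceable_zero, by simp⟩
  | add c d hc hd =>
    obtain ⟨s, hs, es⟩ := hc
    obtain ⟨t, ht, et⟩ := hd
    exact ⟨s + t, hs.add ht, by simp [es, et]⟩
  | single w r =>
    obtain ⟨s, hs, es⟩ := h w
    exact ⟨r • s, hs.smul r, by simp [es]⟩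

theorem IsTraceable.norm_star_apply {s : F →L[ℂ] F} (hs : IsTraceable R Ω s) :
    ‖star s Ω‖ = ‖s Ω‖ := by
  have h := hs.2 (star s) (star_mem hs.1)
  rw [inner_star_right, inner_self_eq_ofReal, ← inner_star_left, inner_self_eq_ofReal] at h
  have h1 := Complex.ofReal_injective h
  exact ((pow_left_inj₀ (norm_nonneg _) (norm_nonneg _) two_ne_zero).mp h1).symm

/-- For traceable s one has ⟨z*Ω, sΩ⟩ = ⟨s*Ω, zΩ⟩ and ‖s*Ω‖ = ‖sΩ‖. Letting sΩ tend to z*Ω gives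
‖z*Ω‖² ≤ ‖zΩ‖‖z*Ω‖. -/
theorem norm_star_apply_le (hd : IsTraceCyclic R Ω)
    {z : F →L[ℂ] F} (hz : z ∈ commutantOf R) : ‖star z Ω‖ ≤ ‖z Ω‖ := by
  have key : ∀ ε : ℝ, 0 < ε → ‖star z Ω‖ * ‖star z Ω‖ ≤ ‖z Ω‖ * ‖star z Ω‖ +
      ε * (‖star z Ω‖ + ‖z Ω‖) := by
    intro ε hε
    obtain ⟨s, hs, hlt⟩ := hd (star z Ω) ε hε
    have h1 : ‖inner ℂ (star z Ω) (s Ω)‖ ≤ ‖z Ω‖ * ‖s Ω‖ := by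
      rw [inner_star_left, hs.2 z hz, ← inner_star_left, ← hs.norm_star_apply, mul_comm]
      exact norm_inner_le_norm _ _
    have h2 : ‖inner ℂ (star z Ω) (star z Ω - s Ω)‖ ≤ ‖star z Ω‖ * ε :=
      (norm_inner_le_norm _ _).trans (mul_le_mul_of_nonneg_left hlt.le (norm_nonneg _))
    have h3 : ‖inner ℂ (star z Ω) (star z Ω)‖ = ‖star z Ω‖ * ‖star z Ω‖ := by
      rw [inner_self_eq_ofReal, Complex.norm_real, Real.norm_of_nonneg (sq_nonneg _), sq]
    have h4 : ‖inner ℂ (star z Ω) (star z Ω)‖ ≤ ‖inner ℂ (star z Ω) (star z Ω - s Ω)‖ +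
        ‖inner ℂ (star z Ω) (s Ω)‖ := by
      refine le_trans (le_of_eq ?_) (norm_add_le _ _)
      rw [← inner_add_right, sub_add_cancel]
    have h5 : ‖s Ω‖ ≤ ‖star z Ω‖ + ε := by
      have h6 := norm_sub_le (star z Ω) (star z Ω - s Ω)
      rw [sub_sub_cancel] at h6
      linarith
    nlinarith [norm_nonneg (z Ω), norm_nonneg (star z Ω), mul_le_mul_of_nonneg_left h5 (norm_nonneg (z Ω))]
  by_contra! hlt
  have h0 : 0 < ‖star z Ω‖ := (norm_nonneg _).trans_lt hlt
  have hS : 0 < ‖star z Ω‖ + ‖z Ω‖ := by positivity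
  -- This ε makes the error term exactly half of the supposed gap (‖z*Ω‖ - ‖zΩ‖)‖z*Ω‖.
  have h1 := key ((‖star z Ω‖ - ‖z Ω‖) * ‖star z Ω‖ / (2 * (‖star z Ω‖ + ‖z Ω‖)))
    (div_pos (mul_pos (sub_pos.mpr hlt) h0) (by positivity))
  have h2 : (‖star z Ω‖ - ‖z Ω‖) * ‖star z Ω‖ / (2 * (‖star z Ω‖ + ‖z Ω‖)) *
      (‖star z Ω‖ + ‖z Ω‖) = (‖star z Ω‖ - ‖z Ω‖) * ‖star z Ω‖ / 2 := by
    field_simp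
  rw [h2] at h1
  nlinarith [mul_pos (sub_pos.mpr hlt) h0]

/-- Replace y by a traceable s with sΩ close to yΩ; the previous bound makes (y - s)*Ω small as
well, so both sides change little. -/
theorem inner_mul_comm (hd : IsTraceCyclic R Ω)
    {x y : F →L[ℂ] F} (hx : x ∈ commutantOf R) (hy : y ∈ commutantOf R) :
    inner ℂ Ω (x (y Ω)) = inner ℂ Ω (y (x Ω)) := by
  refine eq_of_forall_dist_le fun ε hε => ?_
  obtain ⟨s, hs, hlt⟩ := hd (y Ω) (ε / (‖star x Ω‖ + ‖x Ω‖ + 1)) (by positivity)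
  have hz : y - s ∈ commutantOf R := sub_mem hy hs.1
  have e : inner ℂ Ω (x (y Ω)) - inner ℂ Ω (y (x Ω)) =
      inner ℂ (star x Ω) ((y - s) Ω) - inner ℂ (star (y - s) Ω) (x Ω) := by
    have := hs.2 x hx
    simp only [inner_star_left, sub_apply, inner_sub_right]
    linear_combination this
  rw [dist_eq_norm, e]
  have h1 : ‖(y - s) Ω‖ ≤ ε / (‖star x Ω‖ + ‖x Ω‖ + 1) := hlt.le
  calc _ ≤ ‖inner ℂ (star x Ω) ((y - s) Ω)‖ + ‖inner ℂ (star (y - s) Ω) (x Ω)‖ := norm_sub_le _ _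
    _ ≤ ‖star x Ω‖ * ‖(y - s) Ω‖ + ‖(y - s) Ω‖ * ‖x Ω‖ :=
      add_le_add (norm_inner_le_norm _ _) ((norm_inner_le_norm _ _).trans
        (mul_le_mul_of_nonneg_right (norm_star_apply_le hd hz) (norm_nonneg _)))
    _ = (‖star x Ω‖ + ‖x Ω‖) * ‖(y - s) Ω‖ := by ring
    _ ≤ (‖star x Ω‖ + ‖x Ω‖ + 1) * (ε / (‖star x Ω‖ + ‖x Ω‖ + 1)) :=
      mul_le_mul (by linarith) h1 (norm_nonneg _) (by positivity)
    _ = ε := by field_simp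

/-- A cyclic trace vector is separating: the trace property turns ‖xsΩ‖² into ⟨Ω, xss*x*Ω⟩ = ⟨Ω,
ss*x*xΩ⟩ = 0 for traceable s, and the vectors sΩ are dense. -/
theorem eq_zero_of_apply_eq_zero (hd : IsTraceCyclic R Ω)
    {x : F →L[ℂ] F} (hx : x ∈ commutantOf R) (h : x Ω = 0) :
    x = 0 := by
  have key : ∀ s, IsTraceable R Ω s → x (s Ω) = 0 := by
    intro s hs
    have h1 := inner_mul_comm hd (x := s * (star s * star x)) (y := x)
      (mul_mem hs.1 (mul_mem (star_mem hs.1) (star_mem hx))) hx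
    rw [h, map_zero, inner_zero_right] at h1
    have h2 := inner_mul_comm hd (x := x * s) (y := star (x * s)) (mul_mem hx hs.1)
      (star_mem (mul_mem hx hs.1))
    have h3 : inner ℂ Ω ((x * s) (star (x * s) Ω)) = 0 := by
      rw [star_mul]; exact h1.symm
    rw [h3, inner_star_right] at h2
    exact (inner_self_eq_zero (𝕜 := ℂ)).mp h2.symm
  ext v
  rw [zero_apply, ← norm_le_zero_iff]
  refine le_of_forall_pos_le_add fun ε hε => ?_
  obtain ⟨s, hs, hlt⟩ := hd v (ε / (‖x‖ + 1)) (by positivity)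
  have h1 : x v = x (v - s Ω) := by rw [map_sub, key s hs, sub_zero]
  rw [h1, zero_add]
  calc ‖x (v - s Ω)‖ ≤ ‖x‖ * (ε / (‖x‖ + 1)) :=
        (x.le_opNorm _).trans (mul_le_mul_of_nonneg_left hlt.le (norm_nonneg _))
    _ ≤ (‖x‖ + 1) * (ε / (‖x‖ + 1)) := by gcongr; linarith
    _ = ε := by field_simp

/-- The vector state of a cyclic trace vector, as a faithful normal tracial state on the
commutant. -/
noncomputable def vectorTrace (hΩ : ‖Ω‖ = 1) (hd : IsTraceCyclic R Ω) :
    FaithfulNormalTrace (commutantOf R) where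
  toLin :=
    { toFun := fun x => inner ℂ Ω ((x : F →L[ℂ] F) Ω)
      map_add' := fun x y => inner_add_right _ _ _
      map_smul' := fun c x => inner_smul_right _ _ _ }
  map_one := by
    change inner ℂ Ω Ω = 1
    rw [inner_self_eq_ofReal, hΩ]
    simp
  nonneg x hx := by
    exact hx.inner_nonneg_right Ω
  tracial x y := inner_mul_comm hd x.2 y.2
  faithful x h := by
    change inner ℂ Ω (star (x : F →L[ℂ] F) ((x : F →L[ℂ] F) Ω)) = 0 at h
    rw [inner_star_right, inner_self_eq_zero] at h
    exact Subtype.ext (eq_zero_of_apply_eq_zero hd x.2 h)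
  normal := isNormalFun_inner Ω Ω

end Commutant
/-! ### The Radon-Nikodym theorem for a trace -/

theorem norm_one_le_one {A : Type*} [CStarAlgebra A] : ‖(1 : A)‖ ≤ 1 := by
  cases subsingleton_or_nontrivial A
  · simp [Subsingleton.elim (1 : A) 0]
  · exact CStarRing.norm_one.le

/-- Used for truncation: 1 - p*p is the minimum of x*x and 1. -/
theorem exists_posPart_negPart_of_le_one {A : Type*} [CStarAlgebra A] (x : A) :
    ∃ p q : A, 1 - star x * x = star p * p - star q * q ∧ star p * p * (star q * q) = 0 ∧
      ‖star p * p‖ ≤ 1 := by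
  let _ := CStarAlgebra.spectralOrder A
  have _ := CStarAlgebra.spectralOrderedRing A
  have ha : IsSelfAdjoint (1 - star x * x) := (IsSelfAdjoint.one A).sub (.star_mul_self x)
  obtain ⟨p, hp⟩ := CStarAlgebra.nonneg_iff_eq_star_mul_self.mp
    (CFC.posPart_nonneg (1 - star x * x))
  obtain ⟨q, hq⟩ := CStarAlgebra.nonneg_iff_eq_star_mul_self.mp
    (CFC.negPart_nonneg (1 - star x * x))
  refine ⟨p, q, ?_, ?_, ?_⟩
  · rw [← hp, ← hq, CFC.posPart_sub_negPart _ ha]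
  · rw [← hp, ← hq, CFC.posPart_mul_negPart]
  · rw [← hp, CStarAlgebra.norm_le_one_iff_of_nonneg _ (CFC.posPart_nonneg _),
      CFC.posPart_def, cfcₙ_eq_cfc]
    refine cfc_le_one _ _ fun t ht => ?_
    have h1 : (1 - star x * x) ≤ algebraMap ℝ A 1 := by
      rw [map_one, sub_le_self_iff]
      exact star_mul_self_nonneg x
    have h2 := (le_algebraMap_iff_spectrum_le (R := ℝ) ha).mp h1 t ht
    exact sup_le h2 zero_le_one

/-! ### The vectors of words of length zero, and L²(A, τ). -/

namespace FockSpace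

variable {A : Type u} [CStarAlgebra A] {τ : FaithfulTrace A} {ι : Type} [DecidableEq ι]
  {φ : ι → Covariance τ} {F : Type*} [NormedAddCommGroup F] [InnerProductSpace ℂ F]
  (X : FockSpace φ F)

/-- The vector of a word of length zero, as a linear map. -/
noncomputable def nilVec : A →ₗ[ℂ] F where
  toFun x := X.vec (.nil x)
  map_add' x y := by simpa [Word.lmul] using X.vec_lmul_add x y (.nil 1)
  map_smul' r x := by simpa [Word.lmul] using X.vec_lmul_smul r x (.nil 1)

theorem nilVec_apply (x : A) : X.nilVec x = X.vec (.nil x) := rfl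

theorem inner_nilVec (x y : A) : inner ℂ (X.nilVec x) (X.nilVec y) = τ.toLin (star x * y) := by
  simp [nilVec_apply, X.inner_vec]

theorem norm_nilVec_sq (x : A) : ((‖X.nilVec x‖ ^ 2 : ℝ) : ℂ) = τ.toLin (star x * x) := by
  rw [← inner_self_eq_ofReal, inner_nilVec]

theorem norm_nilVec_star (x : A) : ‖X.nilVec (star x)‖ = ‖X.nilVec x‖ := by
  have h1 := X.norm_nilVec_sq (star x)
  rw [star_star, τ.tracial, ← X.norm_nilVec_sq] at h1
  exact (pow_left_inj₀ (norm_nonneg _) (norm_nonneg _) two_ne_zero).mp (Complex.ofReal_injective h1)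

theorem nilVec_injective : Function.Injective X.nilVec := by
  rw [injective_iff_map_eq_zero]
  intro x hx
  refine τ.faithful x ?_
  rw [← X.norm_nilVec_sq, hx]
  simp

end FockSpace

/-- The space `L²(A, τ)`: the Fock space without indices. -/
abbrev L2Space {A : Type u} [CStarAlgebra A] (τ : FaithfulTrace A) (F : Type*)
    [NormedAddCommGroup F] [InnerProductSpace ℂ F] :=
  FockSpace (fun n : Empty => (n.elim : Covariance τ)) F

namespace L2Space

variable {A : Type u} [CStarAlgebra A] {τ : FaithfulTrace A} {F : Type*} [NormedAddCommGroup F]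
  [InnerProductSpace ℂ F] (X : L2Space τ F)

theorem nilVec_sum (c : Word A Empty →₀ ℂ) :
    X.nilVec (c.sum fun w r => r • w.head) = Finsupp.linearCombination ℂ X.vec c := by
  rw [Finsupp.linearCombination_apply, map_finsuppSum]
  refine Finsupp.sum_congr fun w _ => ?_
  rw [map_smul]
  cases w with
  | nil x => rfl
  | cons x n w => exact n.elim

theorem exists_nilVec_norm_sub_lt (η : F) {ε : ℝ} (hε : 0 < ε) : ∃ m, ‖η - X.nilVec m‖ < ε := by
  obtain ⟨c, hc⟩ := X.total.exists_dist_lt η hε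
  exact ⟨_, by rwa [dist_eq_norm, ← X.nilVec_sum] at hc⟩

end L2Space

section RadonNikodym

variable {A : Type u} [CStarAlgebra A] {τ : FaithfulTrace A} {ψ : A →ₗ[ℂ] ℂ}
  {F : Type u} [NormedAddCommGroup F] [InnerProductSpace ℂ F]

/-- Cauchy-Schwarz, by evaluating ψ at the square of y - ψ(y)1 and using ψ(1) ≤ 1. -/
theorem norm_apply_le_norm_nilVec (hpos : ∀ y, 0 ≤ ψ (star y * y))
    (hle : ∀ y, ψ (star y * y) ≤ τ.toLin (star y * y)) (X : L2Space τ F) (y : A) :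
    ‖ψ y‖ ≤ ‖X.nilVec y‖ := by
  have h1 := hpos (y - ψ y • 1)
  have h2 : ψ 1 ≤ 1 := by simpa [τ.map_one] using hle 1
  have e : ψ (star (y - ψ y • 1) * (y - ψ y • 1)) =
      ψ (star y * y) - ((‖ψ y‖ ^ 2 : ℝ) : ℂ) * (2 - ψ 1) := by
    have h3 : ψ (star y) = star (ψ y) := map_star_of_nonneg hpos y
    have h4 : star (ψ y) * ψ y = ((‖ψ y‖ ^ 2 : ℝ) : ℂ) := by
      rw [Complex.star_def, Complex.conj_mul']; norm_cast
    simp only [star_sub, star_smul, star_one, sub_mul, mul_sub, map_sub, smul_mul_assoc,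
      mul_smul_comm, one_mul, mul_one, map_smul, smul_eq_mul, h3]
    linear_combination (ψ 1 - 2) * h4
  rw [e, sub_nonneg] at h1
  have h5 : ((‖ψ y‖ ^ 2 : ℝ) : ℂ) ≤ ((‖ψ y‖ ^ 2 : ℝ) : ℂ) * (2 - ψ 1) := by
    refine le_mul_of_one_le_right (Complex.zero_le_real.mpr (sq_nonneg _)) ?_
    have := sub_le_sub_left h2 2
    norm_num at this
    exact this
  have h6 := (h5.trans h1).trans (hle y)
  rw [← X.norm_nilVec_sq] at h6
  exact (pow_le_pow_iff_left₀ (norm_nonneg _) (norm_nonneg _) two_ne_zero).mp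
    (Complex.real_le_real.mp h6)

theorem exists_inner_nilVec_eq [CompleteSpace F] (hpos : ∀ y, 0 ≤ ψ (star y * y))
    (hle : ∀ y, ψ (star y * y) ≤ τ.toLin (star y * y)) (X : L2Space τ F) :
    ∃ η : F, ∀ y, inner ℂ η (X.nilVec y) = ψ y := by
  obtain ⟨T, hT, -⟩ := X.total.exists_clm (g := fun w => ψ w.head) zero_le_one (fun c => by
    have e : Finsupp.linearCombination ℂ (fun w : Word A Empty => ψ w.head) c =
        ψ (c.sum fun w r => r • w.head) := by
      rw [Finsupp.linearCombination_apply, map_finsuppSum]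
      simp
    rw [e, one_mul, ← X.nilVec_sum]
    exact norm_apply_le_norm_nilVec hpos hle X _)
  refine ⟨(InnerProductSpace.toDual ℂ F).symm T, fun y => ?_⟩
  rw [InnerProductSpace.toDual_symm_apply]
  exact hT (.nil y)

theorem norm_sub_nilVec_sq {η : F} {X : L2Space τ F} (hη : ∀ y, inner ℂ η (X.nilVec y) = ψ y)
    (m : A) :
    ‖η - X.nilVec m‖ ^ 2 = ‖η‖ ^ 2 - 2 * (ψ m).re + (τ.toLin (star m * m)).re := by
  rw [norm_sub_sq (𝕜 := ℂ), hη, ← X.norm_nilVec_sq, Complex.ofReal_re]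
  rfl

/-- Taking the real part, then the positive part, then truncating at 1 never increases the distance
to η, because ψ is respectively Hermitian, positive and dominated by τ. The bound 2 is crude; only
its independence of m matters. -/
theorem exists_norm_le_two_norm_sub_nilVec_le {X : L2Space τ F} (hpos : ∀ y, 0 ≤ ψ (star y * y))
    (hle : ∀ y, ψ (star y * y) ≤ τ.toLin (star y * y)) {η : F}
    (hη : ∀ y, inner ℂ η (X.nilVec y) = ψ y) (m : A) :
    ∃ c : A, ‖c‖ ≤ 2 ∧ ‖η - X.nilVec c‖ ≤ ‖η - X.nilVec m‖ := by
  have hre : ∀ y, 0 ≤ (τ.toLin (star y * y)).re := fun y => (Complex.nonneg_iff.mp (τ.nonneg y)).1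
  have hψre : ∀ y, 0 ≤ (ψ (star y * y)).re := fun y => (Complex.nonneg_iff.mp (hpos y)).1
  have hψle : ∀ y, (ψ (star y * y)).re ≤ (τ.toLin (star y * y)).re := fun y =>
    (Complex.le_def.mp (hle y)).1
  have hadj : ‖η - X.nilVec (star m)‖ = ‖η - X.nilVec m‖ := by
    refine (pow_left_inj₀ (norm_nonneg _) (norm_nonneg _) two_ne_zero).mp ?_
    rw [norm_sub_nilVec_sq hη, norm_sub_nilVec_sq hη, map_star_of_nonneg hpos, star_star,
      τ.tracial m, Complex.star_def, Complex.conj_re]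
  let s : A := (1 / 2 : ℂ) • (m + star m)
  have hs : IsSelfAdjoint s := by
    simp [s, IsSelfAdjoint, star_smul, add_comm]
  have h1 : ‖η - X.nilVec s‖ ≤ ‖η - X.nilVec m‖ := by
    have e : η - X.nilVec s =
        (1 / 2 : ℂ) • (η - X.nilVec m) + (1 / 2 : ℂ) • (η - X.nilVec (star m)) := by
      simp only [s, map_smul, map_add, smul_sub, smul_add]
      have : η = (1 / 2 : ℂ) • η + (1 / 2 : ℂ) • η := by
        rw [← add_smul]; norm_num
      nth_rewrite 1 [this]
      abel
    rw [e]
    refine (norm_add_le _ _).trans ?_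
    rw [norm_smul, norm_smul, hadj]
    norm_num
    linarith
  obtain ⟨p, q, epq, hpq, -⟩ := exists_posPart_negPart hs
  have hqp : star q * q * (star p * p) = 0 := by
    simpa [mul_assoc] using congrArg star hpq
  have h2 : ‖η - X.nilVec (star p * p)‖ ≤ ‖η - X.nilVec s‖ := by
    refine (pow_le_pow_iff_left₀ (norm_nonneg _) (norm_nonneg _) two_ne_zero).mp ?_
    rw [norm_sub_nilVec_sq hη, norm_sub_nilVec_sq hη, hs.star_eq, epq]
    have e : (star p * p - star q * q) * (star p * p - star q * q) =
        star (star p * p) * (star p * p) + star (star q * q) * (star q * q) := by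
      simp only [sub_mul, mul_sub, hpq, hqp, star_mul, star_star]
      abel
    rw [e, map_sub, map_add, Complex.sub_re, Complex.add_re]
    linarith [hψre q, hre (star q * q)]
  obtain ⟨p', q', epq', hpq', hp'⟩ := exists_posPart_negPart_of_le_one p
  have hqp' : star q' * q' * (star p' * p') = 0 := by
    simpa [mul_assoc] using congrArg star hpq'
  have h3 : ‖η - X.nilVec (1 - star p' * p')‖ ≤ ‖η - X.nilVec (star p * p)‖ := by
    refine (pow_le_pow_iff_left₀ (norm_nonneg _) (norm_nonneg _) two_ne_zero).mp ?_
    have e0 : star p * p = (1 - star p' * p') + star q' * q' := by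
      rw [← sub_sub_cancel 1 (star p * p), epq']
      abel
    rw [norm_sub_nilVec_sq hη, norm_sub_nilVec_sq hη, e0]
    have e : star ((1 - star p' * p') + star q' * q') * ((1 - star p' * p') + star q' * q') =
        star (1 - star p' * p') * (1 - star p' * p') + (star q' * q' + star q' * q') +
          star (star q' * q') * (star q' * q') := by
      simp only [star_add, star_sub, star_one, star_mul, star_star, sub_mul, mul_sub, add_mul,
        mul_add, hpq', hqp', one_mul, mul_one]
      abel
    rw [e]
    simp only [map_add, Complex.add_re]
    linarith [hψle q', hre (star q' * q')]
  refine ⟨1 - star p' * p', ?_, h3.trans (h2.trans h1)⟩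
  calc ‖1 - star p' * p'‖ ≤ ‖(1 : A)‖ + ‖star p' * p'‖ := norm_sub_le _ _
    _ ≤ 1 + 1 := add_le_add norm_one_le_one hp'
    _ = 2 := by norm_num

end RadonNikodym

/-- Radon-Nikodym: the Riesz vector of ψ is an L² limit of uniformly bounded elements, so weak
compactness makes it an element of `M`. -/
theorem exists_trace_mul_eq {H : Type u} [NormedAddCommGroup H] [InnerProductSpace ℂ H]
    [CompleteSpace H] {M : VonNeumannAlgebra H} {τ : FaithfulTrace M}
    (hτ : IsNormalFun M τ.toLin) {ψ : M →ₗ[ℂ] ℂ} (hpos : ∀ y, 0 ≤ ψ (star y * y))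
    (hle : ∀ y, ψ (star y * y) ≤ τ.toLin (star y * y)) :
    ∃ h : M, ∀ y, ψ y = τ.toLin (h * y) := by
  obtain ⟨F, _, _, _, ⟨X⟩⟩ := exists_fockSpace (fun n : Empty => (n.elim : Covariance τ))
  obtain ⟨η, hη⟩ := exists_inner_nilVec_eq hpos hle X
  have hδ : ∀ n : ℕ, (0 : ℝ) < 1 / ((n : ℝ) + 1) := fun n => by positivity
  choose m hm using fun n : ℕ => L2Space.exists_nilVec_norm_sub_lt X η (hδ n)
  choose c hc hcm using fun n => exists_norm_le_two_norm_sub_nilVec_le hpos hle hη (m n)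
  have hlim : Tendsto (fun n => X.nilVec (c n)) atTop (𝓝 η) := by
    rw [tendsto_iff_norm_sub_tendsto_zero]
    refine squeeze_zero (fun n => norm_nonneg _) (fun n => ?_)
      tendsto_one_div_add_atTop_nhds_zero_nat
    rw [norm_sub_rev]
    exact (hcm n).trans (hm n).le
  obtain ⟨x, -, hx⟩ := exists_trace_eq_of_tendsto hτ hc (L := ψ) fun y => by
    have h1 : Tendsto (fun n => inner ℂ (X.nilVec (star y)) (X.nilVec (c n))) atTop
      (𝓝 (inner ℂ (X.nilVec (star y)) η)) := tendsto_const_nhds.inner hlim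
    simp only [X.inner_nilVec, star_star] at h1
    rwa [← inner_conj_symm, hη, map_star_of_nonneg hpos, Complex.star_def,
      Complex.conj_conj] at h1
  exact ⟨x, fun y => by rw [← hx y, τ.tracial]⟩

/-! ### Uniqueness of the trace, and covariances of tracial vectors -/

section Factor

variable {H : Type u} [NormedAddCommGroup H] [InnerProductSpace ℂ H] [CompleteSpace H]
  {M : VonNeumannAlgebra H}

theorem half_nonneg_complex : (0 : ℂ) ≤ 1 / 2 := by
  rw [Complex.nonneg_iff]
  norm_num

/-- The derivative of τ/2 with respect to the faithful trace (τ + t)/2 is central because both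
functionals are tracial, hence scalar; evaluating at 1 gives the scalar 1/2. -/
theorem trace_unique {τ : FaithfulNormalTrace M} (hM : ∀ z ∈ Set.center M, ∃ c : ℂ, z = c • (1 : M))
    {t : M →ₗ[ℂ] ℂ} (h1 : t 1 = 1) (hpos : ∀ y, 0 ≤ t (star y * y))
    (htr : ∀ x y, t (x * y) = t (y * x)) (hn : IsNormalFun M t) : t = τ.toLin := by
  let ψ : FaithfulTrace M :=
    { toLin := (1 / 2 : ℂ) • (τ.toLin + t)
      map_one := by simp [τ.map_one, h1]; norm_num
      nonneg := fun x => mul_nonneg half_nonneg_complex (add_nonneg (τ.toTrace.nonneg x) (hpos x))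
      tracial := fun x y => by simp [τ.tracial x y, htr x y]
      faithful := fun x hx => by
        refine τ.faithful x ?_
        have hx' : (1 / 2 : ℂ) * (τ.toLin (star x * x) + t (star x * x)) = 0 := hx
        have h2 := (mul_eq_zero.mp hx').resolve_left (by norm_num)
        exact ((add_eq_zero_iff_of_nonneg (τ.toTrace.nonneg x) (hpos x)).mp h2).1 }
  have hψ : ∀ x, ψ.toLin x = (1 / 2 : ℂ) * (τ.toLin x + t x) := fun x => rfl
  have hψn : IsNormalFun M ψ.toLin := (τ.normal.add hn).const_mul (1 / 2)
  obtain ⟨h, hh⟩ := exists_trace_mul_eq (τ := ψ) hψn (ψ := (1 / 2 : ℂ) • τ.toLin)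
    (fun y => mul_nonneg half_nonneg_complex (τ.toTrace.nonneg y))
    (fun y => by
      rw [hψ, mul_add]
      exact le_add_of_nonneg_right (mul_nonneg half_nonneg_complex (hpos y)))
  have hc : h ∈ Set.center M := by
    rw [Semigroup.mem_center_iff]
    intro x
    refine ψ.eq_of_forall_mul_right fun z => ?_
    have e1 : ψ.toLin (h * x * z) = (1 / 2 : ℂ) * τ.toLin (x * z) := by
      rw [mul_assoc, ← hh]; rfl
    have e2 : ψ.toLin (x * h * z) = (1 / 2 : ℂ) * τ.toLin (z * x) := by
      rw [mul_assoc, ψ.tracial, mul_assoc, ← hh]; rfl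
    rw [e1, e2, τ.tracial]
  obtain ⟨c, rfl⟩ := hM h hc
  have hh' : ∀ y, (1 / 2 : ℂ) * τ.toLin y = c * ((1 / 2 : ℂ) * (τ.toLin y + t y)) := by
    intro y
    have := hh y
    rwa [smul_mul_assoc, one_mul, map_smul, hψ] at this
  have hc1 := hh' 1
  rw [τ.map_one, h1] at hc1
  have hc2 : c = 1 / 2 := by linear_combination -hc1
  refine LinearMap.ext fun y => ?_
  have h2 := hh' y
  rw [hc2] at h2
  linear_combination -4 * h2

/-- From z*z ≤ ‖z‖² and the marginal condition, b(z*z, ·) is dominated by a multiple of τ, so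
Radon-Nikodym applies; squares span `M`. -/
theorem exists_linearMap_of_form {τ : FaithfulTrace M} (hτ : IsNormalFun M τ.toLin)
    (b : M →ₗ[ℂ] M →ₗ[ℂ] ℂ) (hb : ∀ x y, 0 ≤ b (star x * x) (star y * y))
    (h1 : ∀ y, b 1 y = τ.toLin y) :
    ∃ Φ : M →ₗ[ℂ] M, Φ 1 = 1 ∧ ∀ x y, b x y = τ.toLin (Φ x * y) := by
  have hex : ∀ x, ∃ h, ∀ y, b x y = τ.toLin (h * y) := by
    intro x
    have hx : x ∈ Submodule.span ℂ (Set.range fun y : M => star y * y) := by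
      rw [span_star_mul_self]; trivial
    induction hx using Submodule.span_induction with
    | mem x hx =>
      obtain ⟨z, rfl⟩ := hx
      obtain ⟨w, hw⟩ := exists_star_mul_self_norm_sub z
      -- The extra 1 keeps the normalising factor invertible when z = 0.
      have hr : (0 : ℝ) < ‖z‖ ^ 2 + 1 := by positivity
      let r : ℂ := ((‖z‖ ^ 2 + 1 : ℝ) : ℂ)
      have hr0 : r ≠ 0 := Complex.ofReal_ne_zero.mpr hr.ne'
      have hrinv : (0 : ℂ) ≤ r⁻¹ := by
        rw [← Complex.ofReal_inv]; exact Complex.zero_le_real.mpr (by positivity)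
      obtain ⟨h, hh⟩ := exists_trace_mul_eq hτ (ψ := r⁻¹ • b (star z * z))
        (fun y => mul_nonneg hrinv (hb z y))
        (fun y => by
          have e : b (star z * z) (star y * y) + b (star w * w) (star y * y) +
              τ.toLin (star y * y) = r * τ.toLin (star y * y) := by
            rw [← hw, map_sub, map_smul]
            rw [LinearMap.sub_apply, LinearMap.smul_apply, h1, smul_eq_mul]
            simp only [r, Complex.ofReal_add, Complex.ofReal_one]
            ring
          have h2 : b (star z * z) (star y * y) ≤ r * τ.toLin (star y * y) := by
            rw [← e, add_assoc]
            exact le_add_of_nonneg_right (add_nonneg (hb w y) (τ.nonneg y))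
          have h3 := mul_le_mul_of_nonneg_left h2 hrinv
          rwa [inv_mul_cancel_left₀ hr0] at h3)
      refine ⟨r • h, fun y => ?_⟩
      rw [smul_mul_assoc, map_smul, ← hh]
      simp [mul_inv_cancel_left₀ hr0]
    | zero => exact ⟨0, by simp⟩
    | add x x' _ _ hx hx' =>
      obtain ⟨h, hh⟩ := hx
      obtain ⟨h', hh'⟩ := hx'
      exact ⟨h + h', fun y => by rw [map_add, LinearMap.add_apply, hh, hh', add_mul, map_add]⟩
    | smul c x _ hx =>
      obtain ⟨h, hh⟩ := hx
      exact ⟨c • h, fun y => by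
        rw [map_smul, LinearMap.smul_apply, hh, smul_mul_assoc, map_smul]⟩
  choose Φ hΦ using hex
  refine ⟨{ toFun := Φ, map_add' := fun x y => ?_, map_smul' := fun c x => ?_ }, ?_, hΦ⟩
  · refine τ.eq_of_forall_mul_right fun z => ?_
    rw [← hΦ, add_mul, map_add, map_add, ← hΦ, ← hΦ, LinearMap.add_apply]
  · refine τ.eq_of_forall_mul_right fun z => ?_
    rw [← hΦ, RingHom.id_apply, smul_mul_assoc, map_smul, map_smul, ← hΦ, LinearMap.smul_apply]
  · refine τ.eq_of_forall_mul_right fun z => ?_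
    change τ.toLin (Φ 1 * z) = _
    rw [← hΦ, one_mul, h1]

theorem sum_sum_mul_sum_add {n : Type*} [Fintype n] (r : ℂ) (f g : n → n → n → ℂ) :
    ∑ i, ∑ j, r * ∑ k, (f k i j + g k j i) =
      ∑ k, r * ((∑ i, ∑ j, f k i j) + ∑ j, ∑ i, g k j i) := by
  have h : ∀ f : n → n → n → ℂ, ∑ i, ∑ j, ∑ k, f k i j = ∑ k, ∑ i, ∑ j, f k i j := by
    intro f
    rw [Finset.sum_comm (f := fun k i => ∑ j, f k i j)]
    exact Finset.sum_congr rfl fun i _ => Finset.sum_comm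
  have h1 : ∑ i, ∑ j, ∑ k, g k j i = ∑ k, ∑ j, ∑ i, g k j i := by
    rw [h fun k i j => g k j i]
    exact Finset.sum_congr rfl fun k _ => Finset.sum_comm
  simp only [← Finset.mul_sum, Finset.sum_add_distrib]
  rw [h f, h1]

/-! ### From tracial vectors to symmetric covariances. -/

namespace Bimodule

variable {K : Type u} [NormedAddCommGroup K] [InnerProductSpace ℂ K] [CompleteSpace K]
  (B : Bimodule M K)

/-- The vector `x ξ y`. -/
noncomputable def act (x : M) (ξ : K) (y : M) : K := B.left x (B.right (MulOpposite.op y) ξ)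

theorem act_eq (x : M) (ξ : K) (y : M) :
    B.act x ξ y = B.right (MulOpposite.op y) (B.left x ξ) :=
  DFunLike.congr_fun (B.comm x y) ξ

theorem left_act (a x : M) (ξ : K) (y : M) : B.left a (B.act x ξ y) = B.act (a * x) ξ y := by
  rw [act, act, map_mul, mul_apply_eq_comp]

theorem right_act (a x : M) (ξ : K) (y : M) :
    B.right (MulOpposite.op a) (B.act x ξ y) = B.act x ξ (y * a) := by
  rw [act_eq, act_eq, MulOpposite.op_mul, map_mul, mul_apply_eq_comp]

theorem inner_act (ξ : K) (x y x' y' : M) :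
    inner ℂ (B.act x ξ y) (B.act x' ξ y') = inner ℂ ξ (B.act (star x * x') ξ (y' * star y)) := by
  conv_lhs => rw [act, ← inner_star_right, ← map_star, left_act, ← inner_star_right, ← map_star,
    ← MulOpposite.op_star, right_act]

/-- The form `(x, y) ↦ ⟨ξ, x ξ y⟩`. -/
noncomputable def form (ξ : K) : M →ₗ[ℂ] M →ₗ[ℂ] ℂ :=
  LinearMap.mk₂ ℂ (fun x y => inner ℂ ξ (B.act x ξ y))
    (fun a b c => by simp [act])
    (fun r a b => by simp [act])
    (fun a b c => by simp [act])
    (fun r a b => by simp [act])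

theorem form_apply (ξ : K) (x y : M) : B.form ξ x y = inner ℂ ξ (B.act x ξ y) := rfl

theorem sum_form_nonneg {n : Type*} [Fintype n] (ξ : K) (x y : n → M) :
    0 ≤ ∑ i, ∑ j, B.form ξ (star (x i) * x j) (y j * star (y i)) := by
  have : ∑ i, ∑ j, B.form ξ (star (x i) * x j) (y j * star (y i)) =
      inner ℂ (∑ i, B.act (x i) ξ (y i)) (∑ j, B.act (x j) ξ (y j)) := by
    rw [sum_inner]
    simp only [inner_sum, inner_act, form_apply]
  rw [this, inner_self_eq_ofReal]
  exact Complex.zero_le_real.mpr (sq_nonneg _)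

/-- The two marginals of the tracial vector give unital maps Φ and Ψ, one from the form and one from
its flip. They are adjoint for τ, so their mean is symmetric. On a Gram matrix complete positivity
reduces to squared norms of sums of vectors xξy. -/
theorem exists_covariance {τ : FaithfulNormalTrace M} {ξ : K} (hξ : B.IsTracial τ ξ) :
    ∃ φ : Covariance τ.toTrace, ∀ x y, τ.toLin (φ.toLin x * y) =
      (1 / 2 : ℂ) * (inner ℂ ξ (B.act x ξ y) + inner ℂ ξ (B.act y ξ x)) := by
  have hb : ∀ x y, 0 ≤ B.form ξ (star x * x) (star y * y) := by
    intro x y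
    have := B.sum_form_nonneg (n := Unit) ξ (fun _ => x) (fun _ => star y)
    simpa using this
  obtain ⟨Φ, hΦ1, hΦ⟩ := exists_linearMap_of_form (τ := τ.toTrace) τ.normal (B.form ξ) hb
    (fun y => by
      rw [form_apply, act, map_one]
      exact hξ.2 y)
  obtain ⟨Ψ, hΨ1, hΨ⟩ := exists_linearMap_of_form (τ := τ.toTrace) τ.normal (B.form ξ).flip
    (fun x y => hb y x)
    (fun y => by
      rw [LinearMap.flip_apply, form_apply, act, MulOpposite.op_one, map_one]
      exact hξ.1 y)
  simp only [LinearMap.flip_apply] at hΨ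
  have key : ∀ x y, τ.toTrace.toLin (((1 / 2 : ℂ) • (Φ + Ψ)) x * y) =
      (1 / 2 : ℂ) * (B.form ξ x y + B.form ξ y x) := by
    intro x y
    rw [hΦ, hΨ, LinearMap.smul_apply, LinearMap.add_apply, smul_mul_assoc, add_mul, map_smul,
      map_add, smul_eq_mul]
  refine ⟨{ toLin := (1 / 2 : ℂ) • (Φ + Ψ), map_one := ?_, symm := ?_, pos := ?_ }, key⟩
  · rw [LinearMap.smul_apply, LinearMap.add_apply, hΦ1, hΨ1, ← two_smul ℂ (1 : M), smul_smul]
    norm_num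
  · intro x y
    rw [key, τ.toTrace.tracial x, key, add_comm]
  · intro n _ _ a ha y
    obtain ⟨c, hc⟩ := ha.exists_gram
    have e : ∀ i j, τ.toTrace.toLin (star (y i) * ((1 / 2 : ℂ) • (Φ + Ψ)) (a i j) * y j) =
        (1 / 2 : ℂ) * ∑ k, (B.form ξ (star (c k i) * c k j) (y j * star (y i)) +
          B.form ξ (star (star (y j)) * star (y i)) (star (c k i) * star (star (c k j)))) := by
      intro i j
      rw [mul_assoc, τ.toTrace.tracial, mul_assoc, key, hc]
      simp only [map_sum, LinearMap.sum_apply, star_star, Finset.sum_add_distrib]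
    simp only [e]
    rw [sum_sum_mul_sum_add (1 / 2) (fun k i j => B.form ξ (star (c k i) * c k j) (y j * star (y i)))
      fun k j i => B.form ξ (star (star (y j)) * star (y i)) (star (c k i) * star (star (c k j)))]
    refine Finset.sum_nonneg fun k _ => mul_nonneg ?_ (add_nonneg ?_ ?_)
    · exact half_nonneg_complex
    · exact B.sum_form_nonneg ξ (c k) y
    -- For the flipped form the letters act on the opposite sides of ξ, whence the adjoints.
    · exact B.sum_form_nonneg ξ (fun j => star (y j)) (fun j => star (c k j))

end Bimodule

end Factor
/-! ### Equality in the ultrapower -/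

section Ultrapower

variable {K : Type u} [NormedAddCommGroup K] [InnerProductSpace ℂ K] [CompleteSpace K]
  {N : VonNeumannAlgebra K} (σ : FaithfulNormalTrace N)

theorem norm2_sq (x : N) : ((norm2 σ x ^ 2 : ℝ) : ℂ) = σ.toLin (star x * x) := by
  obtain ⟨h1, h2⟩ := Complex.nonneg_iff.mp (trace_star_mul_self_nonneg σ x)
  rw [norm2, Real.sq_sqrt h1]
  exact Complex.ext rfl (by simpa using h2)

theorem norm2_nonneg (x : N) : 0 ≤ norm2 σ x := Real.sqrt_nonneg _

theorem norm2_eq_of_sq_eq {x : N} {r : ℝ} (hr : 0 ≤ r)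
    (h : σ.toLin (star x * x) = ((r ^ 2 : ℝ) : ℂ)) : norm2 σ x = r := by
  rw [← norm2_sq] at h
  exact (pow_left_inj₀ (norm2_nonneg σ x) hr two_ne_zero).mp (Complex.ofReal_injective h)

theorem mk_eq_mk_iff (ω : Ultrafilter ℕ) (x y : boundedSeq N) :
    Ultrapower.mk σ ω x = Ultrapower.mk σ ω y ↔
      Tendsto (fun n => norm2 σ (x.1 n - y.1 n)) ω (𝓝 0) := by
  have h1 : Ultrapower.mk σ ω x = Ultrapower.mk σ ω y ↔ x - y ∈ nullIdeal σ ω := by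
    rw [← TwoSidedIdeal.rel_iff]
    exact RingCon.eq _
  rw [h1, nullIdeal, TwoSidedIdeal.mem_mk', Set.mem_ofPred]
  have h2 : (fun n => σ.toLin (star ((x - y).1 n) * (x - y).1 n)) =
      fun n => ((norm2 σ (x.1 n - y.1 n) ^ 2 : ℝ) : ℂ) := by
    funext n
    rw [norm2_sq]
    rfl
  rw [h2]
  constructor
  · intro h
    have h3 := (Complex.continuous_re.tendsto _).comp h
    have h4 := (Real.continuous_sqrt.tendsto _).comp h3
    simp only [Function.comp_def, Complex.ofReal_re, Real.sqrt_sq (norm2_nonneg σ _),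
      Complex.zero_re, Real.sqrt_zero] at h4
    exact h4
  · intro h
    have h3 := (Complex.continuous_ofReal.tendsto _).comp (h.pow 2)
    simpa [Function.comp_def] using h3

theorem mk_commute_iff (ω : Ultrafilter ℕ) (x : boundedSeq N) (a : N) :
    Ultrapower.mk σ ω (constSeq a) * Ultrapower.mk σ ω x =
      Ultrapower.mk σ ω x * Ultrapower.mk σ ω (constSeq a) ↔
      Tendsto (fun n => norm2 σ (a * x.1 n - x.1 n * a)) ω (𝓝 0) := by
  rw [← map_mul, ← map_mul, mk_eq_mk_iff]
  rfl

end Ultrapower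

/-! ### The von Neumann algebra generated on the Fock space -/

namespace FockSpace

section Algebra

variable {A : Type u} [CStarAlgebra A] {τ : FaithfulTrace A} {ι : Type} [DecidableEq ι]
  {φ : ι → Covariance τ} {F : Type u} [NormedAddCommGroup F] [InnerProductSpace ℂ F]
  (X : FockSpace φ F)

/-- The vacuum vector. -/
def vac : F := X.vec (.nil 1)

theorem norm_vac : ‖X.vac‖ = 1 := by
  have h : ((‖X.vac‖ ^ 2 : ℝ) : ℂ) = ((1 : ℝ) : ℂ) := by
    rw [← inner_self_eq_ofReal, vac, X.inner_vec]
    simp [τ.map_one]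
  have h1 := Complex.ofReal_injective h
  exact (pow_eq_one_iff_of_nonneg (norm_nonneg _) two_ne_zero).mp h1

variable [CompleteSpace F]

/-- The operators acting from the right. -/
def rightOps : Set (F →L[ℂ] F) := Set.range X.right ∪ Set.range X.rsemi

/-- The commutant of the operators acting from the right. -/
noncomputable def algebra : VonNeumannAlgebra F := commutantOf X.rightOps

theorem mem_algebra {z : F →L[ℂ] F} (h1 : ∀ a, Commute z (X.right a))
    (h2 : ∀ n, Commute z (X.rsemi n)) : z ∈ X.algebra := by
  refine mem_commutantOf.mpr ?_
  rintro g (⟨a, rfl⟩ | ⟨n, rfl⟩)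
  · exact ⟨(h1 a).symm, by rw [← map_star]; exact (h1 (star a)).symm⟩
  · exact ⟨(h2 n).symm, by rw [star_rsemi]; exact (h2 n).symm⟩

theorem left_mem (a : A) : X.left a ∈ X.algebra :=
  X.mem_algebra (X.commute_left_right a) (X.commute_left_rsemi a)

theorem semi_mem (n : ι) : X.semi n ∈ X.algebra :=
  X.mem_algebra (X.commute_semi_right n) (X.commute_semi_rsemi n)

theorem left_vac (a : A) : X.left a X.vac = X.vec (.nil a) := by
  simp [vac, Word.lmul]

theorem right_vac (a : Aᵐᵒᵖ) : X.right a X.vac = X.vec (.nil a.unop) := by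
  simp [vac, Word.rmul]

theorem semi_vec_nil (n : ι) (a : A) : X.semi n (X.vec (.nil a)) = X.vec (.cons 1 n (.nil a)) := by
  simp [semi_vec, Word.lann]

theorem semi_vac (n : ι) : X.semi n X.vac = X.vec (.cons 1 n (.nil 1)) := X.semi_vec_nil n 1

theorem rsemi_vac (n : ι) : X.rsemi n X.vac = X.vec (.cons 1 n (.nil 1)) := by
  simp [vac, rsemi_vec, Word.rcre, Word.rann]

theorem isTraceable_left (a : A) : IsTraceable X.rightOps X.vac (X.left a) :=
  isTraceable_of_partner (r := X.right (MulOpposite.op a)) (X.left_mem a) (Or.inl ⟨_, rfl⟩)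
    (by rw [left_vac, right_vac, MulOpposite.unop_op])
    (by rw [← map_star, ← map_star, left_vac, right_vac, MulOpposite.unop_star,
      MulOpposite.unop_op])

theorem isTraceable_semi (n : ι) : IsTraceable X.rightOps X.vac (X.semi n) :=
  isTraceable_of_partner (r := X.rsemi n) (X.semi_mem n) (Or.inr ⟨_, rfl⟩)
    (by rw [semi_vac, rsemi_vac])
    (by rw [star_semi, star_rsemi, semi_vac, rsemi_vac])

/-- Recursively, the word x n w is x(Sₙs - t)Ω, where sΩ is w and tΩ is w with its first index n
annihilated. The induction therefore carries the annihilated words too. -/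
theorem exists_isTraceable_apply_vac (w : Word A ι) :
    ∃ s, IsTraceable X.rightOps X.vac s ∧ s X.vac = X.vec w := by
  suffices h : (∃ s, IsTraceable X.rightOps X.vac s ∧ s X.vac = X.vec w) ∧
      ∀ n, ∃ s, IsTraceable X.rightOps X.vac s ∧ s X.vac = X.vec (w.lann φ n) from h.1
  induction w with
  | nil x =>
    exact ⟨⟨_, X.isTraceable_left x, X.left_vac x⟩,
      fun n => ⟨0, isTraceable_zero, by simp [Word.lann]⟩⟩
  | cons x n w ih =>
    obtain ⟨⟨s, hs, es⟩, hl⟩ := ih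
    refine ⟨?_, fun m => ?_⟩
    · obtain ⟨t, ht, et⟩ := hl n
      refine ⟨X.left x * (X.semi n * s + (-1 : ℂ) • t),
        (X.isTraceable_left x).mul (((X.isTraceable_semi n).mul hs).add (ht.smul _)), ?_⟩
      simp [es, et, semi_vec, Word.lmul]
    · by_cases h : m = n
      · subst h
        refine ⟨X.left ((φ m).toLin x) * s, (X.isTraceable_left _).mul hs, ?_⟩
        simp [es, Word.lann]
      · exact ⟨0, isTraceable_zero, by simp [Word.lann, h]⟩

theorem isTraceCyclic : IsTraceCyclic X.rightOps X.vac :=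
  isTraceCyclic_of_total X.total X.exists_isTraceable_apply_vac

/-- The vacuum state. -/
noncomputable def trace : FaithfulNormalTrace X.algebra := vectorTrace X.norm_vac X.isTraceCyclic

theorem trace_apply (x : X.algebra) :
    X.trace.toLin x = inner ℂ X.vac ((x : F →L[ℂ] F) X.vac) := rfl

theorem norm2_trace (x : X.algebra) : norm2 X.trace x = ‖(x : F →L[ℂ] F) X.vac‖ := by
  refine norm2_eq_of_sq_eq _ (norm_nonneg _) ?_
  rw [trace_apply, ← inner_self_eq_ofReal, ← inner_star_right]
  rfl

/-- The left action, as a homomorphism to the generated algebra. -/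
noncomputable def leftHom : A →⋆ₐ[ℂ] X.algebra where
  toFun a := ⟨X.left a, X.left_mem a⟩
  map_one' := Subtype.ext (map_one X.left)
  map_mul' a b := Subtype.ext (map_mul X.left a b)
  map_zero' := Subtype.ext (map_zero X.left)
  map_add' a b := Subtype.ext (map_add X.left a b)
  commutes' r := Subtype.ext (AlgHomClass.commutes X.left r)
  map_star' a := Subtype.ext (map_star X.left a)

theorem leftHom_injective : Function.Injective X.leftHom := by
  intro a b h
  have h1 : X.left a = X.left b := congrArg Subtype.val h
  have h2 := DFunLike.congr_fun h1 X.vac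
  rw [left_vac, left_vac] at h2
  exact X.nilVec_injective h2

theorem right_apply_of_mem {y : F →L[ℂ] F} (hy : y ∈ X.algebra) (a : Aᵐᵒᵖ) :
    X.right a (y X.vac) = y (X.right a X.vac) :=
  DFunLike.congr_fun (mem_commutantOf.mp hy _ (Or.inl ⟨a, rfl⟩)).1 X.vac

end Algebra

section Normal

variable {H : Type u} [NormedAddCommGroup H] [InnerProductSpace ℂ H] [CompleteSpace H]
  {M : VonNeumannAlgebra H} {τ : FaithfulTrace M} {ι : Type} [DecidableEq ι]
  {φ : ι → Covariance τ} {F : Type u} [NormedAddCommGroup F] [InnerProductSpace ℂ F]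
  [CompleteSpace F] (X : FockSpace φ F)

theorem isNormalFun_left (hτ : IsNormalFun M τ.toLin) (ξ η : F) :
    IsNormalFun M fun x => inner ℂ ξ (X.left x η) := by
  refine isNormalFun_inner_of_total X.total (fun x => X.left x) X.norm_left_le (fun v w => ?_) ξ η
  obtain ⟨d, hd⟩ := exists_ker_eq_trace φ v w
  simp only [X.left_vec, X.inner_vec, ker_lmul_right, one_mul, hd]
  exact hτ.mul_right d

theorem isNormalFun_right (hτ : IsNormalFun M τ.toLin) (ξ η : F) :
    IsNormalFun M fun x => inner ℂ ξ (X.right (MulOpposite.op x) η) := by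
  refine isNormalFun_inner_of_total X.total (fun x => X.right (MulOpposite.op x))
    (fun x => X.norm_right_le _) (fun v w => ?_) ξ η
  obtain ⟨d, hd⟩ := exists_ker_rmul_eq_trace φ 1 v w
  simp only [X.right_vec, X.inner_vec, MulOpposite.unop_op, hd]
  exact hτ.mul_left d

/-- The inclusion of `M` into the algebra generated on the Fock space. -/
noncomputable def inclusion (hτ : IsNormalFun M τ.toLin) : Inclusion M X.algebra where
  toHom := X.leftHom
  injective := X.leftHom_injective
  normal := X.isNormalFun_left hτ

end Normal

end FockSpace

/-! ### Weak spectral gap implies property (T) -/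

/-- The transpose of a Gram matrix is positive: conjugate the coefficients. -/
theorem sum_inner_kernel_flip_nonneg {W E : Type*} [NormedAddCommGroup E] [InnerProductSpace ℂ E]
    (g : W → E) (c : W →₀ ℂ) :
    0 ≤ c.sum fun v a => c.sum fun w b => star a * b * inner ℂ (g w) (g v) := by
  have e : (c.sum fun v a => c.sum fun w b => star a * b * inner ℂ (g w) (g v)) =
      inner ℂ (∑ w ∈ c.support, star (c w) • g w) (∑ v ∈ c.support, star (c v) • g v) := by
    simp only [Finsupp.sum, inner_sum, sum_inner, inner_smul_left, inner_smul_right]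
    refine Finset.sum_congr rfl fun v _ => ?_
    rw [Finset.mul_sum]
    refine Finset.sum_congr rfl fun w _ => ?_
    rw [Complex.star_def, Complex.conj_conj]
    ring
  rw [e, inner_self_eq_ofReal]
  exact Complex.zero_le_real.mpr (sq_nonneg _)

/-! ### The words with a single index n. -/

namespace Word

variable {A : Type u} {ι : Type} [DecidableEq ι]

/-- A function of the words `x n y` with a given index `n`, extended by zero. -/
noncomputable def levelOne {E : Type*} [Zero E] (n : ι) (f : A → A → E) : Word A ι → E
  | .cons x m (.nil y) => if m = n then f x y else 0
  | .nil _ => 0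
  | .cons _ _ (.cons _ _ _) => 0

/-- Kill the words of the form `x n y`. -/
noncomputable def offLevelOne [Zero A] (n : ι) : Word A ι → Word A ι
  | .cons x m (.nil y) => if m = n then .nil 0 else .cons x m (.nil y)
  | .nil x => .nil x
  | .cons x m (.cons y p w) => .cons x m (.cons y p w)

theorem levelOne_lmul [CStarAlgebra A] {E : Type*} [Zero E] (n : ι) (f : A → A → E)
    (a : A) (w : Word A ι) :
    (w.lmul a).levelOne n f = w.levelOne n fun x y => f (a * x) y := by
  rcases w with x | ⟨x, m, y | ⟨y, p, w⟩⟩ <;> simp [lmul, levelOne]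

theorem levelOne_rmul [CStarAlgebra A] {E : Type*} [Zero E] (n : ι) (f : A → A → E)
    (a : A) (w : Word A ι) :
    (w.rmul a).levelOne n f = w.levelOne n fun x y => f x (y * a) := by
  rcases w with x | ⟨x, m, y | ⟨y, p, w⟩⟩ <;> simp [rmul, levelOne]

theorem map_levelOne {E : Type*} [NormedAddCommGroup E] [InnerProductSpace ℂ E] (n : ι)
    (f : A → A → E) (T : E →L[ℂ] E) (w : Word A ι) :
    T (w.levelOne n f) = w.levelOne n fun x y => T (f x y) := by
  rcases w with x | ⟨x, m, y | ⟨y, p, w⟩⟩ <;> simp [levelOne, apply_ite T]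

end Word

/-- The words x n y span a sector orthogonal to all other words; on it the hypothesis splits twice
the inner product into two parts. -/
theorem two_mul_ker_eq_levelOne {A : Type u} [CStarAlgebra A] {τ : FaithfulTrace A} {ι : Type}
    [DecidableEq ι] {φ : ι → Covariance τ} {E : Type*} [NormedAddCommGroup E]
    [InnerProductSpace ℂ E] {n : ι} {f g : A → A → E}
    (h : ∀ x y x' y', 2 * τ.toLin (star y * (φ n).toLin (star x * x') * y') =
      inner ℂ (f x y) (f x' y') + inner ℂ (g x' y') (g x y)) (v w : Word A ι) :
    2 * ker φ 1 v w = inner ℂ (v.levelOne n f) (w.levelOne n f) +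
      (inner ℂ (w.levelOne n g) (v.levelOne n g) +
        2 * ker φ 1 (v.offLevelOne n) (w.offLevelOne n)) := by
  rcases v with x | ⟨x, m, y | ⟨y, p, v⟩⟩ <;> rcases w with x' | ⟨x', m', y' | ⟨y', p', w⟩⟩ <;>
    simp only [Word.levelOne, Word.offLevelOne, inner_zero_left, inner_zero_right, zero_add]
  · by_cases h1 : m' = n <;> simp [h1]
  · by_cases h1 : m = n <;> simp [h1]
  · by_cases h1 : m = n
    · subst h1
      by_cases h2 : m' = m
      · subst h2
        simp [h]
      · simp [h2, Ne.symm h2]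
    · by_cases h2 : m' = n
      · subst h2
        simp [h1]
      · simp [h1, h2]
  · by_cases h1 : m = n <;> simp [h1]
  · by_cases h1 : m' = n <;> simp [h1]

namespace FockSpace

/-- Twice the Fock kernel minus the Gram matrix of f is a flipped Gram matrix plus the part off the
sector, hence positive. The √2 is the price of symmetrising. -/
theorem exists_levelOne_clm {A : Type u} [CStarAlgebra A] {τ : FaithfulTrace A} {ι : Type}
    [DecidableEq ι] {φ : ι → Covariance τ} {F : Type*} [NormedAddCommGroup F]
    [InnerProductSpace ℂ F] (X : FockSpace φ F) {E : Type*} [NormedAddCommGroup E]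
    [InnerProductSpace ℂ E] [CompleteSpace E] {n : ι} {f g : A → A → E}
    (h : ∀ x y x' y', 2 * τ.toLin (star y * (φ n).toLin (star x * x') * y') =
      inner ℂ (f x y) (f x' y') + inner ℂ (g x' y') (g x y)) :
    ∃ T : F →L[ℂ] E, (∀ w, T (X.vec w) = w.levelOne n f) ∧ ‖T‖ ≤ √2 := by
  refine X.total.exists_clm (Real.sqrt_nonneg 2) (norm_linearCombination_le (Real.sqrt_nonneg 2)
    (fun v w => inner ℂ (w.levelOne n g) (v.levelOne n g) +
        2 * ker φ 1 (v.offLevelOne n) (w.offLevelOne n)) (fun c => ?_) fun v w => ?_)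
  · have h1 := sum_inner_kernel_flip_nonneg (fun w : Word A ι => w.levelOne n g) c
    have h2 := sum_inner_kernel_nonneg (fun w : Word A ι => X.vec (w.offLevelOne n)) c
    have e : (c.sum fun v a => c.sum fun w b => star a * b *
        (inner ℂ (w.levelOne n g) (v.levelOne n g) +
          2 * ker φ 1 (v.offLevelOne n) (w.offLevelOne n))) =
        (c.sum fun v a => c.sum fun w b => star a * b *
          inner ℂ (w.levelOne n g) (v.levelOne n g)) +
        2 * (c.sum fun v a => c.sum fun w b => star a * b *
          inner ℂ (X.vec (v.offLevelOne n)) (X.vec (w.offLevelOne n))) := by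
      simp only [Finsupp.sum, Finset.mul_sum, ← Finset.sum_add_distrib, X.inner_vec]
      refine Finset.sum_congr rfl fun v _ => Finset.sum_congr rfl fun w _ => ?_
      ring
    rw [e]
    exact add_nonneg h1 (mul_nonneg zero_le_two h2)
  · rw [Real.sq_sqrt zero_le_two, X.inner_vec, Complex.ofReal_ofNat]
    exact two_mul_ker_eq_levelOne h v w

end FockSpace

section Bimodule

variable {H : Type u} [NormedAddCommGroup H] [InnerProductSpace ℂ H] [CompleteSpace H]
  {M : VonNeumannAlgebra H} {K : Type u} [NormedAddCommGroup K] [InnerProductSpace ℂ K]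
  [CompleteSpace K] (B : Bimodule M K)

/-! ### Comparison of the Fock space with the original bimodule. -/

namespace Bimodule

theorem norm_left_eq {τ : FaithfulNormalTrace M} {ξ : K} (hξ : B.IsTracial τ ξ) (a : M) :
    ‖B.left a ξ‖ = norm2 τ a := by
  refine (norm2_eq_of_sq_eq τ (norm_nonneg _) ?_).symm
  rw [← inner_self_eq_ofReal, ← hξ.1, map_mul, mul_apply_eq_comp, map_star, inner_star_right]

theorem norm_right_eq {τ : FaithfulNormalTrace M} {ξ : K} (hξ : B.IsTracial τ ξ) (a : M) :
    ‖B.right (MulOpposite.op a) ξ‖ = norm2 τ a := by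
  refine (norm2_eq_of_sq_eq τ (norm_nonneg _) ?_).symm
  rw [← inner_self_eq_ofReal, τ.tracial, ← hξ.2, MulOpposite.op_mul, map_mul, mul_apply_eq_comp,
    MulOpposite.op_star, map_star, inner_star_right]

theorem norm_commutator_le {τ : FaithfulNormalTrace M} {ξ : K} (hξ : B.IsTracial τ ξ) (a d : M) :
    ‖B.left a ξ - B.right (MulOpposite.op a) ξ‖ ≤
      ‖B.left d ξ - B.right (MulOpposite.op d) ξ‖ + 2 * norm2 τ (a - d) := by
  have e : B.left a ξ - B.right (MulOpposite.op a) ξ =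
      (B.left d ξ - B.right (MulOpposite.op d) ξ) + B.left (a - d) ξ -
        B.right (MulOpposite.op (a - d)) ξ := by
    simp only [map_sub, MulOpposite.op_sub, sub_apply]
    abel
  rw [e]
  refine (norm_sub_le _ _).trans ?_
  have := norm_add_le (B.left d ξ - B.right (MulOpposite.op d) ξ) (B.left (a - d) ξ)
  rw [B.norm_left_eq hξ] at this
  rw [B.norm_right_eq hξ]
  linarith

/-- The second summand is the coefficient of the conjugate bimodule, whence the adjoints and the
swapped arguments. -/
theorem two_mul_trace_covariance {τ : FaithfulNormalTrace M} {ξ : K} {φ : Covariance τ.toTrace}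
    (hφ : ∀ x y, τ.toLin (φ.toLin x * y) =
      (1 / 2 : ℂ) * (inner ℂ ξ (B.act x ξ y) + inner ℂ ξ (B.act y ξ x))) (x y x' y' : M) :
    2 * τ.toTrace.toLin (star y * φ.toLin (star x * x') * y') =
      inner ℂ (B.act x ξ y) (B.act x' ξ y') +
        inner ℂ (B.act (star y') ξ (star x')) (B.act (star y) ξ (star x)) := by
  rw [inner_act, inner_act, mul_assoc, τ.toTrace.tracial, mul_assoc]
  change 2 * τ.toLin _ = _
  rw [hφ, star_star, star_star]
  ring

variable {τ : FaithfulNormalTrace M} {ι : Type} [DecidableEq ι] {φ : ι → Covariance τ.toTrace}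
  {F : Type u} [NormedAddCommGroup F] [InnerProductSpace ℂ F] [CompleteSpace F]
  (X : FockSpace φ F) {ξ : K} {n : ι}

/-- The map sends the word x n y to xξy and kills all other words. -/
theorem exists_intertwiner (hφ : ∀ x y, τ.toLin ((φ n).toLin x * y) =
      (1 / 2 : ℂ) * (inner ℂ ξ (B.act x ξ y) + inner ℂ ξ (B.act y ξ x))) :
    ∃ T : F →L[ℂ] K, ‖T‖ ≤ √2 ∧ T (X.semi n X.vac) = ξ ∧
      (∀ a v, T (X.left a v) = B.left a (T v)) ∧ ∀ a v, T (X.right a v) = B.right a (T v) := by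
  obtain ⟨T, hT, hn⟩ := X.exists_levelOne_clm (n := n) (f := fun x y => B.act x ξ y)
    (g := fun x y => B.act (star y) ξ (star x)) (B.two_mul_trace_covariance hφ)
  refine ⟨T, hn, ?_, fun a v => ?_, fun a v => ?_⟩
  · rw [X.semi_vac, hT]
    simp [Word.levelOne, act]
  · have h : T ∘L X.left a = B.left a ∘L T := X.total.ext_clm fun w => by
      simp only [ContinuousLinearMap.comp_apply, X.left_vec, hT, Word.levelOne_lmul,
        Word.map_levelOne, left_act]
    exact DFunLike.congr_fun h v
  · have h : T ∘L X.right a = B.right a ∘L T := X.total.ext_clm fun w => by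
      obtain ⟨a, rfl⟩ := MulOpposite.op_surjective a
      simp only [ContinuousLinearMap.comp_apply, X.right_vec, hT, Word.levelOne_rmul,
        Word.map_levelOne, right_act, MulOpposite.unop_op]
    exact DFunLike.congr_fun h v

/-- Twice the squared norm of [a, Sₙ]Ω equals ‖aξ - ξa‖² + ‖a*ξ - ξa*‖²; the term in a* comes from
the conjugate half of the covariance. -/
theorem norm_commutator_semi_le (hφ : ∀ x y, τ.toLin ((φ n).toLin x * y) =
      (1 / 2 : ℂ) * (inner ℂ ξ (B.act x ξ y) + inner ℂ ξ (B.act y ξ x))) (a : M) :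
    ‖X.left a (X.semi n X.vac) - X.semi n (X.left a X.vac)‖ ≤
      ‖B.left a ξ - B.right (MulOpposite.op a) ξ‖ +
        ‖B.left (star a) ξ - B.right (MulOpposite.op (star a)) ξ‖ := by
  have key := B.two_mul_trace_covariance hφ
  have hin : ∀ x y x' y', 2 * inner ℂ (X.vec (.cons x n (.nil y))) (X.vec (.cons x' n (.nil y'))) =
      inner ℂ (B.act x ξ y) (B.act x' ξ y') +
        inner ℂ (B.act (star y') ξ (star x')) (B.act (star y) ξ (star x)) := by
    intro x y x' y'
    rw [← key, X.inner_vec, ker_cons_cons, if_pos rfl, mul_one, ker_nil_nil]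
  rw [X.semi_vac, X.left_vac, X.semi_vec_nil, X.left_vec, Word.lmul, mul_one]
  set p := X.vec (.cons a n (.nil 1)) - X.vec (.cons 1 n (.nil a)) with hp
  have hl : ∀ a, B.left a ξ = B.act a ξ 1 := fun a => by simp [act]
  have hr : ∀ a, B.right (MulOpposite.op a) ξ = B.act 1 ξ a := fun a => by simp [act]
  have e : 2 * inner ℂ p p = inner ℂ (B.left a ξ - B.right (MulOpposite.op a) ξ)
      (B.left a ξ - B.right (MulOpposite.op a) ξ) +
      inner ℂ (B.left (star a) ξ - B.right (MulOpposite.op (star a)) ξ)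
      (B.left (star a) ξ - B.right (MulOpposite.op (star a)) ξ) := by
    have h1 := hin a 1 a 1
    have h2 := hin a 1 1 a
    have h3 := hin 1 a a 1
    have h4 := hin 1 a 1 a
    simp only [star_one] at h1 h2 h3 h4
    rw [hl, hr, hl, hr, hp]
    simp only [inner_sub_left, inner_sub_right]
    linear_combination h1 - h2 - h3 + h4
  rw [inner_self_eq_ofReal, inner_self_eq_ofReal, inner_self_eq_ofReal] at e
  have e' : 2 * ‖p‖ ^ 2 = ‖B.left a ξ - B.right (MulOpposite.op a) ξ‖ ^ 2 +
      ‖B.left (star a) ξ - B.right (MulOpposite.op (star a)) ξ‖ ^ 2 := by exact_mod_cast e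
  refine abs_le_of_sq_le_sq' ?_ (by positivity) |>.2
  have := mul_nonneg (norm_nonneg (B.left a ξ - B.right (MulOpposite.op a) ξ))
    (norm_nonneg (B.left (star a) ξ - B.right (MulOpposite.op (star a)) ξ))
  nlinarith [sq_nonneg ‖p‖]

end Bimodule

theorem ultrafilter_le_atTop {ω : Ultrafilter ℕ} (hω : ∀ n : ℕ, ω ≠ pure n) :
    (ω : Filter ℕ) ≤ atTop := by
  rw [← Nat.cofinite_eq_atTop]
  refine ω.le_cofinite_or_eq_pure.resolve_right ?_
  rintro ⟨n, hn⟩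
  exact hω n hn

theorem hasPropertyT_of_hasWeakSpectralGap {ω : Ultrafilter ℕ} (hω : ∀ n : ℕ, ω ≠ pure n)
    {τ : FaithfulNormalTrace M} (hsep : IsSeparableVN τ)
    (hgap : ∀ (K : Type u) [NormedAddCommGroup K] [InnerProductSpace ℂ K] [CompleteSpace K]
        (N : VonNeumannAlgebra K) (σ : FaithfulNormalTrace N) (ι : Inclusion M N),
        HasWeakSpectralGap ι σ ω) : HasPropertyT τ := by
  classical
  by_contra hT
  obtain ⟨D, hDc, hD⟩ := hsep
  obtain ⟨d, rfl⟩ := hDc.exists_eq_range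
    (let ⟨d, hd, _⟩ := hD 0 1 one_pos; ⟨d, hd⟩)
  unfold HasPropertyT at hT
  push Not at hT
  obtain ⟨ε', hε', hT⟩ := hT
  -- The first n terms of a 2-norm dense sequence suffice: tracial vectors make the commutator
  -- Lipschitz in the 2-norm, so it tends to zero at every element of `M`.
  have hT' := fun n : ℕ => hT ((Finset.range n).image d) (1 / ((n : ℝ) + 1)) (by positivity)
  choose K i1 i2 i3 B ξ hξ1 hξ2 hξ3 hξ4 using hT'
  choose φ hφ using fun n => (B n).exists_covariance (hξ2 n)
  obtain ⟨F, j1, j2, j3, ⟨X⟩⟩ := exists_fockSpace φ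
  choose T hT1 hT2 hT3 hT4 using fun n => (B n).exists_intertwiner X (hφ n)
  have hlim : ∀ a : M, Tendsto (fun n => ‖(B n).left a (ξ n) -
      (B n).right (MulOpposite.op a) (ξ n)‖) atTop (𝓝 0) := by
    intro a
    rw [Metric.tendsto_atTop]
    intro ε hε
    obtain ⟨_, ⟨i, rfl⟩, hi⟩ := hD a (ε / 4) (by positivity)
    obtain ⟨m, hm⟩ := exists_nat_one_div_lt (show 0 < ε / 2 by positivity)
    refine ⟨max (i + 1) m, fun n hn => ?_⟩
    have h1 := (B n).norm_commutator_le (hξ2 n) a (d i)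
    have h2 := hξ3 n (d i) (Finset.mem_image_of_mem _ (Finset.mem_range.mpr (by omega)))
    have h3 : 1 / ((n : ℝ) + 1) ≤ 1 / ((m : ℝ) + 1) :=
      Nat.one_div_le_one_div (le_trans (le_max_right _ _) hn)
    rw [Real.dist_eq, sub_zero, abs_of_nonneg (norm_nonneg _)]
    linarith
  let s : boundedSeq X.algebra := ⟨fun n => ⟨X.semi n, X.semi_mem n⟩, 2, X.norm_semi_le⟩
  have hs : Ultrapower.mk X.trace ω s ∈ Set.centralizer (Set.range fun x : M =>
      Ultrapower.mk X.trace ω (constSeq ((X.inclusion τ.normal).toHom x))) := by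
    rintro _ ⟨a, rfl⟩
    refine (mk_commute_iff _ _ _ _).mpr ?_
    have h := ((hlim a).add (hlim (star a))).mono_left (ultrafilter_le_atTop hω)
    rw [add_zero] at h
    refine squeeze_zero (fun n => norm2_nonneg _ _) (fun n => ?_) h
    rw [X.norm2_trace]
    exact (B n).norm_commutator_semi_le X (hφ n) a
  rw [hgap F X.algebra X.trace (X.inclusion τ.normal)] at hs
  obtain ⟨y, hy, hys⟩ := hs
  rw [mk_eq_mk_iff] at hys
  -- After applying the intertwiner, of norm at most √2, this error becomes ε'.
  have hlt : √2 * ε' / 2 > 0 := by positivity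
  obtain ⟨n, hn⟩ := ((tendsto_order.mp hys).2 _ hlt).exists
  rw [X.norm2_trace] at hn
  -- With y commuting with M and with the right action, a·yΩ = y·aΩ = y(Ωa) = (yΩ)a.
  have hcen : (B n).IsCentral (T n ((y.1 n : F →L[ℂ] F) X.vac)) := by
    intro a
    rw [← hT3, ← hT4, X.right_apply_of_mem (y.1 n).2, X.right_vac, MulOpposite.unop_op,
      ← X.left_vac]
    have h := congrArg Subtype.val (hy n _ ⟨a, rfl⟩)
    exact congrArg (T n) (DFunLike.congr_fun h X.vac)
  have h1 := hξ4 n _ hcen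
  have h2 : T n ((y.1 n : F →L[ℂ] F) X.vac) - ξ n =
      T n (((y.1 n - s.1 n : X.algebra) : F →L[ℂ] F) X.vac) := by
    conv_lhs => rw [← hT2 n]
    rw [← map_sub]
    rfl
  rw [h2] at h1
  have h3 := (T n).le_of_opNorm_le (hT1 n) (((y.1 n - s.1 n : X.algebra) : F →L[ℂ] F) X.vac)
  have h4 := mul_lt_mul_of_pos_left hn (show 0 < √2 by positivity)
  have h5 : √2 * (√2 * ε' / 2) = ε' := by
    have := Real.mul_self_sqrt (show (0 : ℝ) ≤ 2 by norm_num)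
    linear_combination ε' / 2 * this
  linarith

end Bimodule

/-! ### The Cayley transform -/

section Cayley

variable {A : Type u} [CStarAlgebra A]

theorem norm_le_one_of_star_mul_self {w : A} (h : star w * w = 1) : ‖w‖ ≤ 1 := by
  have h1 : ‖w‖ * ‖w‖ = ‖(1 : A)‖ := by rw [← CStarRing.norm_star_mul_self, h]
  have h2 := norm_one_le_one (A := A)
  nlinarith [norm_nonneg w]

/-- `1 - 2 i r` is the Cayley transform of a self-adjoint element with resolvent `r` at `-i`. -/
noncomputable def cayley (r : A) : A := 1 - (2 * Complex.I) • r

theorem exists_resolvent {a : A} (ha : IsSelfAdjoint a) :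
    ∃ r : A, (a + Complex.I • 1) * r = 1 ∧ r * (a + Complex.I • 1) = 1 := by
  have h : -Complex.I ∉ spectrum ℂ a := fun h => by
    have := congrArg Complex.im (ha.mem_spectrum_eq_re h)
    simp at this
  rw [spectrum.notMem_iff, Algebra.algebraMap_eq_smul_one] at h
  obtain ⟨v, hv⟩ := h.neg
  have e : a + Complex.I • 1 = v := by rw [hv, neg_smul]; abel
  exact ⟨(v⁻¹ : Aˣ), by rw [e]; exact v.mul_inv, by rw [e]; exact v.inv_mul⟩

variable {a r : A}

/-- The resolvent identity gives r* - r = 2i r*r = 2i rr*, which cancels the cross terms. -/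
theorem star_cayley_mul_self (ha : IsSelfAdjoint a) (h1 : (a + Complex.I • 1) * r = 1)
    (h2 : r * (a + Complex.I • 1) = 1) :
    star (cayley r) * cayley r = 1 ∧ cayley r * star (cayley r) = 1 := by
  have h3 : star r * (a - Complex.I • 1) = 1 := by
    have := congrArg star h1
    simpa [ha.star_eq, sub_eq_add_neg] using this
  have h4 : (a - Complex.I • 1) * star r = 1 := by
    have := congrArg star h2
    simpa [ha.star_eq, sub_eq_add_neg] using this
  have e : (a + Complex.I • 1) - (a - Complex.I • 1) = (2 * Complex.I) • (1 : A) := by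
    rw [mul_smul, two_smul]; abel
  have e1 : star r - r = (2 * Complex.I) • (star r * r) := by
    calc star r - r = star r * ((a + Complex.I • 1) * r) - star r * (a - Complex.I • 1) * r := by
          rw [h1, h3, mul_one, one_mul]
      _ = star r * ((a + Complex.I • 1) - (a - Complex.I • 1)) * r := by
          simp only [mul_sub, sub_mul, mul_add, add_mul, mul_assoc]
      _ = _ := by rw [e, mul_smul_comm, mul_one, smul_mul_assoc]
  have e2 : star r - r = (2 * Complex.I) • (r * star r) := by
    calc star r - r = r * (a + Complex.I • 1) * star r - r * ((a - Complex.I • 1) * star r) := by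
          rw [h2, h4, mul_one, one_mul]
      _ = r * ((a + Complex.I • 1) - (a - Complex.I • 1)) * star r := by
          simp only [mul_sub, sub_mul, mul_add, add_mul, mul_assoc]
      _ = _ := by rw [e, mul_smul_comm, mul_one, smul_mul_assoc]
  have hs : star (cayley r) = 1 + (2 * Complex.I) • star r := by
    simp [cayley, star_smul]
  have hI : (2 * Complex.I) * (2 * Complex.I) = -4 := by
    linear_combination 4 * Complex.I_mul_I
  constructor
  · have : star (cayley r) * cayley r = 1 + (2 * Complex.I) • (star r - r) -
        ((2 * Complex.I) * (2 * Complex.I)) • (star r * r) := by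
      rw [hs, cayley, add_mul, mul_sub, mul_sub, smul_mul_smul_comm, smul_sub]
      simp only [one_mul, mul_one]
      abel
    rw [this, e1, smul_smul]
    abel
  · have : cayley r * star (cayley r) = 1 + (2 * Complex.I) • (star r - r) -
        ((2 * Complex.I) * (2 * Complex.I)) • (r * star r) := by
      rw [hs, cayley, sub_mul, mul_add, mul_add, smul_mul_smul_comm, smul_sub]
      simp only [one_mul, mul_one]
      abel
    rw [this, e2, smul_smul]
    abel

/-- Read off from 2ir = 1 - u with u of norm at most 1. -/
theorem norm_resolvent_le (hu : star (cayley r) * cayley r = 1) : ‖r‖ ≤ 1 := by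
  have e : (2 * Complex.I) • r = 1 - cayley r := by rw [cayley]; abel
  have h := norm_sub_le (1 : A) (cayley r)
  rw [← e, norm_smul] at h
  have h1 := norm_one_le_one (A := A)
  have h2 := norm_le_one_of_star_mul_self hu
  simp only [norm_mul, Complex.norm_I, Complex.norm_ofNat] at h
  linarith

end Cayley

namespace FockSpace

section Estimates

variable {A : Type u} [CStarAlgebra A] {τ : FaithfulTrace A} {ι : Type} [DecidableEq ι]
  {φ : ι → Covariance τ} {F : Type*} [NormedAddCommGroup F] [InnerProductSpace ℂ F]
  [CompleteSpace F] (X : FockSpace φ F)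

theorem left_nilVec (a b : A) : X.left a (X.nilVec b) = X.nilVec (a * b) := by
  simp [nilVec_apply, Word.lmul]

theorem right_nilVec (a b : A) : X.right (MulOpposite.op a) (X.nilVec b) = X.nilVec (b * a) := by
  simp [nilVec_apply, Word.rmul]

theorem norm_nilVec_mul_le_left (a b : A) : ‖X.nilVec (a * b)‖ ≤ ‖a‖ * ‖X.nilVec b‖ := by
  rw [← left_nilVec]
  exact (X.left a).le_of_opNorm_le (X.norm_left_le a) _

theorem norm_nilVec_mul_le_right (a b : A) : ‖X.nilVec (a * b)‖ ≤ ‖X.nilVec a‖ * ‖b‖ := by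
  rw [← right_nilVec, mul_comm]
  exact (X.right (MulOpposite.op b)).le_of_opNorm_le (X.norm_right_le _) _

/-- From [m, r] = -r[m, a]r with ‖r‖ ≤ 1; the factor 2 is |2i|. -/
theorem norm_nilVec_commutator_cayley_le {a r : A} (ha : IsSelfAdjoint a)
    (h1 : (a + Complex.I • 1) * r = 1) (h2 : r * (a + Complex.I • 1) = 1) (m : A) :
    ‖X.nilVec (m * cayley r - cayley r * m)‖ ≤ 2 * ‖X.nilVec (m * a - a * m)‖ := by
  have e1 : m * r - r * m = -(r * (m * a - a * m) * r) := by
    calc m * r - r * m = r * (a + Complex.I • 1) * m * r - r * m * ((a + Complex.I • 1) * r) := by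
          rw [h1, h2, one_mul, mul_one]
      _ = r * ((a + Complex.I • 1) * m - m * (a + Complex.I • 1)) * r := by
          simp only [mul_sub, sub_mul, mul_assoc]
      _ = r * (a * m - m * a) * r := by
          rw [add_mul, mul_add, smul_mul_assoc, mul_smul_comm, one_mul, mul_one,
            add_sub_add_right_eq_sub]
      _ = _ := by rw [← neg_sub, mul_neg, neg_mul]
  have e2 : m * cayley r - cayley r * m = (2 * Complex.I) • (r * (m * a - a * m) * r) := by
    have : m * cayley r - cayley r * m = -((2 * Complex.I) • (m * r - r * m)) := by
      rw [cayley, mul_sub, sub_mul, mul_smul_comm, smul_mul_assoc, smul_sub, mul_one, one_mul]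
      abel
    rw [this, e1, smul_neg, neg_neg]
  have hr := norm_resolvent_le (star_cayley_mul_self ha h1 h2).1
  rw [e2, map_smul, norm_smul]
  simp only [norm_mul, Complex.norm_I, Complex.norm_ofNat, mul_one]
  refine mul_le_mul_of_nonneg_left ?_ zero_le_two
  refine (X.norm_nilVec_mul_le_right _ _).trans ?_
  refine (mul_le_of_le_one_right (norm_nonneg _) hr).trans ?_
  refine (X.norm_nilVec_mul_le_left _ _).trans ?_
  exact mul_le_of_le_one_left (norm_nonneg _) hr

/-- Going back from the Cayley transform: with p = a + i one has wpw* - p = wpw*(r - wrw*)p, and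
each outer factor costs ‖a‖ + 1. A bound on ‖a‖ is thus essential. -/
theorem norm_nilVec_conj_sub_le {a r : A} (h1 : (a + Complex.I • 1) * r = 1)
    (h2 : r * (a + Complex.I • 1) = 1) {w : A} (hw1 : star w * w = 1) (hw2 : w * star w = 1) :
    ‖X.nilVec (w * a * star w - a)‖ ≤
      (‖a‖ + 1) ^ 2 / 2 * ‖X.nilVec (w * cayley r * star w - cayley r)‖ := by
  set p := a + Complex.I • (1 : A) with hp
  have hpn : ‖p‖ ≤ ‖a‖ + 1 := by
    refine (norm_add_le _ _).trans (add_le_add_right ?_ _)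
    rw [norm_smul, Complex.norm_I, one_mul]
    exact norm_one_le_one
  have hwn := norm_le_one_of_star_mul_self hw1
  have hq : ‖w * p * star w‖ ≤ ‖a‖ + 1 := by
    refine (norm_mul_le _ _).trans ?_
    rw [norm_star]
    refine (mul_le_of_le_one_right (norm_nonneg _) hwn).trans ?_
    refine (norm_mul_le _ _).trans ?_
    exact (mul_le_of_le_one_left (norm_nonneg _) hwn).trans hpn
  have e0 : w * p * star w - p = w * a * star w - a := by
    rw [hp, mul_add, add_mul, mul_smul_comm, smul_mul_assoc, mul_one, hw2]
    abel
  have e1 : w * a * star w - a = w * p * star w * (r - w * r * star w) * p := by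
    rw [← e0, mul_sub, sub_mul]
    congr 1
    · rw [mul_assoc, mul_assoc, h2, mul_one]
    · have : w * p * star w * (w * r * star w) = w * (p * ((star w * w) * r)) * star w := by
        simp only [mul_assoc]
      rw [this, hw1, one_mul, h1, mul_one, hw2, one_mul]
  have e2 : r - w * r * star w = (2 * Complex.I)⁻¹ • (w * cayley r * star w - cayley r) := by
    have : w * cayley r * star w - cayley r = (2 * Complex.I) • (r - w * r * star w) := by
      rw [cayley, mul_sub, sub_mul, mul_one, hw2, mul_smul_comm, smul_mul_assoc, smul_sub]
      abel
    rw [this, inv_smul_smul₀ (mul_ne_zero two_ne_zero Complex.I_ne_zero)]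
  rw [e1, e2]
  refine (X.norm_nilVec_mul_le_right _ _).trans ?_
  refine (mul_le_mul (X.norm_nilVec_mul_le_left _ _) hpn (norm_nonneg _) (by positivity)).trans ?_
  rw [map_smul, norm_smul]
  simp only [norm_inv, norm_mul, Complex.norm_I, Complex.norm_ofNat, mul_one]
  have := mul_le_mul_of_nonneg_right hq
    (norm_nonneg (X.nilVec (w * cayley r * star w - cayley r)))
  nlinarith [norm_nonneg a]

end Estimates

end FockSpace

/-! ### The bimodule of an inclusion -/

section Inclusion

variable {H : Type u} [NormedAddCommGroup H] [InnerProductSpace ℂ H] [CompleteSpace H]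
  {K : Type u} [NormedAddCommGroup K] [InnerProductSpace ℂ K] [CompleteSpace K]
  {M : VonNeumannAlgebra H} {N : VonNeumannAlgebra K}

theorem norm2_eq_norm_nilVec {σ : FaithfulNormalTrace N} {F : Type*} [NormedAddCommGroup F]
    [InnerProductSpace ℂ F] (X : L2Space σ.toTrace F) (x : N) : norm2 σ x = ‖X.nilVec x‖ :=
  norm2_eq_of_sq_eq σ (norm_nonneg _) (X.norm_nilVec_sq x).symm

theorem norm_nilVec_of_unitary {σ : FaithfulNormalTrace N} {F : Type*} [NormedAddCommGroup F]
    [InnerProductSpace ℂ F] (X : L2Space σ.toTrace F) {u : N} (h1 : star u * u = 1) :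
    ‖X.nilVec u‖ = 1 := by
  have h := X.norm_nilVec_sq u
  rw [h1, σ.toTrace.map_one] at h
  exact (pow_eq_one_iff_of_nonneg (norm_nonneg _) two_ne_zero).mp (by exact_mod_cast h)

namespace Inclusion

variable (ι : Inclusion M N)

theorem norm_apply_le (x : M) : ‖ι.toHom x‖ ≤ ‖x‖ := NonUnitalStarAlgHom.norm_apply_le ι.toHom x

theorem isNormalFun_comp {f : N → ℂ} (hf : IsNormalFun N f) :
    IsNormalFun M fun x => f (ι.toHom x) := by
  rw [isNormalFun_iff]
  intro l x hx hl hw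
  exact hf.tendsto ((ι.norm_apply_le x).trans hx) (hl.mono fun y hy => (ι.norm_apply_le y).trans hy)
    fun ξ η => isNormalFun_iff.mp (ι.normal ξ η) l x hx hl hw

theorem trace_apply {τ : FaithfulNormalTrace M}
    (hM : ∀ z ∈ Set.center M, ∃ c : ℂ, z = c • (1 : M)) (σ : FaithfulNormalTrace N) (x : M) :
    σ.toLin (ι.toHom x) = τ.toLin x := by
  have h := trace_unique (τ := τ) hM (t := σ.toLin ∘ₗ ι.toHom.toAlgHom.toLinearMap)
    (by simp [σ.map_one])
    (fun y => by
      have := trace_star_mul_self_nonneg σ (ι.toHom y)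
      rwa [← map_star, ← map_mul] at this)
    (fun x y => by
      have := σ.tracial (ι.toHom x) (ι.toHom y)
      rwa [← map_mul, ← map_mul] at this)
    (ι.isNormalFun_comp σ.normal)
  exact DFunLike.congr_fun h x

variable {σ : FaithfulNormalTrace N} {F : Type u} [NormedAddCommGroup F] [InnerProductSpace ℂ F]
  [CompleteSpace F] (X : L2Space σ.toTrace F)

/-- The `M`-`M`-bimodule `L²(N)`. -/
noncomputable def bimodule : Bimodule M F where
  left := X.left.comp ι.toHom
  right :=
    { toFun := fun x => X.right (MulOpposite.op (ι.toHom x.unop))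
      map_one' := by simp
      map_mul' := fun x y => by simp
      map_zero' := by simp
      map_add' := fun x y => by simp
      commutes' := fun r => by
        rw [MulOpposite.algebraMap_apply, MulOpposite.unop_op, AlgHomClass.commutes,
          ← MulOpposite.algebraMap_apply, AlgHomClass.commutes]
      map_star' := fun x => by simp [map_star] }
  left_normal ξ η := ι.isNormalFun_comp (X.isNormalFun_left σ.normal ξ η)
  right_normal ξ η := ι.isNormalFun_comp (X.isNormalFun_right σ.normal ξ η)
  comm x y := X.commute_left_right _ _

theorem bimodule_left (x : M) (v : F) : (ι.bimodule X).left x v = X.left (ι.toHom x) v := rfl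

theorem bimodule_right (x : M) (v : F) : (ι.bimodule X).right (MulOpposite.op x) v =
    X.right (MulOpposite.op (ι.toHom x)) v := rfl

/-- This is why unitaries are needed: uu* = 1 gives the left marginal and u*u = 1 the right one,
once the trace of `N` is known to restrict to τ. -/
theorem isTracial_nilVec {τ : FaithfulNormalTrace M}
    (hM : ∀ z ∈ Set.center M, ∃ c : ℂ, z = c • (1 : M)) {u : N} (h1 : star u * u = 1)
    (h2 : u * star u = 1) : (ι.bimodule X).IsTracial τ (X.nilVec u) := by
  refine ⟨fun x => ?_, fun x => ?_⟩
  · rw [bimodule_left, X.left_nilVec, X.inner_nilVec, σ.toTrace.tracial, mul_assoc, h2, mul_one]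
    exact ι.trace_apply hM σ x
  · rw [bimodule_right, X.right_nilVec, X.inner_nilVec, ← mul_assoc, h1, one_mul]
    exact ι.trace_apply hM σ x

theorem norm_commutator_nilVec (m : M) (u : N) : ‖(ι.bimodule X).left m (X.nilVec u) -
    (ι.bimodule X).right (MulOpposite.op m) (X.nilVec u)‖ =
      ‖X.nilVec (ι.toHom m * u - u * ι.toHom m)‖ := by
  rw [bimodule_left, bimodule_right, X.left_nilVec, X.right_nilVec, map_sub]

end Inclusion

/-! ### Conjugation on L². -/

namespace FockSpace

section Conj

variable {A : Type u} [CStarAlgebra A] {τ : FaithfulTrace A} {ι : Type} [DecidableEq ι]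
  {φ : ι → Covariance τ} {F : Type*} [NormedAddCommGroup F] [InnerProductSpace ℂ F]
  [CompleteSpace F] (X : FockSpace φ F)

/-- Conjugation by `w`. -/
noncomputable def conj (w : A) : F →L[ℂ] F := X.left w * X.right (MulOpposite.op (star w))

theorem conj_nilVec (w a : A) : X.conj w (X.nilVec a) = X.nilVec (w * a * star w) := by
  rw [conj, mul_apply_eq_comp, right_nilVec, left_nilVec, mul_assoc]

theorem conj_conj (v w : A) (η : F) : X.conj v (X.conj w η) = X.conj (v * w) η := by
  simp only [conj, mul_apply_eq_comp, star_mul, MulOpposite.op_mul, map_mul]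
  congr 1
  exact DFunLike.congr_fun (X.commute_left_right w (MulOpposite.op (star v))).symm _

theorem conj_one (η : F) : X.conj 1 η = η := by simp [conj]

theorem norm_conj_le {w : A} (hw : star w * w = 1) (η : F) : ‖X.conj w η‖ ≤ ‖η‖ := by
  have h := norm_le_one_of_star_mul_self hw
  rw [conj, mul_apply_eq_comp]
  have h1 := (X.left w).le_of_opNorm_le ((X.norm_left_le w).trans h)
    (X.right (MulOpposite.op (star w)) η)
  have h2 := (X.right (MulOpposite.op (star w))).le_of_opNorm_le ((X.norm_right_le _).trans
    (show ‖MulOpposite.op (star w)‖ ≤ 1 by rwa [MulOpposite.norm_op, norm_star])) η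
  linarith

end Conj

end FockSpace

namespace Inclusion

variable (ι : Inclusion M N) {σ : FaithfulNormalTrace N} {F : Type u} [NormedAddCommGroup F]
  [InnerProductSpace ℂ F] [CompleteSpace F] (X : L2Space σ.toTrace F)

theorem map_unitary {w : M} (hw : w ∈ unitary M) :
    star (ι.toHom w) * ι.toHom w = 1 ∧ ι.toHom w * star (ι.toHom w) = 1 := by
  rw [← map_star, ← map_mul, ← map_mul, (Unitary.mem_iff.mp hw).1, (Unitary.mem_iff.mp hw).2,
    map_one]
  exact ⟨rfl, rfl⟩

theorem conj_of_isCentral {η : F} (hη : (ι.bimodule X).IsCentral η) {w : M} (hw : w ∈ unitary M) :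
    X.conj (ι.toHom w) η = η := by
  have h := hη (star w)
  rw [bimodule_left, bimodule_right, map_star] at h
  rw [FockSpace.conj, mul_apply_eq_comp, ← h, ← mul_apply_eq_comp, ← map_mul, (ι.map_unitary hw).2,
    map_one]
  rfl

theorem exists_norm_conj_sub_le {τ : FaithfulNormalTrace M} (hT : HasPropertyT τ)
    (hM : ∀ z ∈ Set.center M, ∃ c : ℂ, z = c • (1 : M)) (C : ℝ) {δ : ℝ} (hδ : 0 < δ) :
    ∃ (S : Finset M) (ε : ℝ), 0 < ε ∧ ∀ a : N, IsSelfAdjoint a → ‖a‖ ≤ C →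
      (∀ m ∈ S, ‖X.nilVec (ι.toHom m * a - a * ι.toHom m)‖ ≤ ε) →
      ∀ w ∈ unitary M, ‖X.conj (ι.toHom w) (X.nilVec a) - X.nilVec a‖ ≤ δ := by
  -- Conjugation moves the Cayley transform by at most twice this distance, and returning to a
  -- multiplies by at most (|C| + 1)²/2, for a total of δ. Taking ε/2 below absorbs the factor 2 in
  -- the Cayley commutator bound.
  obtain ⟨S, ε, hε, h⟩ := hT (δ / ((|C| + 1) ^ 2)) (by positivity)
  refine ⟨S, ε / 2, by positivity, fun a ha hC hS w hw => ?_⟩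
  obtain ⟨r, h1, h2⟩ := exists_resolvent ha
  obtain ⟨hu1, hu2⟩ := star_cayley_mul_self ha h1 h2
  obtain ⟨η, hη, hle⟩ := h F (ι.bimodule X) (X.nilVec (cayley r)) (norm_nilVec_of_unitary X hu1)
    (ι.isTracial_nilVec X hM hu1 hu2) (fun m hm => by
      rw [norm_commutator_nilVec]
      have := X.norm_nilVec_commutator_cayley_le ha h1 h2 (ι.toHom m)
      linarith [hS m hm])
  obtain ⟨hw1, hw2⟩ := ι.map_unitary hw
  have h3 := X.norm_nilVec_conj_sub_le h1 h2 hw1 hw2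
  rw [map_sub, ← X.conj_nilVec, map_sub, ← X.conj_nilVec] at h3
  have h4 : ‖X.conj (ι.toHom w) (X.nilVec (cayley r)) - X.nilVec (cayley r)‖ ≤
      2 * (δ / ((|C| + 1) ^ 2)) := by
    have e : X.conj (ι.toHom w) (X.nilVec (cayley r)) - X.nilVec (cayley r) =
        (η - X.nilVec (cayley r)) - X.conj (ι.toHom w) (η - X.nilVec (cayley r)) := by
      rw [map_sub, ι.conj_of_isCentral X hη hw]
      abel
    rw [e]
    have := X.norm_conj_le hw1 (η - X.nilVec (cayley r))
    linarith [norm_sub_le (η - X.nilVec (cayley r)) (X.conj (ι.toHom w) (η - X.nilVec (cayley r)))]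
  have h5 : (‖a‖ + 1) ^ 2 ≤ (|C| + 1) ^ 2 := by
    have := hC.trans (le_abs_self C)
    gcongr
  have hpos : (0 : ℝ) < (|C| + 1) ^ 2 := by positivity
  calc _ ≤ (‖a‖ + 1) ^ 2 / 2 * _ := h3
    _ ≤ (|C| + 1) ^ 2 / 2 * (2 * (δ / ((|C| + 1) ^ 2))) := by gcongr
    _ = δ := by field_simp

end Inclusion

end Inclusion

/-! ### Property (T) implies weak spectral gap -/

/-- Uniqueness, from the parallelogram law, makes the minimiser fixed by every contraction
preserving the set. -/
theorem exists_norm_minimal {F : Type*} [NormedAddCommGroup F] [InnerProductSpace ℂ F]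
    [CompleteSpace F] {Q : Set F} (hne : Q.Nonempty) (hcl : IsClosed Q) (hconv : Convex ℝ Q) :
    ∃ η ∈ Q, ∀ ζ ∈ Q, ‖ζ‖ ≤ ‖η‖ → ζ = η := by
  let _ := InnerProductSpace.rclikeToReal ℂ F
  obtain ⟨η, hη, hmin⟩ := exists_norm_eq_iInf_of_complete_convex hne hcl.isComplete hconv 0
  refine ⟨η, hη, fun ζ hζ hle => ?_⟩
  have hb : BddBelow (Set.range fun w : Q => ‖(0 : F) - w‖) :=
    ⟨0, by rintro _ ⟨w, rfl⟩; exact norm_nonneg _⟩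
  have hmid : (1 / 2 : ℝ) • ζ + (1 / 2 : ℝ) • η ∈ Q :=
    hconv hζ hη (by norm_num) (by norm_num) (by norm_num)
  have h1 := ciInf_le hb ⟨_, hmid⟩
  have h1' : ‖η‖ ≤ ‖(1 / 2 : ℝ) • ζ + (1 / 2 : ℝ) • η‖ := by
    rw [← hmin] at h1
    simpa only [zero_sub, norm_neg] using h1
  rw [← smul_add, norm_smul, Real.norm_of_nonneg (by norm_num : (0 : ℝ) ≤ 1 / 2)] at h1'
  have h2 := parallelogram_law_with_norm ℂ ζ η
  have h3 : ‖ζ - η‖ ^ 2 ≤ 0 := by nlinarith [norm_nonneg ζ, norm_nonneg η, norm_nonneg (ζ + η)]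
  have h4 : ‖ζ - η‖ = 0 := by nlinarith [norm_nonneg (ζ - η)]
  exact sub_eq_zero.mp (norm_eq_zero.mp h4)

/-- Choosing at each n a minimiser up to 1/(n+1) avoids a diagonal argument over ε. -/
theorem exists_tendsto_zero_of_eventually {B : Type*} [Nonempty B] {f : ℕ → B → ℝ}
    (hf : ∀ n b, 0 ≤ f n b) {l : Filter ℕ} (hl : l ≤ atTop)
    (h : ∀ ε > 0, ∀ᶠ n in l, ∃ b, f n b ≤ ε) :
    ∃ y : ℕ → B, Tendsto (fun n => f n (y n)) l (𝓝 0) := by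
  have hex : ∀ n : ℕ, ∃ b, f n b < (⨅ b, f n b) + 1 / ((n : ℝ) + 1) := fun n =>
    exists_lt_of_ciInf_lt (lt_add_of_pos_right _ (by positivity))
  choose y hy using hex
  have h0 : ∀ n, 0 ≤ ⨅ b, f n b := fun n => Real.iInf_nonneg (hf n)
  have h1 : Tendsto (fun n => ⨅ b, f n b) l (𝓝 0) := by
    rw [Metric.tendsto_nhds]
    intro ε hε
    filter_upwards [h (ε / 2) (by positivity)] with n ⟨b, hb⟩
    rw [Real.dist_eq, sub_zero, abs_of_nonneg (h0 n)]
    have := ciInf_le (f := f n) ⟨0, by rintro _ ⟨b, rfl⟩; exact hf n b⟩ b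
    linarith
  have h2 := h1.add (tendsto_one_div_add_atTop_nhds_zero_nat.mono_left hl)
  rw [add_zero] at h2
  exact ⟨y, squeeze_zero (fun n => hf n _) (fun n => (hy n).le) h2⟩

section Inclusion

variable {H : Type u} [NormedAddCommGroup H] [InnerProductSpace ℂ H] [CompleteSpace H]
  {K : Type u} [NormedAddCommGroup K] [InnerProductSpace ℂ K] [CompleteSpace K]
  {M : VonNeumannAlgebra H} {N : VonNeumannAlgebra K}
  {σ : FaithfulNormalTrace N} {F : Type u} [NormedAddCommGroup F] [InnerProductSpace ℂ F]
  (X : L2Space σ.toTrace F)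

namespace L2Space

theorem isClosed_image_ball (C : ℝ) : IsClosed (X.nilVec '' {x | ‖x‖ ≤ C}) := by
  refine isClosed_of_closure_subset fun η hη => ?_
  obtain ⟨s, hs, hlim⟩ := mem_closure_iff_seq_limit.mp hη
  choose h hC he using hs
  obtain ⟨x, hx, hxy⟩ := exists_trace_eq_of_tendsto (τ := σ.toTrace) σ.normal hC
    (L := fun y => inner ℂ (X.nilVec (star y)) η) (fun y => by
      have h1 : Tendsto (fun n => inner ℂ (X.nilVec (star y)) (s n)) atTop
          (𝓝 (inner ℂ (X.nilVec (star y)) η)) := tendsto_const_nhds.inner hlim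
      refine h1.congr fun n => ?_
      rw [← he, X.inner_nilVec, star_star])
  refine ⟨x, hx, X.total.ext_inner_right fun w => ?_⟩
  cases w with
  | nil y =>
    change inner ℂ (X.nilVec y) _ = inner ℂ (X.nilVec y) _
    rw [X.inner_nilVec, hxy, star_star]
  | cons x n w => exact n.elim

theorem convex_image_ball (C : ℝ) : Convex ℝ (X.nilVec '' {x | ‖x‖ ≤ C}) := by
  rintro _ ⟨x, hx, rfl⟩ _ ⟨y, hy, rfl⟩ s t hs ht hst
  refine ⟨(s : ℂ) • x + (t : ℂ) • y, ?_, by simp⟩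
  refine (norm_add_le _ _).trans ?_
  rw [norm_smul, norm_smul, Complex.norm_real, Complex.norm_real, Real.norm_of_nonneg hs,
    Real.norm_of_nonneg ht]
  have h1 := mul_le_mul_of_nonneg_left (Set.mem_ofPred.mp hx) hs
  have h2 := mul_le_mul_of_nonneg_left (Set.mem_ofPred.mp hy) ht
  calc _ ≤ s * C + t * C := add_le_add h1 h2
    _ = C := by rw [← add_mul, hst, one_mul]

end L2Space

namespace Inclusion

variable (ι : Inclusion M N)

theorem norm_commutator_star (m : M) (x : N) :
    ‖X.nilVec (ι.toHom m * star x - star x * ι.toHom m)‖ =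
      ‖X.nilVec (ι.toHom (star m) * x - x * ι.toHom (star m))‖ := by
  rw [← X.norm_nilVec_star, ← norm_neg, ← map_neg, map_star]
  simp

variable [CompleteSpace F]

theorem mem_centralizer_of_conj {b : N}
    (h : ∀ w ∈ unitary M, X.conj (ι.toHom w) (X.nilVec b) = X.nilVec b) :
    b ∈ Set.centralizer (Set.range ι.toHom) := by
  rintro _ ⟨m, rfl⟩
  have hm : m ∈ Submodule.span ℂ (unitary M : Set M) := by
    rw [CStarAlgebra.span_unitary]; trivial
  induction hm using Submodule.span_induction with
  | mem w hw =>
    have h1 := h w hw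
    rw [X.conj_nilVec] at h1
    have h2 := X.nilVec_injective h1
    calc ι.toHom w * b = ι.toHom w * b * (star (ι.toHom w) * ι.toHom w) := by
          rw [(ι.map_unitary hw).1, mul_one]
      _ = b * ι.toHom w := by rw [← mul_assoc, h2]
  | zero => simp
  | add x y _ _ hx hy => rw [map_add, add_mul, mul_add, hx, hy]
  | smul c x _ hx => rw [map_smul, smul_mul_assoc, mul_smul_comm, hx]

/-- `Q` consists of the L² vectors of elements of norm at most ‖a‖ whose whole orbit under unitaries
of `M` stays within δ of a. It is closed, convex and invariant, so its vector of least norm is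
fixed; lying in the ball, it comes from an element of `N`. -/
theorem exists_mem_centralizer_of_conj {a : N} {δ : ℝ}
    (h : ∀ w ∈ unitary M, ‖X.conj (ι.toHom w) (X.nilVec a) - X.nilVec a‖ ≤ δ) :
    ∃ b ∈ Set.centralizer (Set.range ι.toHom), ‖b‖ ≤ ‖a‖ ∧ ‖X.nilVec (a - b)‖ ≤ δ := by
  let Q : Set F := (X.nilVec '' {x | ‖x‖ ≤ ‖a‖}) ∩
    ⋂ w : unitary M, X.conj (ι.toHom w) ⁻¹' Metric.closedBall (X.nilVec a) δ
  have hQ : ∀ η, η ∈ Q ↔ η ∈ X.nilVec '' {x | ‖x‖ ≤ ‖a‖} ∧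
      ∀ w ∈ unitary M, ‖X.conj (ι.toHom w) η - X.nilVec a‖ ≤ δ := by
    intro η
    simp [Q, dist_eq_norm]
  have hne : Q.Nonempty := ⟨X.nilVec a, (hQ _).mpr ⟨⟨a, le_refl ‖a‖, rfl⟩, h⟩⟩
  have hcl : IsClosed Q := (X.isClosed_image_ball _).inter
    (isClosed_iInter fun w => Metric.isClosed_closedBall.preimage (X.conj _).continuous)
  have hconv : Convex ℝ Q := (X.convex_image_ball _).inter
    (convex_iInter fun w => (convex_closedBall (X.nilVec a) δ).linear_preimage
      ((X.conj (ι.toHom w)).toLinearMap.restrictScalars ℝ))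
  obtain ⟨η, hη, hmin⟩ := exists_norm_minimal hne hcl hconv
  obtain ⟨⟨b, hb, rfl⟩, hball⟩ := (hQ η).mp hη
  refine ⟨b, ι.mem_centralizer_of_conj X fun v hv => ?_, hb, ?_⟩
  · refine hmin _ ((hQ _).mpr ⟨⟨ι.toHom v * b * star (ι.toHom v), ?_, (X.conj_nilVec _ _).symm⟩,
      fun w hw => ?_⟩) (X.norm_conj_le (ι.map_unitary hv).1 _)
    · have hv1 := norm_le_one_of_star_mul_self (ι.map_unitary hv).1
      refine (norm_mul_le _ _).trans ?_
      rw [norm_star]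
      refine (mul_le_of_le_one_right (norm_nonneg _) hv1).trans ?_
      refine (norm_mul_le _ _).trans ?_
      exact (mul_le_of_le_one_left (norm_nonneg _) hv1).trans hb
    · rw [X.conj_conj, ← map_mul]
      exact hball _ (mul_mem hw hv)
  -- The unitary 1 turns the orbit condition into the distance bound.
  · have h1 := hball 1 (one_mem _)
    rwa [map_one, X.conj_one, ← map_sub, ← norm_neg, ← map_neg, neg_sub] at h1

theorem exists_near_centralizer_of_isSelfAdjoint {τ : FaithfulNormalTrace M} (hT : HasPropertyT τ)
    (hM : ∀ z ∈ Set.center M, ∃ c : ℂ, z = c • (1 : M)) (C : ℝ) {δ : ℝ} (hδ : 0 < δ) :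
    ∃ (S : Finset M) (ε : ℝ), 0 < ε ∧ ∀ a : N, IsSelfAdjoint a → ‖a‖ ≤ C →
      (∀ m ∈ S, ‖X.nilVec (ι.toHom m * a - a * ι.toHom m)‖ ≤ ε) →
      ∃ b ∈ Set.centralizer (Set.range ι.toHom), ‖b‖ ≤ C ∧ ‖X.nilVec (a - b)‖ ≤ δ := by
  obtain ⟨S, ε, hε, h⟩ := ι.exists_norm_conj_sub_le X hT hM C hδ
  refine ⟨S, ε, hε, fun a ha hC hS => ?_⟩
  obtain ⟨b, hb, hba, hd⟩ := ι.exists_mem_centralizer_of_conj X (h a ha hC hS)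
  exact ⟨b, hb, hba.trans hC, hd⟩

theorem exists_near_centralizer {τ : FaithfulNormalTrace M} (hT : HasPropertyT τ)
    (hM : ∀ z ∈ Set.center M, ∃ c : ℂ, z = c • (1 : M)) (C : ℝ) {δ : ℝ} (hδ : 0 < δ) :
    ∃ (S : Finset M) (ε : ℝ), 0 < ε ∧ ∀ x : N, ‖x‖ ≤ C →
      (∀ m ∈ S, ‖X.nilVec (ι.toHom m * x - x * ι.toHom m)‖ ≤ ε) →
      ∃ b ∈ Set.centralizer (Set.range ι.toHom), ‖b‖ ≤ 2 * C ∧ ‖X.nilVec (x - b)‖ ≤ δ := by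
  classical
  obtain ⟨S, ε, hε, h⟩ := ι.exists_near_centralizer_of_isSelfAdjoint X hT hM C (half_pos hδ)
  -- The commutator of m with x* has the 2-norm of that of m* with x, so controlling the real part
  -- of x requires the adjoints of S.
  refine ⟨S ∪ S.image star, ε, hε, fun x hC hS => ?_⟩
  have hhalf : ‖(1 / 2 : ℂ)‖ = 1 / 2 := by norm_num
  have hre : ∀ c : ℂ, ‖c‖ = 1 → ∃ b ∈ Set.centralizer (Set.range ι.toHom), ‖b‖ ≤ C ∧
      ‖X.nilVec ((1 / 2 : ℂ) • (c • x + star (c • x)) - b)‖ ≤ δ / 2 := by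
    intro c hc
    have hcx : ‖c • x‖ ≤ C := by rwa [norm_smul, hc, one_mul]
    refine h _ ?_ ?_ fun m hm => ?_
    · rw [isSelfAdjoint_iff, star_smul, star_add, star_star, add_comm]
      simp
    · rw [norm_smul, hhalf]
      have := norm_add_le (c • x) (star (c • x))
      rw [norm_star] at this
      linarith
    · have hcm : ∀ m, ‖X.nilVec (ι.toHom m * (c • x) - (c • x) * ι.toHom m)‖ =
          ‖X.nilVec (ι.toHom m * x - x * ι.toHom m)‖ := by
        intro m
        rw [mul_smul_comm, smul_mul_assoc, ← smul_sub, map_smul, norm_smul, hc, one_mul]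
      have e : X.nilVec (ι.toHom m * ((1 / 2 : ℂ) • (c • x + star (c • x))) -
          ((1 / 2 : ℂ) • (c • x + star (c • x))) * ι.toHom m) =
          (1 / 2 : ℂ) • (X.nilVec (ι.toHom m * (c • x) - (c • x) * ι.toHom m) +
            X.nilVec (ι.toHom m * star (c • x) - star (c • x) * ι.toHom m)) := by
        rw [mul_smul_comm, smul_mul_assoc, ← smul_sub, map_smul, ← map_add, mul_add, add_mul,
          add_sub_add_comm]
      rw [e, norm_smul, hhalf]
      have h1 := norm_add_le (X.nilVec (ι.toHom m * (c • x) - (c • x) * ι.toHom m))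
        (X.nilVec (ι.toHom m * star (c • x) - star (c • x) * ι.toHom m))
      rw [norm_commutator_star, hcm, hcm] at h1
      have h2 := hS m (Finset.mem_union_left _ hm)
      have h3 := hS (star m) (Finset.mem_union_right _ (Finset.mem_image_of_mem _ hm))
      linarith
  obtain ⟨b, hb, hbC, hbd⟩ := hre 1 (by simp)
  -- The imaginary part of x is the real part of -ix.
  obtain ⟨b', hb', hbC', hbd'⟩ := hre (-Complex.I) (by simp)
  refine ⟨b + Complex.I • b', fun m hm => ?_, ?_, ?_⟩
  · rw [mul_add, add_mul, mul_smul_comm, smul_mul_assoc, hb m hm, hb' m hm]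
  · refine (norm_add_le _ _).trans ?_
    rw [norm_smul, Complex.norm_I]
    linarith
  · have e : x - (b + Complex.I • b') = ((1 / 2 : ℂ) • ((1 : ℂ) • x + star ((1 : ℂ) • x)) - b) +
        Complex.I • ((1 / 2 : ℂ) • ((-Complex.I) • x + star ((-Complex.I) • x)) - b') := by
      have hI : star (-Complex.I) = Complex.I := by simp
      simp only [star_smul, hI, star_one, smul_add, smul_sub, smul_smul]
      have h1 : Complex.I * (1 / 2 * -Complex.I) = 1 / 2 := by
        linear_combination (-1 / 2 : ℂ) * Complex.I_mul_I
      have h2 : Complex.I * (1 / 2 * Complex.I) = -(1 / 2) := by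
        linear_combination (1 / 2 : ℂ) * Complex.I_mul_I
      have h3 : x = (1 / 2 : ℂ) • x + (1 / 2 : ℂ) • x := by
        rw [← add_smul]; norm_num
      rw [h1, h2, mul_one, neg_smul]
      nth_rewrite 1 [h3]
      abel
    rw [e, map_add, map_smul]
    refine (norm_add_le _ _).trans ?_
    rw [norm_smul, Complex.norm_I]
    linarith

theorem hasWeakSpectralGap {ω : Ultrafilter ℕ} (hω : ∀ n : ℕ, ω ≠ pure n)
    {τ : FaithfulNormalTrace M} (hT : HasPropertyT τ)
    (hM : ∀ z ∈ Set.center M, ∃ c : ℂ, z = c • (1 : M)) : HasWeakSpectralGap ι σ ω := by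
  obtain ⟨F, j1, j2, j3, ⟨X⟩⟩ := exists_fockSpace
    fun n : Empty => (n.elim : Covariance σ.toTrace)
  refine Set.Subset.antisymm (fun z hz => ?_) ?_
  · obtain ⟨x, rfl⟩ := RingCon.mk'_surjective (nullIdeal σ ω).ringCon z
    obtain ⟨x, C, hC⟩ := x
    have hcomm : ∀ m : M, Tendsto (fun n => ‖X.nilVec (ι.toHom m * x n - x n * ι.toHom m)‖) ω
        (𝓝 0) := by
      intro m
      have := (mk_commute_iff σ ω ⟨x, C, hC⟩ (ι.toHom m)).mp (hz _ ⟨m, rfl⟩)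
      simpa only [norm2_eq_norm_nilVec X] using this
    -- The norm bound is part of the choice, so the selected elements form a bounded sequence and
    -- define a class in the ultrapower.
    let B := {b : N // b ∈ Set.centralizer (Set.range ι.toHom) ∧ ‖b‖ ≤ 2 * C}
    have hC0 : 0 ≤ C := (norm_nonneg _).trans (hC 0)
    have _ : Nonempty B := ⟨⟨0, Set.zero_mem_centralizer, by rw [norm_zero]; positivity⟩⟩
    obtain ⟨y, hy⟩ := exists_tendsto_zero_of_eventually (B := B)
      (f := fun n b => ‖X.nilVec (x n - b.1)‖) (fun n b => norm_nonneg _)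
      (ultrafilter_le_atTop hω) (fun δ hδ => by
        obtain ⟨S, ε, hε, h⟩ := ι.exists_near_centralizer X hT hM C hδ
        have h1 : ∀ᶠ n in (ω : Filter ℕ), ∀ m ∈ S,
            ‖X.nilVec (ι.toHom m * x n - x n * ι.toHom m)‖ ≤ ε :=
          (Finset.eventually_all S).mpr fun m _ =>
            ((tendsto_order.mp (hcomm m)).2 ε hε).mono fun n hn => hn.le
        filter_upwards [h1] with n hn
        obtain ⟨b, hb, hbC, hbd⟩ := h (x n) (hC n) hn
        exact ⟨⟨b, hb, hbC⟩, hbd⟩)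
    refine ⟨⟨fun n => (y n).1, 2 * C, fun n => (y n).2.2⟩, fun n => (y n).2.1, ?_⟩
    refine ((mk_eq_mk_iff σ ω ⟨x, C, hC⟩ _).mpr ?_).symm
    simpa only [norm2_eq_norm_nilVec X] using hy
  · rintro _ ⟨y, hy, rfl⟩ _ ⟨m, rfl⟩
    refine (mk_commute_iff σ ω y (ι.toHom m)).mpr ?_
    have h0 : ∀ n, norm2 σ (ι.toHom m * y.1 n - y.1 n * ι.toHom m) = 0 := fun n => by
      rw [hy n _ ⟨m, rfl⟩, sub_self]
      simp [norm2]
    simpa only [h0] using tendsto_const_nhds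

end Inclusion

end Inclusion

end TracialVN

theorem theorem1p1 (ω : Ultrafilter ℕ) (hω : ∀ n : ℕ, ω ≠ pure n)
    {H : Type u} [NormedAddCommGroup H] [InnerProductSpace ℂ H] [CompleteSpace H]
    (M : VonNeumannAlgebra H) (τ : TracialVN.FaithfulNormalTrace M)
    (hM : TracialVN.IsII1Factor M τ) (hsep : TracialVN.IsSeparableVN τ) :
    TracialVN.HasPropertyT τ ↔
      ∀ (K : Type u) [NormedAddCommGroup K] [InnerProductSpace ℂ K] [CompleteSpace K]
        (N : VonNeumannAlgebra K) (σ : TracialVN.FaithfulNormalTrace N)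
        (ι : TracialVN.Inclusion M N),
        TracialVN.HasWeakSpectralGap ι σ ω :=
  ⟨fun hT _ _ _ _ _ _ ι => ι.hasWeakSpectralGap hω hT hM.2,
    fun h => TracialVN.hasPropertyT_of_hasWeakSpectralGap hω hsep h⟩
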